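/- Let $n\ge 3$ and let $M$ be a smooth connected $n$-manifold, possibly with compact boundary. Fix $r_0>0$, a compact set $K\subset M$ and a diffeomorphism $\Phi:M\setminus K\to\{x\in\mathbb{R}^n:|x|>r_0\}$ that extends to a smooth coordinate chart of $M$ onto an open neighbourhood of $\{|x|\ge r_0\}$. All components $g_{ij}$ and partial derivatives on $M\setminus K$ are taken in this coordinate system. For a $C^2$ function $f$ on $M\setminus K$ let $$\|f\|_{C^2_{-\tau}(M\setminus K)}=\sum_{|\gamma|\le 2}\ \sup_{|x|>r_0}|x|^{|\gamma|+\tau}\,|\partial^\gamma f(x)| .$$ Let $\mathrm{Met}^2_{-\tau}(M)$ be the set of $C^2$ Riemannian metrics $g$ on $M$ with $\|g_{ij}-\delta_{ij}\|_{C^2_{-\tau}(M\setminus K)}<\infty$ for all $i,j$. Say that $g^\ell\to g$ in $\mathrm{Met}^2_{-\tau}(M)$ if $\|g^\ell_{ij}-g_{ij}\|_{C^2_{-\tau}(M\setminus K)}\to 0$ for all $i,j$ and the tensors $g^\ell$ converge to $g$ in $C^2$ on $K$. Let $R(g)$ and $dV_g$ be the scalar curvature and the volume measure of $g$, let $\omega_{n-1}$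 be the area of the unit sphere in $\mathbb{R}^n$, and let $$m_{ADM}(M,g)=\frac{1}{2(n-1)\omega_{n-1}}\lim_{r\to\infty}\int_{\{|x|=r\}}\sum_{i,j=1}^n(\partial_i g_{ij}-\partial_j g_{ii})\frac{x^j}{r}\,dA,$$ where $dA$ is the Euclidean surface measure. **Theorem.** Let $\tau>\frac{n-2}{2}$, let $g^\ell$ $(\ell=1,2,\dots)$ and $g$ be metrics in $\mathrm{Met}^2_{-\tau}(M)$ whose scalar curvatures are integrable, and suppose that $g^\ell\to g$ in $\mathrm{Met}^2_{-\tau}(M)$. Then the limits defining $m_{ADM}(M,g^\ell)$ and $m_{ADM}(M,g)$ exist and are finite, and $$\lim_{\ell\to\infty}\left(m_{ADM}(M,g^\ell)-\frac{1}{2(n-1)\omega_{n-1}}\int_M R(g^\ell)\,dV_{g^\ell}\right)=m_{ADM}(M,g)-\frac{1}{2(n-1)\omega_{n-1}}\int_M R(g)\,dV_g .$$ Moreover, if $R(g^\ell)\ge 0$ for all $\ell$, then $$\liminf_{\ell\to\infty}m_{ADM}(M,g^\ell)\ \ge\ m_{ADM}(M,g),$$ where the left-hand side may be $+\infty$. 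-/

import Mathlib

open Set Filter Topology MeasureTheory
open scoped Manifold ContDiff ENNReal

noncomputable section

namespace ADM

/-! ### Coordinate formulas on a set `S ⊆ ℝⁿ`

`S` is the range of a coordinate chart: an open subset of `ℝⁿ`, or a relatively open subset of a
half-space if the chart meets the boundary. All derivatives are taken within `S`. -/

section Coordinates

variable {n : ℕ}

/-- The partial derivative `∂ᵢ f` within `S`. -/
def pderiv (S : Set (EuclideanSpace ℝ (Fin n))) (i : Fin n)
    (f : EuclideanSpace ℝ (Fin n) → ℝ) (y : EuclideanSpace ℝ (Fin n)) : ℝ :=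
  fderivWithin ℝ f S y (EuclideanSpace.single i 1)

/-- The Christoffel symbol `Γᵏᵢⱼ = ½ ∑ₘ gᵏᵐ (∂ᵢ gₘⱼ + ∂ⱼ gₘᵢ - ∂ₘ gᵢⱼ)` of the matrix valued
function `G = (gᵢⱼ)`. -/
def christoffel (S : Set (EuclideanSpace ℝ (Fin n)))
    (G : EuclideanSpace ℝ (Fin n) → Matrix (Fin n) (Fin n) ℝ) (k i j : Fin n)
    (y : EuclideanSpace ℝ (Fin n)) : ℝ :=
  (1 / 2) * ∑ m, (G y)⁻¹ k m *
    (pderiv S i (fun z => G z m j) y + pderiv S j (fun z => G z m i) y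
      - pderiv S m (fun z => G z i j) y)

/-- The scalar curvature
`gʲᵏ (∂ᵢ Γⁱⱼₖ - ∂ₖ Γⁱᵢⱼ + Γᵐⱼₖ Γⁱᵢₘ - Γᵐᵢⱼ Γⁱₖₘ)` of the metric with components `G`. -/
def coordScalarCurvature (S : Set (EuclideanSpace ℝ (Fin n)))
    (G : EuclideanSpace ℝ (Fin n) → Matrix (Fin n) (Fin n) ℝ)
    (y : EuclideanSpace ℝ (Fin n)) : ℝ :=
  ∑ j, ∑ k, (G y)⁻¹ j k * ∑ i,
    (pderiv S i (christoffel S G i j k) y - pderiv S k (christoffel S G i i j) y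
      + ∑ m, (christoffel S G m j k y * christoffel S G i i m y
          - christoffel S G m i j y * christoffel S G i k m y))

/-- The exterior region `{x ∈ ℝⁿ : |x| > r₀}`. -/
def exterior (n : ℕ) (r₀ : ℝ) : Set (EuclideanSpace ℝ (Fin n)) := {x | r₀ < ‖x‖}

/-- The weighted norm `∑_{|γ| ≤ 2} sup_{|x| > r₀} |x|^{|γ| + τ} |∂^γ f(x)|`, possibly infinite.
The multi-indices of order two are the pairs `i ≤ j`. -/
def weightedC2Norm (r₀ τ : ℝ) (f : EuclideanSpace ℝ (Fin n) → ℝ) : ℝ≥0∞ :=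
  (⨆ x ∈ exterior n r₀, ENNReal.ofReal (‖x‖ ^ τ * |f x|))
  + (∑ i, ⨆ x ∈ exterior n r₀,
      ENNReal.ofReal (‖x‖ ^ (1 + τ) * |pderiv (exterior n r₀) i f x|))
  + ∑ i, ∑ j ∈ Finset.Ici i, ⨆ x ∈ exterior n r₀,
      ENNReal.ofReal
        (‖x‖ ^ (2 + τ) * |pderiv (exterior n r₀) i (pderiv (exterior n r₀) j f) x|)

/-- The area `ω_{n-1}` of the unit sphere in `ℝⁿ`. -/
def unitSphereArea (n : ℕ) : ℝ :=
  (volume : Measure (EuclideanSpace ℝ (Fin n))).toSphere.real univ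

/-- The integral `∫_{S_r} F dA` over the sphere `S_r = {|x| = r}` with respect to the Euclidean
surface measure. -/
def sphereIntegral (r : ℝ) (F : EuclideanSpace ℝ (Fin n) → ℝ) : ℝ :=
  r ^ (n - 1) * ∫ u : Metric.sphere (0 : EuclideanSpace ℝ (Fin n)) 1,
    F (r • (u : EuclideanSpace ℝ (Fin n)))
      ∂(volume : Measure (EuclideanSpace ℝ (Fin n))).toSphere

end Coordinates

/-! ### `C²` Riemannian metrics on a manifold, possibly with boundary -/

section Manifolds

variable {n : ℕ} {H : Type*} [TopologicalSpace H]
  (I : ModelWithCorners ℝ (EuclideanSpace ℝ (Fin n)) H)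
  (M : Type*) [TopologicalSpace M] [ChartedSpace H M] [IsManifold I ∞ M]

/-- Riemannian metrics of class `C²` on `M`. -/
abbrev C2Metric : Type _ :=
  Bundle.ContMDiffRiemannianMetric I 2 (EuclideanSpace ℝ (Fin n))
    (fun x : M => TangentSpace I x)

variable {I M}

/-- The components `gᵢⱼ` of `g` in the coordinates whose inverse is the parametrization
`ψ : S → M`, that is, `g (∂ᵢψ, ∂ⱼψ)`. -/
def coordMetric (g : C2Metric I M) (ψ : EuclideanSpace ℝ (Fin n) → M)
    (S : Set (EuclideanSpace ℝ (Fin n))) (y : EuclideanSpace ℝ (Fin n)) :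
    Matrix (Fin n) (Fin n) ℝ :=
  Matrix.of fun i j =>
    g.inner (ψ y)
      (mfderivWithin 𝓘(ℝ, EuclideanSpace ℝ (Fin n)) I ψ S y
        (EuclideanSpace.single i (1 : ℝ) : EuclideanSpace ℝ (Fin n)))
      (mfderivWithin 𝓘(ℝ, EuclideanSpace ℝ (Fin n)) I ψ S y
        (EuclideanSpace.single j (1 : ℝ) : EuclideanSpace ℝ (Fin n)))

/-- The components of `g` in the preferred chart at `p`. -/
def chartMetric (g : C2Metric I M) (p : M) :
    EuclideanSpace ℝ (Fin n) → Matrix (Fin n) (Fin n) ℝ :=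
  coordMetric g (extChartAt I p).symm (extChartAt I p).target

/-- The scalar curvature of `g` at `p`, computed in the preferred chart at `p`. -/
def scalarCurvature (g : C2Metric I M) (p : M) : ℝ :=
  coordScalarCurvature (extChartAt I p).target (chartMetric g p) (extChartAt I p p)

/-- The Riemannian volume measure of `g`: the least measure that dominates, for each `p`, the
measure `√(det gᵢⱼ) dx` of the preferred chart at `p`. As these measures agree on overlaps of
charts, it coincides with each of them on the domain of the chart. -/
def volumeMeasure [MeasurableSpace M] (g : C2Metric I M) : Measure M :=
  ⨆ p : M, Measure.map (extChartAt I p).symm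
    ((volume.restrict (extChartAt I p).target).withDensity
      fun y => ENNReal.ofReal (Real.sqrt (chartMetric g p y).det))

/-- The tensors `gs ℓ` converge to `g` in `C²` on the set `K`: in each chart, the components and
their first and second derivatives converge uniformly on compact subsets of `K`. -/
def C2ConvergesOn (K : Set M) (gs : ℕ → C2Metric I M) (g : C2Metric I M) : Prop :=
  ∀ p : M, ∀ C : Set M, IsCompact C → C ⊆ K ∩ (chartAt H p).source →
    ∀ i j : Fin n, ∀ m : ℕ, m ≤ 2 →
      TendstoUniformlyOn
        (fun ℓ => iteratedFDerivWithin ℝ m (fun y => chartMetric (gs ℓ) p y i j)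
          (extChartAt I p).target)
        (iteratedFDerivWithin ℝ m (fun y => chartMetric g p y i j) (extChartAt I p).target)
        atTop (extChartAt I p '' C)

/-! ### The asymptotic end, weighted convergence and the ADM mass -/

variable (I M)

/-- The fixed coordinate system at infinity: a smooth coordinate chart `Φ` of `M` onto an open
neighbourhood of `{x : |x| ≥ r₀}` such that the set `K` of points of `M` outside
`Φ⁻¹ {x : |x| > r₀}` is compact. -/
structure EndChart where
  /-- the chart `Φ` -/
  chart : OpenPartialHomeomorph M (EuclideanSpace ℝ (Fin n))
  /-- the radius of the ball removed from `ℝⁿ` -/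
  r₀ : ℝ
  r₀_pos : 0 < r₀
  subset_target : {x : EuclideanSpace ℝ (Fin n) | r₀ ≤ ‖x‖} ⊆ chart.target
  contMDiffOn : ContMDiffOn I 𝓘(ℝ, EuclideanSpace ℝ (Fin n)) ∞ chart chart.source
  contMDiffOn_symm : ContMDiffOn 𝓘(ℝ, EuclideanSpace ℝ (Fin n)) I ∞ chart.symm chart.target
  isCompact_core : IsCompact (chart.source ∩ chart ⁻¹' exterior n r₀)ᶜ

variable {I M}

/-- The compact set `K`, with `Φ : M \ K → {x : |x| > r₀}`. -/
def EndChart.core (Φ : EndChart I M) : Set M :=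
  (Φ.chart.source ∩ Φ.chart ⁻¹' exterior n Φ.r₀)ᶜ

/-- The components `gᵢⱼ` in the coordinates at infinity, as functions on `{x : |x| > r₀}`. -/
def endMetric (Φ : EndChart I M) (g : C2Metric I M) :
    EuclideanSpace ℝ (Fin n) → Matrix (Fin n) (Fin n) ℝ :=
  coordMetric g Φ.chart.symm (exterior n Φ.r₀)

/-- `g` belongs to `Met²_{-τ}(M)`: `gᵢⱼ - δᵢⱼ ∈ C²_{-τ}(M \ K)` for all `i`, `j`. -/
def MemMet (Φ : EndChart I M) (τ : ℝ) (g : C2Metric I M) : Prop :=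
  ∀ i j : Fin n,
    weightedC2Norm Φ.r₀ τ (fun x => endMetric Φ g x i j - (1 : Matrix (Fin n) (Fin n) ℝ) i j) < ⊤

/-- Convergence in `Met²_{-τ}(M)`. -/
def MetConverges (Φ : EndChart I M) (τ : ℝ) (gs : ℕ → C2Metric I M) (g : C2Metric I M) : Prop :=
  (∀ i j : Fin n, Tendsto
    (fun ℓ => weightedC2Norm Φ.r₀ τ (fun x => endMetric Φ (gs ℓ) x i j - endMetric Φ g x i j))
    atTop (𝓝 0)) ∧
  C2ConvergesOn Φ.core gs g

/-- `g` is an asymptotically flat metric in `Met²_{-τ}(M)`: it lies in `Met²_{-τ}(M)` and its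
scalar curvature is integrable. -/
def IsAsymptoticallyFlat [MeasurableSpace M] (Φ : EndChart I M) (τ : ℝ) (g : C2Metric I M) :
    Prop :=
  MemMet Φ τ g ∧ Integrable (scalarCurvature g) (volumeMeasure g)

/-- The quantity
`1 / (2 (n-1) ω_{n-1}) ∫_{S_r} ∑ᵢⱼ (∂ᵢ gᵢⱼ - ∂ⱼ gᵢᵢ) xʲ / r dA`. -/
def admFlux (Φ : EndChart I M) (g : C2Metric I M) (r : ℝ) : ℝ :=
  1 / (2 * ((n : ℝ) - 1) * unitSphereArea n) *
    sphereIntegral r fun x => ∑ i, ∑ j,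
      (pderiv (exterior n Φ.r₀) i (fun z => endMetric Φ g z i j) x
        - pderiv (exterior n Φ.r₀) j (fun z => endMetric Φ g z i i) x) * (x j / r)

/-- The ADM mass, the limit of `admFlux Φ g r` as `r → ∞`. -/
def admMass (Φ : EndChart I M) (g : C2Metric I M) : ℝ :=
  limUnder atTop (admFlux Φ g)

/-- The integral `∫_M R(g) dV_g`. -/
def totalScalarCurvature [MeasurableSpace M] (g : C2Metric I M) : ℝ :=
  ∫ x, scalarCurvature g x ∂(volumeMeasure g)

end Manifolds

end ADM

end

/-! On the end, let `V` be the vector field `Vⱼ = ∑ᵢ (∂ᵢ gᵢⱼ - ∂ⱼ gᵢᵢ)` (`massField`), whose flux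
through large spheres defines the mass. The scalar curvature is a polynomial in `g⁻¹`, `∂g`, `∂²g`,
and its linearization at the flat metric is `div V`. What is left is quadratic, of the form `(g - δ)
∂²g` or `∂g ∂g`, hence `O(|x|^(-2-2τ))`, and this persists for the density `R √det g`. Since `τ >
(n-2)/2` says `2 + 2τ > n`, the error is integrable on the end, with one dominating function for all
large `ℓ` (`isBigO_scalarDensity_sub_divergence`). So `div V` is integrable when `R` is, and the
divergence theorem in annuli shows that the flux converges.

Fix `r₁ > r₀`. The mass, up to its normalizing factor, is the flux of `V` through `|x| = r₁` plus
the integral of `div V` outside. Subtracting `∫ R dV` cancels this integral and leaves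
(`admMass_sub_totalScalarCurvature`) flux through `|x| = r₁`, minus `∫_K R dV`, minus `∫ (R √det g -
div V)` over the end, minus `∫ div V` over `r₀ < |x| ≤ r₁`. Each of the four terms is continuous in
`g`: dominated convergence applies on the end, on the annulus and on the sphere, and `C²`
convergence on the compact set `K`. The tail of `∫ div V`, which the weighted norm alone does not
dominate, has disappeared. If `R(g^ℓ) ≥ 0`, Fatou's lemma on the end makes `∫ R dV` lower
semicontinuous, and adding this to the continuity of the difference gives the inequality for the
mass.

Two foundations take up much of the space. First, `scalarCurvature` is defined at each point in a
chart that depends on the point, and `volumeMeasure` is a supremum over charts; to compute `∫ R dV`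
in one coordinate system both must be shown independent of coordinates
(`IsParam.scalarCurvature_eq`, `IsParam.volumeMeasure_restrict_image`). For curvature this is the
classical argument: the Koszul formula determines how Christoffel symbols transform, so the
curvature is a tensor and its traces are invariant. Charts may meet the boundary, so all derivatives
are taken within sets. Second, the divergence theorem in an annulus is derived from polar
coordinates: testing with radial cutoffs shows that `r ↦ ∫_{S_r} div V` is the weak derivative of
the flux, and both functions are continuous. -/

noncomputable section

namespace ADM

/-! ### Transformation of connections and their curvature under coordinate changes -/

section Connections

variable {E : Type*} [NormedAddCommGroup E] [NormedSpace ℝ E]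

/-- The curvature `R(u, v) w` of the connection on `S ⊆ E` with Christoffel symbols `Γ`. -/
def connectionCurvature (S : Set E) (Γ : E → E →L[ℝ] E →L[ℝ] E) (y u v w : E) : E :=
  fderivWithin ℝ Γ S y u v w - fderivWithin ℝ Γ S y v u w + Γ y u (Γ y v w) - Γ y v (Γ y u w)

/-- At a boundary point of `S` the symmetry is inherited from nearby interior points, which is why
`S` has to lie in the closure of its interior. Ranges of charts with boundary have this property. -/
lemma symm_sndFDerivWithin {F : Type*} [NormedAddCommGroup F] [NormedSpace ℝ F] {S : Set E}
    {f : E → F} {y : E} (hS : UniqueDiffOn ℝ S) (hS' : S ⊆ closure (interior S))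
    (hf : ContDiffOn ℝ 2 f S) (hy : y ∈ S) (u v : E) :
    fderivWithin ℝ (fderivWithin ℝ f S) S y u v = fderivWithin ℝ (fderivWithin ℝ f S) S y v u :=
  (hf y hy).isSymmSndFDerivWithinAt (by simp) hS (hS' hy) hy u v

/-- The curvature of a connection is natural under changes of coordinates. -/
lemma connectionCurvature_map {S T : Set E} {φ : E → E} {Γ Γ' : E → E →L[ℝ] E →L[ℝ] E} {y : E}
    (hS : UniqueDiffOn ℝ S) (hS' : S ⊆ closure (interior S)) (hφ : ContDiffOn ℝ 3 φ S)
    (hm : MapsTo φ S T) (hy : y ∈ S) (hΓ : DifferentiableWithinAt ℝ Γ T (φ y))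
    (hΓ' : DifferentiableWithinAt ℝ Γ' S y)
    (h : ∀ z ∈ S, ∀ u v, fderivWithin ℝ φ S z (Γ' z u v) =
      Γ (φ z) (fderivWithin ℝ φ S z u) (fderivWithin ℝ φ S z v)
        + fderivWithin ℝ (fderivWithin ℝ φ S) S z u v) (u v w : E) :
    fderivWithin ℝ φ S y (connectionCurvature S Γ' y u v w) =
      connectionCurvature T Γ (φ y) (fderivWithin ℝ φ S y u) (fderivWithin ℝ φ S y v)
        (fderivWithin ℝ φ S y w) := by
  set J := fderivWithin ℝ φ S with hJ
  set H := fderivWithin ℝ J S with hH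
  have cJ : ContDiffOn ℝ 2 J S := hφ.fderivWithin hS (by norm_num)
  have cH : ContDiffOn ℝ 1 H S := cJ.fderivWithin hS (by norm_num)
  have dφ : HasFDerivWithinAt φ (J y) S y :=
    (hφ.differentiableOn (by norm_num) y hy).hasFDerivWithinAt
  have dJ : HasFDerivWithinAt J (H y) S y :=
    (cJ.differentiableOn (by norm_num) y hy).hasFDerivWithinAt
  have dH : HasFDerivWithinAt H (fderivWithin ℝ H S y) S y :=
    (cH.differentiableOn (by norm_num) y hy).hasFDerivWithinAt
  have dΓ : HasFDerivWithinAt (fun z => Γ (φ z)) ((fderivWithin ℝ Γ T (φ y)).comp (J y)) S y :=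
    HasFDerivWithinAt.comp (g := Γ) (t := T) y hΓ.hasFDerivWithinAt dφ hm
  have dΓ' := hΓ'.hasFDerivWithinAt
  have sH : ∀ z ∈ S, ∀ u v, H z u v = H z v u := fun z hz u v =>
    symm_sndFDerivWithin hS hS' (hφ.of_le (by norm_num)) hz u v
  -- `J` is itself `C²`, so the third derivative of `φ` is symmetric in its first two slots.
  have sT : ∀ u v w, fderivWithin ℝ H S y u v w = fderivWithin ℝ H S y v u w := fun u v w => by
    rw [symm_sndFDerivWithin hS hS' cJ hy u v]
  -- The transformation law `h` differentiated along `u`. Antisymmetrizing in `u` and `v` removes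
  -- the third derivative of `φ`; the terms with `H` cancel by symmetry or against those that `h`
  -- contributes through `g1` and `g2`.
  have key : ∀ u v w, H y u (Γ' y v w) + J y (fderivWithin ℝ Γ' S y u v w) =
      fderivWithin ℝ Γ T (φ y) (J y u) (J y v) (J y w) + Γ (φ y) (H y u v) (J y w)
        + Γ (φ y) (J y v) (H y u w) + fderivWithin ℝ H S y u v w := by
    intro u v w
    have cst : ∀ x : E, HasFDerivWithinAt (fun _ : E => x) (0 : E →L[ℝ] E) S y := fun x =>
      hasFDerivWithinAt_const x y S
    have d1 := dJ.clm_apply ((dΓ'.clm_apply (cst v)).clm_apply (cst w))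
    have d2 := ((dΓ.clm_apply (dJ.clm_apply (cst v))).clm_apply (dJ.clm_apply (cst w))).add
      ((dH.clm_apply (cst v)).clm_apply (cst w))
    have e := (hS y hy).eq d1 (d2.congr (fun z hz => h z hz v w) (h y hy v w))
    have := congrArg (fun L : E →L[ℝ] E => L u) e
    simp at this
    rw [add_comm, this]
    abel
  have k1 := key u v w
  have k2 := key v u w
  have g1 := h y hy u (Γ' y v w)
  have g2 := h y hy v (Γ' y u w)
  rw [h y hy v w] at g1
  rw [h y hy u w] at g2
  rw [map_add] at g1 g2
  have e1 : J y (fderivWithin ℝ Γ' S y u v w) = fderivWithin ℝ Γ T (φ y) (J y u) (J y v) (J y w)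
      + Γ (φ y) (H y u v) (J y w) + Γ (φ y) (J y v) (H y u w) + fderivWithin ℝ H S y u v w
      - H y u (Γ' y v w) := by rw [← k1]; abel
  have e2 : J y (fderivWithin ℝ Γ' S y v u w) = fderivWithin ℝ Γ T (φ y) (J y v) (J y u) (J y w)
      + Γ (φ y) (H y u v) (J y w) + Γ (φ y) (J y u) (H y v w) + fderivWithin ℝ H S y u v w
      - H y v (Γ' y u w) := by rw [sH y hy u v, sT u v w, ← k2]; abel
  simp only [connectionCurvature, map_add, map_sub]
  rw [e1, e2, g1, g2]
  abel

/-- The Koszul formula characterizes how Christoffel symbols change under changes of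
coordinates. -/
lemma christoffel_map {S T : Set E} {φ : E → E} {Γ Γ' : E →L[ℝ] E →L[ℝ] E}
    {B B' : E → E →L[ℝ] E →L[ℝ] ℝ} {y : E}
    (hS : UniqueDiffOn ℝ S) (hS' : S ⊆ closure (interior S)) (hφ : ContDiffOn ℝ 2 φ S)
    (hm : MapsTo φ S T) (hy : y ∈ S) (hB : DifferentiableWithinAt ℝ B T (φ y))
    (hB' : DifferentiableWithinAt ℝ B' S y)
    (h : ∀ z ∈ S, ∀ u v, B' z u v = B (φ z) (fderivWithin ℝ φ S z u) (fderivWithin ℝ φ S z v))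
    (symm : ∀ u v, B (φ y) u v = B (φ y) v u)
    (nondeg : ∀ u, (∀ w, B (φ y) u w = 0) → u = 0)
    (surj : Function.Surjective (fderivWithin ℝ φ S y))
    (koszul : ∀ u v w, 2 * B (φ y) (Γ u v) w = fderivWithin ℝ B T (φ y) u v w
      + fderivWithin ℝ B T (φ y) v u w - fderivWithin ℝ B T (φ y) w u v)
    (koszul' : ∀ u v w, 2 * B' y (Γ' u v) w = fderivWithin ℝ B' S y u v w
      + fderivWithin ℝ B' S y v u w - fderivWithin ℝ B' S y w u v) (u v : E) :
    fderivWithin ℝ φ S y (Γ' u v) = Γ (fderivWithin ℝ φ S y u) (fderivWithin ℝ φ S y v)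
        + fderivWithin ℝ (fderivWithin ℝ φ S) S y u v := by
  set J := fderivWithin ℝ φ S with hJ
  set H := fderivWithin ℝ J S with hH
  have cJ : ContDiffOn ℝ 1 J S := hφ.fderivWithin hS (by norm_num)
  have dφ : HasFDerivWithinAt φ (J y) S y :=
    (hφ.differentiableOn (by norm_num) y hy).hasFDerivWithinAt
  have dJ : HasFDerivWithinAt J (H y) S y :=
    (cJ.differentiableOn (by norm_num) y hy).hasFDerivWithinAt
  have dB : HasFDerivWithinAt (fun z => B (φ z)) ((fderivWithin ℝ B T (φ y)).comp (J y)) S y :=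
    HasFDerivWithinAt.comp (g := B) (t := T) y hB.hasFDerivWithinAt dφ hm
  have sH : ∀ u v, H y u v = H y v u := fun u v =>
    symm_sndFDerivWithin hS hS' hφ hy u v
  have key : ∀ u v w, fderivWithin ℝ B' S y u v w = fderivWithin ℝ B T (φ y) (J y u) (J y v) (J y w)
      + B (φ y) (H y u v) (J y w) + B (φ y) (J y v) (H y u w) := by
    intro u v w
    have cst : ∀ x : E, HasFDerivWithinAt (fun _ : E => x) (0 : E →L[ℝ] E) S y := fun x =>
      hasFDerivWithinAt_const x y S
    have d1 := (hB'.hasFDerivWithinAt.clm_apply (cst v)).clm_apply (cst w)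
    have d2 := ((dB.clm_apply (dJ.clm_apply (cst v))).clm_apply (dJ.clm_apply (cst w)))
    have e := (hS y hy).eq d1 (d2.congr (fun z hz => h z hz v w) (h y hy v w))
    have := congrArg (fun L : E →L[ℝ] ℝ => L u) e
    simp at this
    rw [this]
    ring
  -- By nondegeneracy it suffices to pair with all `w`, and by surjectivity with all `J w`. Of the
  -- six terms with `H` in the Koszul formula for the pulled back metric, four cancel and the other
  -- two give `2 B (H u v) (J w)`.
  have main : ∀ w, B (φ y) (J y (Γ' u v) - (Γ (J y u) (J y v) + H y u v)) w = 0 := by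
    intro w
    obtain ⟨w, rfl⟩ := surj w
    have k := koszul (J y u) (J y v) (J y w)
    have k' := koszul' u v w
    rw [h y hy, key, key, key, sH v u, sH w u, sH w v, symm (H y u w), symm (J y u) (H y v w)] at k'
    rw [map_sub, map_add, sub_apply, add_apply]
    rw [symm (H y v w)] at k'
    linarith
  exact sub_eq_zero.1 (nondeg _ main)

end Connections

/-! ### Smoothness of determinants and inverse matrices -/

section MatrixCalculus

variable {E : Type*} [NormedAddCommGroup E] [NormedSpace ℝ E] {n : ℕ} {S : Set E}
  {A : E → Matrix (Fin n) (Fin n) ℝ} {k : WithTop ℕ∞}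

lemma contDiffOn_det (h : ∀ i j, ContDiffOn ℝ k (fun z => A z i j) S) :
    ContDiffOn ℝ k (fun z => (A z).det) S := by
  simp only [Matrix.det_apply]
  exact ContDiffOn.sum fun σ _ => (contDiffOn_prod fun i _ => h _ _).const_smul _

lemma contDiffOn_inv (h : ∀ i j, ContDiffOn ℝ k (fun z => A z i j) S)
    (hd : ∀ z ∈ S, (A z).det ≠ 0) (i j : Fin n) :
    ContDiffOn ℝ k (fun z => (A z)⁻¹ i j) S := by
  simp only [Matrix.inv_def, Matrix.smul_apply, Ring.inverse_eq_inv', smul_eq_mul]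
  refine ((contDiffOn_det h).inv hd).mul ?_
  simp only [Matrix.adjugate_apply]
  refine contDiffOn_det fun a b => ?_
  by_cases hab : a = j
  · subst hab
    simpa using contDiffOn_const
  · simpa [Matrix.updateRow_ne hab] using h a b

end MatrixCalculus

/-! ### Bilinear maps with given components -/

section Forms

variable {n : ℕ}

local notation "𝔼" => EuclideanSpace ℝ (Fin n)

/-- The bilinear form with matrix `A`. -/
def matForm (A : Matrix (Fin n) (Fin n) ℝ) :
    EuclideanSpace ℝ (Fin n) →L[ℝ] EuclideanSpace ℝ (Fin n) →L[ℝ] ℝ :=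
  ∑ i, ∑ j, A i j • (EuclideanSpace.proj i : 𝔼 →L[ℝ] ℝ).smulRight
    (EuclideanSpace.proj j : 𝔼 →L[ℝ] ℝ)

/-- The vector valued bilinear map with components `c k i j`. -/
def vecForm (c : Fin n → Fin n → Fin n → ℝ) :
    EuclideanSpace ℝ (Fin n) →L[ℝ] EuclideanSpace ℝ (Fin n) →L[ℝ] EuclideanSpace ℝ (Fin n) :=
  ∑ k, ∑ i, ∑ j, c k i j • (EuclideanSpace.proj i : 𝔼 →L[ℝ] ℝ).smulRight
    ((EuclideanSpace.proj j : 𝔼 →L[ℝ] ℝ).smulRight (EuclideanSpace.single k (1 : ℝ)))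

lemma matForm_apply (A : Matrix (Fin n) (Fin n) ℝ) (u v : 𝔼) :
    matForm A u v = ∑ i, ∑ j, A i j * (u i * v j) := by
  simp [matForm]

lemma vecForm_apply (c : Fin n → Fin n → Fin n → ℝ) (u v : 𝔼) (k : Fin n) :
    vecForm c u v k = ∑ i, ∑ j, c k i j * (u i * v j) := by
  simp [vecForm, Finset.sum_apply, Pi.single_apply, Finset.sum_ite_eq]

@[simp] lemma matForm_single (A : Matrix (Fin n) (Fin n) ℝ) (i j : Fin n) :
    matForm A (EuclideanSpace.single i 1) (EuclideanSpace.single j 1) = A i j := by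
  simp [matForm_apply]

@[simp] lemma vecForm_single (c : Fin n → Fin n → Fin n → ℝ) (i j k : Fin n) :
    vecForm c (EuclideanSpace.single i 1) (EuclideanSpace.single j 1) k = c k i j := by
  simp [vecForm_apply]

lemma differentiableWithinAt_sum_smul {ι E F : Type*} [Fintype ι] [NormedAddCommGroup E]
    [NormedSpace ℝ E] [NormedAddCommGroup F] [NormedSpace ℝ F] {S : Set E} {y : E}
    {c : ι → E → ℝ} (h : ∀ i, DifferentiableWithinAt ℝ (c i) S y) (L : ι → F) :
    DifferentiableWithinAt ℝ (fun z => ∑ i, c i z • L i) S y :=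
  DifferentiableWithinAt.fun_sum fun i _ => (h i).smul_const (L i)

lemma differentiableWithinAt_matForm {S : Set 𝔼} {y : 𝔼} {G : 𝔼 → Matrix (Fin n) (Fin n) ℝ}
    (h : ∀ i j, DifferentiableWithinAt ℝ (fun z => G z i j) S y) :
    DifferentiableWithinAt ℝ (fun z => matForm (G z)) S y := by
  have := differentiableWithinAt_sum_smul (c := fun (p : Fin n × Fin n) z => G z p.1 p.2)
    (fun p => h _ _) (fun p => (EuclideanSpace.proj p.1 : 𝔼 →L[ℝ] ℝ).smulRight
      (EuclideanSpace.proj p.2 : 𝔼 →L[ℝ] ℝ))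
  simpa only [matForm, Fintype.sum_prod_type] using this

lemma differentiableWithinAt_vecForm {S : Set 𝔼} {y : 𝔼} {c : 𝔼 → Fin n → Fin n → Fin n → ℝ}
    (h : ∀ k i j, DifferentiableWithinAt ℝ (fun z => c z k i j) S y) :
    DifferentiableWithinAt ℝ (fun z => vecForm (c z)) S y := by
  have := differentiableWithinAt_sum_smul
    (c := fun (p : Fin n × Fin n × Fin n) z => c z p.1 p.2.1 p.2.2)
    (fun p => h _ _ _) (fun p => (EuclideanSpace.proj p.2.1 : 𝔼 →L[ℝ] ℝ).smulRight
    ((EuclideanSpace.proj p.2.2 : 𝔼 →L[ℝ] ℝ).smulRight (EuclideanSpace.single p.1 (1 : ℝ))))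
  simpa only [vecForm, Fintype.sum_prod_type] using this

lemma fderivWithin_clm_apply₂ {E F G K : Type*} [NormedAddCommGroup E] [NormedSpace ℝ E]
    [NormedAddCommGroup F] [NormedSpace ℝ F] [NormedAddCommGroup G] [NormedSpace ℝ G]
    [NormedAddCommGroup K] [NormedSpace ℝ K] {S : Set E} {y : E} {f : E → F →L[ℝ] G →L[ℝ] K}
    (hS : UniqueDiffWithinAt ℝ S y) (h : DifferentiableWithinAt ℝ f S y) (w : E) (u : F) (v : G) :
    fderivWithin ℝ f S y w u v = fderivWithin ℝ (fun z => f z u v) S y w := by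
  have := (h.hasFDerivWithinAt.clm_apply (hasFDerivWithinAt_const u y S)).clm_apply
    (hasFDerivWithinAt_const v y S)
  rw [this.fderivWithin hS]
  simp

lemma fderivWithin_matForm_single {S : Set 𝔼} {y : 𝔼} {G : 𝔼 → Matrix (Fin n) (Fin n) ℝ}
    (hS : UniqueDiffWithinAt ℝ S y)
    (h : ∀ i j, DifferentiableWithinAt ℝ (fun z => G z i j) S y) (l i j : Fin n) :
    fderivWithin ℝ (fun z => matForm (G z)) S y (EuclideanSpace.single l 1)
      (EuclideanSpace.single i 1) (EuclideanSpace.single j 1)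
      = pderiv S l (fun z => G z i j) y := by
  rw [fderivWithin_clm_apply₂ hS (differentiableWithinAt_matForm h)]
  simp only [matForm_single, pderiv]

lemma fderivWithin_vecForm_single {S : Set 𝔼} {y : 𝔼} {c : 𝔼 → Fin n → Fin n → Fin n → ℝ}
    (hS : UniqueDiffWithinAt ℝ S y)
    (h : ∀ k i j, DifferentiableWithinAt ℝ (fun z => c z k i j) S y) (l i j k : Fin n) :
    fderivWithin ℝ (fun z => vecForm (c z)) S y (EuclideanSpace.single l 1)
      (EuclideanSpace.single i 1) (EuclideanSpace.single j 1) k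
      = pderiv S l (fun z => c z k i j) y := by
  have hd := differentiableWithinAt_vecForm h
  rw [fderivWithin_clm_apply₂ hS hd]
  have h' : DifferentiableWithinAt ℝ (fun z => vecForm (c z) (EuclideanSpace.single i 1)
      (EuclideanSpace.single j 1)) S y :=
    (hd.clm_apply (differentiableWithinAt_const _)).clm_apply (differentiableWithinAt_const _)
  have := ((EuclideanSpace.proj k : 𝔼 →L[ℝ] ℝ).hasFDerivAt.comp_hasFDerivWithinAt y
    h'.hasFDerivWithinAt).fderivWithin hS
  have e : pderiv S l (fun z => c z k i j) y = fderivWithin ℝ ((EuclideanSpace.proj k : 𝔼 →L[ℝ] ℝ) ∘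
      fun z => vecForm (c z) (EuclideanSpace.single i 1) (EuclideanSpace.single j 1)) S y
      (EuclideanSpace.single l 1) := by
    simp only [pderiv]
    congr 2
    funext z
    simp
  rw [e, this]
  rfl

lemma sum_single (u : 𝔼) : ∑ i, u i • EuclideanSpace.single i (1 : ℝ) = u := by
  simpa using (EuclideanSpace.basisFun (Fin n) ℝ).sum_repr u

/-- Used once per argument, this reduces a multilinear identity to basis vectors. -/
lemma basis_induction {P : 𝔼 → Prop} (hadd : ∀ u v, P u → P v → P (u + v))
    (hsmul : ∀ (c : ℝ) u, P u → P (c • u)) (h0 : P 0)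
    (h : ∀ i, P (EuclideanSpace.single i 1)) (u : 𝔼) : P u := by
  rw [← sum_single u]
  exact Finset.sum_induction _ P hadd h0 fun i _ => hsmul _ _ (h i)

end Forms

/-! ### Metrics in coordinates and the invariance of their scalar curvature -/

section Invariance

variable {n : ℕ} {S T : Set (EuclideanSpace ℝ (Fin n))}
  {G G' : EuclideanSpace ℝ (Fin n) → Matrix (Fin n) (Fin n) ℝ} {y : EuclideanSpace ℝ (Fin n)}

local notation "𝔼" => EuclideanSpace ℝ (Fin n)

/-- `G` is a `C²` Riemannian metric on `S`, in coordinates. -/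
structure IsC2MetricOn (S : Set (EuclideanSpace ℝ (Fin n)))
    (G : EuclideanSpace ℝ (Fin n) → Matrix (Fin n) (Fin n) ℝ) : Prop where
  contDiffOn : ∀ i j, ContDiffOn ℝ 2 (fun z => G z i j) S
  posDef : ∀ z ∈ S, (G z).PosDef

namespace IsC2MetricOn

lemma symm (h : IsC2MetricOn S G) (hy : y ∈ S) (i j : Fin n) : G y i j = G y j i := by
  simpa using (h.posDef y hy).isHermitian.apply j i

lemma det_ne_zero (h : IsC2MetricOn S G) (hy : y ∈ S) : (G y).det ≠ 0 :=
  (h.posDef y hy).det_pos.ne'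

lemma inv_mul (h : IsC2MetricOn S G) (hy : y ∈ S) : (G y)⁻¹ * G y = 1 :=
  Matrix.nonsing_inv_mul _ (h.det_ne_zero hy).isUnit

lemma contDiffOn_inv (h : IsC2MetricOn S G) (i j : Fin n) :
    ContDiffOn ℝ 2 (fun z => (G z)⁻¹ i j) S :=
  ADM.contDiffOn_inv h.contDiffOn (fun _ hz => h.det_ne_zero hz) i j

lemma differentiableOn (h : IsC2MetricOn S G) (i j : Fin n) :
    DifferentiableOn ℝ (fun z => G z i j) S :=
  (h.contDiffOn i j).differentiableOn (by norm_num)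

lemma contDiffOn_pderiv (h : IsC2MetricOn S G) (hS : UniqueDiffOn ℝ S) (l i j : Fin n) :
    ContDiffOn ℝ 1 (pderiv S l (fun z => G z i j)) S :=
  ((h.contDiffOn i j).fderivWithin hS (by norm_num)).clm_apply contDiffOn_const

lemma contDiffOn_christoffel (h : IsC2MetricOn S G) (hS : UniqueDiffOn ℝ S) (k i j : Fin n) :
    ContDiffOn ℝ 1 (christoffel S G k i j) S := by
  unfold christoffel
  refine contDiffOn_const.mul (ContDiffOn.sum fun m _ => ?_)
  exact ((h.contDiffOn_inv k m).of_le (by norm_num)).mul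
    (((h.contDiffOn_pderiv hS _ _ _).add (h.contDiffOn_pderiv hS _ _ _)).sub
      (h.contDiffOn_pderiv hS _ _ _))

lemma differentiableOn_christoffel (h : IsC2MetricOn S G) (hS : UniqueDiffOn ℝ S)
    (k i j : Fin n) : DifferentiableOn ℝ (christoffel S G k i j) S :=
  (h.contDiffOn_christoffel hS k i j).differentiableOn (by norm_num)

lemma pderiv_symm (h : IsC2MetricOn S G) (hy : y ∈ S) (l i j : Fin n) :
    pderiv S l (fun z => G z i j) y = pderiv S l (fun z => G z j i) y := by
  unfold pderiv
  rw [fderivWithin_congr (fun z hz => h.symm hz i j) (h.symm hy i j)]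

lemma matForm_symm (h : IsC2MetricOn S G) (hy : y ∈ S) (u v : 𝔼) :
    matForm (G y) u v = matForm (G y) v u := by
  rw [matForm_apply, matForm_apply, Finset.sum_comm]
  refine Finset.sum_congr rfl fun i _ => Finset.sum_congr rfl fun j _ => ?_
  rw [h.symm hy, mul_comm (u j)]

lemma matForm_nondegenerate (h : IsC2MetricOn S G) (hy : y ∈ S) (u : 𝔼)
    (hu : ∀ w, matForm (G y) u w = 0) : u = 0 := by
  by_contra hne
  have h1 : (fun i => u i) ≠ 0 := fun h0 => hne (by ext i; exact congrFun h0 i)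
  have := (h.posDef y hy).dotProduct_mulVec_pos h1
  have h2 := hu u
  rw [matForm_apply] at h2
  simp only [dotProduct, Matrix.mulVec, Pi.star_apply, star_trivial, Finset.mul_sum] at this
  refine this.ne' ?_
  rw [← h2]
  exact Finset.sum_congr rfl fun i _ => Finset.sum_congr rfl fun j _ => by ring

/-- The Koszul formula. -/
lemma koszul (h : IsC2MetricOn S G) (hS : UniqueDiffOn ℝ S) (hy : y ∈ S) (u v w : 𝔼) :
    2 * matForm (G y) (vecForm (fun k i j => christoffel S G k i j y) u v) w =
      fderivWithin ℝ (fun z => matForm (G z)) S y u v w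
      + fderivWithin ℝ (fun z => matForm (G z)) S y v u w
      - fderivWithin ℝ (fun z => matForm (G z)) S y w u v := by
  have hd : ∀ i j, DifferentiableWithinAt ℝ (fun z => G z i j) S y := fun i j =>
    h.differentiableOn i j y hy
  refine basis_induction (P := fun u => 2 * matForm (G y) (vecForm _ u v) w =
      fderivWithin ℝ (fun z => matForm (G z)) S y u v w
      + fderivWithin ℝ (fun z => matForm (G z)) S y v u w
      - fderivWithin ℝ (fun z => matForm (G z)) S y w u v) ?_ ?_ ?_ (fun i => ?_) u
  · intro a b ha hb
    simp only [map_add, add_apply, mul_add] at *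
    linarith
  · intro a b hb
    simp only [map_smul, smul_apply, smul_eq_mul] at *
    linear_combination a * hb
  · simp
  refine basis_induction (P := fun v => 2 * matForm (G y) (vecForm _ _ v) w =
      fderivWithin ℝ (fun z => matForm (G z)) S y _ v w
      + fderivWithin ℝ (fun z => matForm (G z)) S y v _ w
      - fderivWithin ℝ (fun z => matForm (G z)) S y w _ v) ?_ ?_ ?_ (fun j => ?_) v
  · intro a b ha hb
    simp only [map_add, add_apply, mul_add] at *
    linarith
  · intro a b hb
    simp only [map_smul, smul_apply, smul_eq_mul] at *
    linear_combination a * hb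
  · simp
  refine basis_induction (P := fun w => 2 * matForm (G y) (vecForm _ _ _) w =
      fderivWithin ℝ (fun z => matForm (G z)) S y _ _ w
      + fderivWithin ℝ (fun z => matForm (G z)) S y _ _ w
      - fderivWithin ℝ (fun z => matForm (G z)) S y w _ _) ?_ ?_ ?_ (fun l => ?_) w
  · intro a b ha hb
    simp only [map_add, add_apply, mul_add] at *
    linarith
  · intro a b hb
    simp only [map_smul, smul_apply, smul_eq_mul] at *
    linear_combination a * hb
  · simp
  rw [fderivWithin_matForm_single (hS y hy) hd, fderivWithin_matForm_single (hS y hy) hd,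
    fderivWithin_matForm_single (hS y hy) hd, h.matForm_symm hy, matForm_apply]
  simp only [vecForm_single, PiLp.single_apply, christoffel]
  simp only [ite_mul, one_mul, zero_mul, mul_ite, mul_zero, Finset.sum_ite_irrel,
    Finset.sum_const_zero, Finset.sum_ite_eq', Finset.mem_univ, if_true]
  set a : Fin n → ℝ := fun m => pderiv S i (fun z => G z m j) y + pderiv S j (fun z => G z m i) y
      - pderiv S m (fun z => G z i j) y with ha
  -- Lowering the upper index of the Christoffel symbol cancels the inverse metric in its
  -- definition.
  have e : ∑ k, G y l k * (1 / 2 * ∑ m, (G y)⁻¹ k m * a m) = 1 / 2 * a l := by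
    have : (G y).mulVec ((G y)⁻¹.mulVec a) = a := by
      rw [Matrix.mulVec_mulVec, Matrix.mul_nonsing_inv _ (h.det_ne_zero hy).isUnit,
        Matrix.one_mulVec]
    have := congrFun this l
    simp only [Matrix.mulVec, dotProduct] at this
    rw [← this, Finset.mul_sum]
    exact Finset.sum_congr rfl fun k _ => by ring
  rw [e, ha]
  simp only
  rw [h.pderiv_symm hy i j l, h.pderiv_symm hy j i l]
  ring

end IsC2MetricOn

lemma IsC2MetricOn.christoffel_symm (h : IsC2MetricOn S G) (hy : y ∈ S) (k i j : Fin n) :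
    christoffel S G k i j y = christoffel S G k j i y := by
  simp only [christoffel]
  congr 1
  refine Finset.sum_congr rfl fun m _ => ?_
  rw [h.pderiv_symm hy m i j]
  ring

/-! ### The Ricci form of a connection -/

section Curvature

variable {E : Type*} [NormedAddCommGroup E] [NormedSpace ℝ E] (U : Set E)
  (Γ : E → E →L[ℝ] E →L[ℝ] E) (p : E)

lemma connectionCurvature_add₁ (a b v w : E) : connectionCurvature U Γ p (a + b) v w =
    connectionCurvature U Γ p a v w + connectionCurvature U Γ p b v w := by
  simp only [connectionCurvature, map_add, add_apply]; abel

lemma connectionCurvature_add₂ (u a b w : E) : connectionCurvature U Γ p u (a + b) w =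
    connectionCurvature U Γ p u a w + connectionCurvature U Γ p u b w := by
  simp only [connectionCurvature, map_add, add_apply]; abel

lemma connectionCurvature_add₃ (u v a b : E) : connectionCurvature U Γ p u v (a + b) =
    connectionCurvature U Γ p u v a + connectionCurvature U Γ p u v b := by
  simp only [connectionCurvature, map_add]; abel

lemma connectionCurvature_smul₁ (c : ℝ) (u v w : E) : connectionCurvature U Γ p (c • u) v w =
    c • connectionCurvature U Γ p u v w := by
  simp only [connectionCurvature, map_smul, smul_apply, smul_sub, smul_add]

lemma connectionCurvature_smul₂ (c : ℝ) (u v w : E) : connectionCurvature U Γ p u (c • v) w =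
    c • connectionCurvature U Γ p u v w := by
  simp only [connectionCurvature, map_smul, smul_apply, smul_sub, smul_add]

lemma connectionCurvature_smul₃ (c : ℝ) (u v w : E) : connectionCurvature U Γ p u v (c • w) =
    c • connectionCurvature U Γ p u v w := by
  simp only [connectionCurvature, map_smul, smul_sub, smul_add]

/-- The endomorphism `u ↦ R(u, v) w`. -/
def curvatureEnd (v w : E) : E →ₗ[ℝ] E where
  toFun u := connectionCurvature U Γ p u v w
  map_add' a b := connectionCurvature_add₁ U Γ p a b v w
  map_smul' c a := connectionCurvature_smul₁ U Γ p c a v w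

/-- The bilinear Ricci form `trace (u ↦ R(u, v) w)`. -/
def ricciForm : E →ₗ[ℝ] E →ₗ[ℝ] ℝ :=
  LinearMap.mk₂ ℝ (fun v w => LinearMap.trace ℝ E (curvatureEnd U Γ p v w))
    (fun a b c => by
      rw [← map_add]; congr 1; ext u : 1; exact connectionCurvature_add₂ U Γ p u a b c)
    (fun a b c => by
      rw [← map_smul]; congr 1; ext u : 1; exact connectionCurvature_smul₂ U Γ p a u b c)
    (fun a b c => by
      rw [← map_add]; congr 1; ext u : 1; exact connectionCurvature_add₃ U Γ p u a b c)
    (fun a b c => by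
      rw [← map_smul]; congr 1; ext u : 1; exact connectionCurvature_smul₃ U Γ p a u b c)

lemma ricciForm_apply (v w : E) :
    ricciForm U Γ p v w = LinearMap.trace ℝ E (curvatureEnd U Γ p v w) := rfl

end Curvature

/-- If `N` is the matrix of `J`, both Gram matrices change by `X ↦ Nᵀ X N`, so `B⁻¹ R` is replaced
by its conjugate `N⁻¹ B⁻¹ R N`. With `R` the Ricci form and `B` the metric this is the invariance of
the scalar curvature. -/
lemma trace_inv_mul_compl₁₂ {E ι : Type*} [AddCommGroup E] [Module ℝ E] [Fintype ι]
    [DecidableEq ι] (b : Module.Basis ι ℝ E) (B R : E →ₗ[ℝ] E →ₗ[ℝ] ℝ) (J : E ≃ₗ[ℝ] E) :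
    ((LinearMap.toMatrix₂ b b (B.compl₁₂ J.toLinearMap J.toLinearMap))⁻¹ *
      LinearMap.toMatrix₂ b b (R.compl₁₂ J.toLinearMap J.toLinearMap)).trace =
    ((LinearMap.toMatrix₂ b b B)⁻¹ * LinearMap.toMatrix₂ b b R).trace := by
  rw [LinearMap.toMatrix₂_compl₁₂ b b b b, LinearMap.toMatrix₂_compl₁₂ b b b b]
  have hu : IsUnit (LinearMap.toMatrix b b J.toLinearMap) :=
    IsUnit.of_mul_eq_one (LinearMap.toMatrix b b J.symm.toLinearMap) (by
      rw [← LinearMap.toMatrix_comp b b b]; simp)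
  set N := LinearMap.toMatrix b b J.toLinearMap
  have hd : IsUnit N.det := (Matrix.isUnit_iff_isUnit_det _).1 hu
  have hdt : IsUnit N.transpose.det := by rwa [Matrix.det_transpose]
  rw [Matrix.mul_inv_rev, Matrix.mul_inv_rev]
  have : N⁻¹ * ((LinearMap.toMatrix₂ b b B)⁻¹ * (N.transpose)⁻¹) *
      (N.transpose * LinearMap.toMatrix₂ b b R * N) =
      N⁻¹ * ((LinearMap.toMatrix₂ b b B)⁻¹ * LinearMap.toMatrix₂ b b R) * N := by
    calc _ = N⁻¹ * ((LinearMap.toMatrix₂ b b B)⁻¹ * ((N.transpose)⁻¹ * N.transpose) *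
          LinearMap.toMatrix₂ b b R) * N := by simp only [Matrix.mul_assoc]
      _ = _ := by rw [Matrix.nonsing_inv_mul _ hdt, Matrix.mul_one]
  rw [this, Matrix.trace_mul_comm, ← Matrix.mul_assoc, Matrix.mul_nonsing_inv _ hd, Matrix.one_mul]

/-- The `i`-th component of `R(∂ᵢ, ∂ₖ) ∂ⱼ` is the summand of the index formula, up to the symmetry
of Christoffel symbols in their lower indices. The trace form is the one whose behaviour under
coordinate changes is evident. -/
lemma IsC2MetricOn.coordScalarCurvature_eq_trace (h : IsC2MetricOn S G) (hS : UniqueDiffOn ℝ S)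
    (hy : y ∈ S) : coordScalarCurvature S G y = ((G y)⁻¹ * LinearMap.toMatrix₂
      (EuclideanSpace.basisFun (Fin n) ℝ).toBasis (EuclideanSpace.basisFun (Fin n) ℝ).toBasis
      (ricciForm S (fun z => vecForm fun k i j => christoffel S G k i j z) y)).trace := by
  have hd : ∀ k i j, DifferentiableWithinAt ℝ (fun z => christoffel S G k i j z) S y :=
    fun k i j => h.differentiableOn_christoffel hS k i j y hy
  simp only [coordScalarCurvature, Matrix.trace, Matrix.diag, Matrix.mul_apply,
    LinearMap.toMatrix₂_apply, OrthonormalBasis.coe_toBasis, EuclideanSpace.basisFun_apply,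
    ricciForm_apply]
  refine Finset.sum_congr rfl fun j _ => Finset.sum_congr rfl fun k _ => ?_
  congr 1
  rw [LinearMap.trace_eq_sum_inner _ (EuclideanSpace.basisFun (Fin n) ℝ)]
  refine Finset.sum_congr rfl fun i _ => ?_
  rw [EuclideanSpace.basisFun_apply, EuclideanSpace.inner_single_left]
  have e : pderiv S i (christoffel S G i j k) y = pderiv S i (christoffel S G i k j) y := by
    unfold pderiv
    rw [fderivWithin_congr (fun z hz => h.christoffel_symm hz i j k) (h.christoffel_symm hy i j k)]
  have c1 := fderivWithin_vecForm_single (hS y hy) hd i k j i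
  have c2 := fderivWithin_vecForm_single (hS y hy) hd k i j i
  simp only [curvatureEnd, LinearMap.coe_mk, AddHom.coe_mk, connectionCurvature, PiLp.add_apply,
    PiLp.sub_apply, c1, c2, e, map_one, one_mul]
  rw [vecForm_apply, vecForm_apply, add_sub_assoc]
  congr 1
  simp only [vecForm_single, PiLp.single_apply, ite_mul, one_mul, zero_mul, mul_ite,
    mul_zero, Finset.sum_ite_irrel, Finset.sum_const_zero, Finset.sum_ite_eq', Finset.mem_univ,
    if_true]
  rw [← Finset.sum_sub_distrib]
  refine Finset.sum_congr rfl fun m _ => ?_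
  rw [h.christoffel_symm hy m j k]
  ring

/-- The scalar curvature does not depend on the coordinates. -/
theorem coordScalarCurvature_map {φ : EuclideanSpace ℝ (Fin n) → EuclideanSpace ℝ (Fin n)}
    (hS : UniqueDiffOn ℝ S) (hS' : S ⊆ closure (interior S)) (hT : UniqueDiffOn ℝ T)
    (hφ : ContDiffOn ℝ 3 φ S) (hm : MapsTo φ S T) (hy : y ∈ S) (hG : IsC2MetricOn T G)
    (hG' : IsC2MetricOn S G')
    (hJ : ∀ z ∈ S, Function.Bijective (fderivWithin ℝ φ S z))
    (h : ∀ z ∈ S, ∀ u v, matForm (G' z) u v =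
      matForm (G (φ z)) (fderivWithin ℝ φ S z u) (fderivWithin ℝ φ S z v)) :
    coordScalarCurvature S G' y = coordScalarCurvature T G (φ y) := by
  rw [hG'.coordScalarCurvature_eq_trace hS hy, hG.coordScalarCurvature_eq_trace hT (hm hy)]
  set Γ := fun z => vecForm fun k i j => christoffel T G k i j z
  set Γ' := fun z => vecForm fun k i j => christoffel S G' k i j z
  have hdΓ : DifferentiableWithinAt ℝ Γ T (φ y) := differentiableWithinAt_vecForm
    fun k i j => hG.differentiableOn_christoffel hT k i j _ (hm hy)
  have hdΓ' : DifferentiableWithinAt ℝ Γ' S y := differentiableWithinAt_vecForm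
    fun k i j => hG'.differentiableOn_christoffel hS k i j _ hy
  have hΓ : ∀ z ∈ S, ∀ u v, fderivWithin ℝ φ S z (Γ' z u v) =
      Γ (φ z) (fderivWithin ℝ φ S z u) (fderivWithin ℝ φ S z v)
        + fderivWithin ℝ (fderivWithin ℝ φ S) S z u v := fun z hz u v =>
    christoffel_map (B := fun z => matForm (G z)) (B' := fun z => matForm (G' z)) hS hS'
      (hφ.of_le (by norm_num)) hm hz
      (differentiableWithinAt_matForm fun i j => hG.differentiableOn i j _ (hm hz))
      (differentiableWithinAt_matForm fun i j => hG'.differentiableOn i j _ hz) h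
      (hG.matForm_symm (hm hz)) (hG.matForm_nondegenerate (hm hz)) (hJ z hz).2
      (hG.koszul hT (hm hz)) (hG'.koszul hS hz) u v
  set J : 𝔼 ≃ₗ[ℝ] 𝔼 := LinearEquiv.ofBijective (fderivWithin ℝ φ S y).toLinearMap (hJ y hy)
  have hJ' : ∀ u, J u = fderivWithin ℝ φ S y u := fun u => rfl
  -- Because curvature is a tensor, `u ↦ R(u, v) w` for `Γ'` is conjugate under `J` to the same
  -- endomorphism for `Γ`, and conjugation preserves the trace.
  have hR : ricciForm S Γ' y = (ricciForm T Γ (φ y)).compl₁₂ J.toLinearMap J.toLinearMap := by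
    refine LinearMap.ext fun v => LinearMap.ext fun w => ?_
    rw [LinearMap.compl₁₂_apply, ricciForm_apply, ricciForm_apply,
      ← LinearMap.trace_conj' (curvatureEnd S Γ' y v w) J]
    congr 1
    ext u : 1
    rw [LinearEquiv.conj_apply]
    have := connectionCurvature_map hS hS' hφ hm hy hdΓ hdΓ' hΓ (J.symm u) v w
    rw [← hJ' (J.symm u), J.apply_symm_apply] at this
    exact this
  set b := (EuclideanSpace.basisFun (Fin n) ℝ).toBasis
  have hb : ∀ i, b i = EuclideanSpace.single i 1 := fun i => by simp [b]
  have m : ∀ A : Matrix (Fin n) (Fin n) ℝ, ∀ B : 𝔼 →ₗ[ℝ] 𝔼 →ₗ[ℝ] ℝ,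
      (∀ u v, B u v = matForm A u v) → LinearMap.toMatrix₂ b b B = A := by
    intro A B hB
    ext i j
    rw [LinearMap.toMatrix₂_apply, hB, hb, hb, matForm_single]
  let B : 𝔼 →ₗ[ℝ] 𝔼 →ₗ[ℝ] ℝ := LinearMap.mk₂ ℝ (fun u v => matForm (G (φ y)) u v)
    (by simp) (by simp) (by simp) (by simp)
  rw [hR, ← m _ B fun u v => rfl, ← m (G' y) (B.compl₁₂ J.toLinearMap J.toLinearMap)
    fun u v => (h y hy u v).symm]
  exact trace_inv_mul_compl₁₂ b _ _ J

end Invariance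

/-! ### Parametrizations of a manifold and the metric components in them -/

section Parametrizations

variable {n : ℕ} {H : Type*} [TopologicalSpace H]
  {I : ModelWithCorners ℝ (EuclideanSpace ℝ (Fin n)) H}
  {M : Type*} [TopologicalSpace M] [ChartedSpace H M] [IsManifold I ∞ M]

local notation "𝔼" => EuclideanSpace ℝ (Fin n)

variable (I) in
/-- `ψ : S → M` is a smooth parametrization of an open subset of `M`, with inverse `χ`. -/
structure IsParam (ψ : EuclideanSpace ℝ (Fin n) → M) (χ : M → EuclideanSpace ℝ (Fin n))
    (S : Set (EuclideanSpace ℝ (Fin n))) : Prop where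
  uniqueDiffOn : UniqueDiffOn ℝ S
  subset_closure_interior : S ⊆ closure (interior S)
  measurableSet : MeasurableSet S
  contMDiffOn : ContMDiffOn 𝓘(ℝ, 𝔼) I ∞ ψ S
  contMDiffOn_inv : ContMDiffOn I 𝓘(ℝ, 𝔼) ∞ χ (ψ '' S)
  left_inv : ∀ y ∈ S, χ (ψ y) = y
  isOpen_image : IsOpen (ψ '' S)

/-- The tangent map of `ψ` is composed with the constant section `y ↦ (y, u)`. Order two is all that
is needed, since the metric is only `C²`. -/
lemma contMDiffOn_mfderivWithin_const {ψ : 𝔼 → M} {S : Set 𝔼} (hS : UniqueDiffOn ℝ S)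
    (hψ : ContMDiffOn 𝓘(ℝ, 𝔼) I ∞ ψ S) (u : 𝔼) :
    ContMDiffOn 𝓘(ℝ, 𝔼) I.tangent 2
      (fun y => (⟨ψ y, mfderivWithin 𝓘(ℝ, 𝔼) I ψ S y u⟩ : TangentBundle I M)) S := by
  have h1 := hψ.contMDiffOn_tangentMapWithin (m := 2) (by norm_cast) hS.uniqueMDiffOn
  have h2 : ContMDiffOn 𝓘(ℝ, 𝔼) 𝓘(ℝ, 𝔼).tangent 2
      (fun y => (⟨y, u⟩ : TangentBundle 𝓘(ℝ, 𝔼) 𝔼)) S := fun y _ =>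
    contMDiffWithinAt_vectorSpace_iff_contDiffWithinAt.2 contDiffWithinAt_const
  exact h1.comp h2 fun y hy => hy

lemma contDiffOn_coordMetric (g : C2Metric I M) {ψ : 𝔼 → M} {S : Set 𝔼} (hS : UniqueDiffOn ℝ S)
    (hψ : ContMDiffOn 𝓘(ℝ, 𝔼) I ∞ ψ S) (i j : Fin n) :
    ContDiffOn ℝ 2 (fun y => coordMetric g ψ S y i j) S := by
  intro y hy
  have hv := contMDiffOn_mfderivWithin_const hS hψ
  have hb : ContMDiffWithinAt 𝓘(ℝ, 𝔼) I 2 ψ S y := (hψ y hy).of_le (by norm_cast)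
  have : ContMDiffWithinAt 𝓘(ℝ, 𝔼) (I.prod 𝓘(ℝ)) 2
      (fun m ↦ Bundle.TotalSpace.mk' ℝ (E := Bundle.Trivial M ℝ) (ψ m)
        (coordMetric g ψ S m i j)) S y := by
    apply ContMDiffWithinAt.clm_bundle_apply₂ (F₁ := 𝔼) (F₂ := 𝔼)
    · exact ContMDiffAt.comp_contMDiffWithinAt y g.contMDiff.contMDiffAt hb
    · exact hv _ y hy
    · exact hv _ y hy
  simp only [Bundle.contMDiffWithinAt_totalSpace] at this
  exact this.2.contDiffWithinAt

/-- The target is an abstract space `F` so that it can be instantiated with a tangent space of `M`.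
-/
lemma matForm_pullback {F : Type*} [AddCommGroup F] [Module ℝ F] [TopologicalSpace F]
    [IsTopologicalAddGroup F] [ContinuousSMul ℝ F]
    (B : F →L[ℝ] F →L[ℝ] ℝ) (D : 𝔼 →L[ℝ] F) (u v : 𝔼) :
    matForm (Matrix.of fun i j => B (D (EuclideanSpace.single i 1))
      (D (EuclideanSpace.single j 1))) u v = B (D u) (D v) := by
  conv_rhs => rw [← sum_single u, ← sum_single v]
  simp only [map_sum, map_smul, sum_apply, smul_apply, matForm_apply, Matrix.of_apply, smul_eq_mul,
    Finset.mul_sum]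
  rw [Finset.sum_comm]
  exact Finset.sum_congr rfl fun i _ => Finset.sum_congr rfl fun j _ => by ring

lemma matForm_coordMetric (g : C2Metric I M) (ψ : 𝔼 → M) (S : Set 𝔼) (y u v : 𝔼) :
    matForm (coordMetric g ψ S y) u v =
      g.inner (ψ y) (mfderivWithin 𝓘(ℝ, 𝔼) I ψ S y u) (mfderivWithin 𝓘(ℝ, 𝔼) I ψ S y v) :=
  matForm_pullback (F := TangentSpace I (ψ y)) (g.inner (ψ y))
    (mfderivWithin 𝓘(ℝ, 𝔼) I ψ S y) u v

lemma bijective_of_injective (J : 𝔼 →L[ℝ] 𝔼) (hJ : Function.Injective J) :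
    Function.Bijective J :=
  ⟨hJ, (LinearMap.injective_iff_surjective (f := J.toLinearMap)).1 hJ⟩

/-! ### Locality of the coordinate formulas -/

section Locality

variable {S U : Set (EuclideanSpace ℝ (Fin n))} {y : EuclideanSpace ℝ (Fin n)}

lemma pderiv_inter (hU : U ∈ 𝓝 y) (i : Fin n) (f : 𝔼 → ℝ) :
    pderiv (S ∩ U) i f y = pderiv S i f y := by
  rw [pderiv, pderiv, fderivWithin_inter hU]

lemma pderiv_congr {f f' : 𝔼 → ℝ} (h : ∀ z ∈ S, f z = f' z) (hy : y ∈ S) (i : Fin n) :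
    pderiv S i f y = pderiv S i f' y := by
  rw [pderiv, pderiv, fderivWithin_congr h (h y hy)]

lemma christoffel_inter {G G' : 𝔼 → Matrix (Fin n) (Fin n) ℝ} (hU : IsOpen U) (hy : y ∈ S ∩ U)
    (h : ∀ z ∈ S ∩ U, G' z = G z) (k i j : Fin n) :
    christoffel (S ∩ U) G' k i j y = christoffel S G k i j y := by
  have e : ∀ l a b, pderiv (S ∩ U) l (fun z => G' z a b) y = pderiv S l (fun z => G z a b) y :=
    fun l a b => (pderiv_congr (fun z hz => by rw [h z hz]) hy l).trans
      (pderiv_inter (hU.mem_nhds hy.2) _ _)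
  simp only [christoffel, e, h y hy]

/-- Derivatives within `S` at `y` see only the germ of `S` at `y`. The derivatives are iterated, so
the metrics must agree on a relative neighbourhood and not merely at `y`. -/
lemma coordScalarCurvature_inter {G G' : 𝔼 → Matrix (Fin n) (Fin n) ℝ} (hU : IsOpen U)
    (hy : y ∈ S ∩ U) (h : ∀ z ∈ S ∩ U, G' z = G z) :
    coordScalarCurvature (S ∩ U) G' y = coordScalarCurvature S G y := by
  have e : ∀ l k i j, pderiv (S ∩ U) l (christoffel (S ∩ U) G' k i j) y =
      pderiv S l (christoffel S G k i j) y := fun l k i j =>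
    (pderiv_congr (fun z hz => christoffel_inter hU hz h k i j) hy l).trans
      (pderiv_inter (hU.mem_nhds hy.2) _ _)
  simp only [coordScalarCurvature, e, christoffel_inter hU hy h, h y hy]

end Locality

namespace IsParam

variable {ψ ψ₁ ψ₂ : EuclideanSpace ℝ (Fin n) → M} {χ χ₁ χ₂ : M → EuclideanSpace ℝ (Fin n)}
  {S S₁ S₂ U : Set (EuclideanSpace ℝ (Fin n))} {y : EuclideanSpace ℝ (Fin n)}

lemma mdifferentiableWithinAt (P : IsParam I ψ χ S) (hy : y ∈ S) :
    MDifferentiableWithinAt 𝓘(ℝ, 𝔼) I ψ S y :=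
  (P.contMDiffOn y hy).mdifferentiableWithinAt (by simp)

lemma injOn (P : IsParam I ψ χ S) : InjOn ψ S := fun a ha b hb h => by
  rw [← P.left_inv a ha, h, P.left_inv b hb]

lemma continuousOn (P : IsParam I ψ χ S) : ContinuousOn ψ S := P.contMDiffOn.continuousOn

/-- Differentiating `χ ∘ ψ = id` exhibits a left inverse. -/
lemma mfderivWithin_injective (P : IsParam I ψ χ S) (hy : y ∈ S) :
    Function.Injective (mfderivWithin 𝓘(ℝ, 𝔼) I ψ S y) := by
  have h1 : MDifferentiableWithinAt I 𝓘(ℝ, 𝔼) χ (ψ '' S) (ψ y) :=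
    (P.contMDiffOn_inv _ (mem_image_of_mem ψ hy)).mdifferentiableWithinAt (by simp)
  have h2 := mfderivWithin_comp y h1 (P.mdifferentiableWithinAt hy) (subset_preimage_image _ _)
    (P.uniqueDiffOn.uniqueMDiffOn y hy)
  have h3 : mfderivWithin 𝓘(ℝ, 𝔼) 𝓘(ℝ, 𝔼) (χ ∘ ψ) S y = mfderivWithin 𝓘(ℝ, 𝔼) 𝓘(ℝ, 𝔼) id S y :=
    mfderivWithin_congr_of_mem (fun z hz => P.left_inv z hz) hy
  have h4 := h2.symm.trans (h3.trans (mfderivWithin_id (P.uniqueDiffOn.uniqueMDiffOn y hy)))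
  intro u v huv
  have e : ∀ w : 𝔼, w = mfderivWithin I 𝓘(ℝ, 𝔼) χ (ψ '' S) (ψ y)
      (mfderivWithin 𝓘(ℝ, 𝔼) I ψ S y w) := fun w =>
    (congrArg (fun L : 𝔼 →L[ℝ] 𝔼 => L w) h4).symm
  have e1 := e u
  rw [huv] at e1
  exact e1.trans (e v).symm

lemma isC2MetricOn (P : IsParam I ψ χ S) (g : C2Metric I M) :
    IsC2MetricOn S (coordMetric g ψ S) where
  contDiffOn := contDiffOn_coordMetric g P.uniqueDiffOn P.contMDiffOn
  posDef y hy := by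
    refine Matrix.PosDef.of_dotProduct_mulVec_pos ?_ fun x hx => ?_
    · ext i j
      simpa [coordMetric] using g.symm _ _ _
    · have h0 : WithLp.toLp 2 x ≠ (0 : 𝔼) := fun h => hx (by simpa using congrArg WithLp.ofLp h)
      have h1 : mfderivWithin 𝓘(ℝ, 𝔼) I ψ S y (WithLp.toLp 2 x : 𝔼) ≠ 0 := fun h =>
        h0 (P.mfderivWithin_injective hy (h.trans (map_zero _).symm))
      have h2 := g.pos _ _ h1
      rw [← matForm_coordMetric, matForm_apply] at h2
      refine h2.trans_eq ?_
      simp only [dotProduct, Matrix.mulVec, Pi.star_apply, star_trivial, Finset.mul_sum]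
      exact Finset.sum_congr rfl fun i _ => Finset.sum_congr rfl fun j _ => by ring

/-- The restriction of a parametrization to an open subset. -/
lemma inter (P : IsParam I ψ χ S) (hU : IsOpen U) : IsParam I ψ χ (S ∩ U) where
  uniqueDiffOn := P.uniqueDiffOn.inter hU
  subset_closure_interior := by
    rintro x ⟨hx, hxU⟩
    rw [interior_inter, hU.interior_eq, inter_comm]
    exact hU.inter_closure ⟨hxU, P.subset_closure_interior hx⟩
  measurableSet := P.measurableSet.inter hU.measurableSet
  contMDiffOn := P.contMDiffOn.mono inter_subset_left
  contMDiffOn_inv := P.contMDiffOn_inv.mono (image_mono inter_subset_left)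
  left_inv y hy := P.left_inv y hy.1
  isOpen_image := by
    have : ψ '' (S ∩ U) = ψ '' S ∩ χ ⁻¹' U := by
      ext x
      constructor
      · rintro ⟨y, ⟨hy, hyU⟩, rfl⟩
        exact ⟨mem_image_of_mem _ hy, by rwa [mem_preimage, P.left_inv y hy]⟩
      · rintro ⟨⟨y, hy, rfl⟩, hyU⟩
        rw [mem_preimage, P.left_inv y hy] at hyU
        exact ⟨y, ⟨hy, hyU⟩, rfl⟩
    rw [this]
    exact P.contMDiffOn_inv.continuousOn.isOpen_inter_preimage P.isOpen_image hU

lemma coordMetric_inter (g : C2Metric I M) (hU : IsOpen U) (hy : y ∈ S ∩ U) :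
    coordMetric g ψ (S ∩ U) y = coordMetric g ψ S y := by
  simp only [coordMetric, mfderivWithin_inter (hU.mem_nhds hy.2)]

/-! ### Transition maps between parametrizations -/

section Transition

variable (P₁ : IsParam I ψ₁ χ₁ S₁) (P₂ : IsParam I ψ₂ χ₂ S₂) (h : MapsTo ψ₁ S₁ (ψ₂ '' S₂))

include P₂ h

lemma transition_spec (hy : y ∈ S₁) : χ₂ (ψ₁ y) ∈ S₂ ∧ ψ₂ (χ₂ (ψ₁ y)) = ψ₁ y := by
  obtain ⟨z, hz, e⟩ := h hy
  rw [← e, P₂.left_inv z hz]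
  exact ⟨hz, rfl⟩

include P₁

lemma contDiffOn_transition : ContDiffOn ℝ ∞ (χ₂ ∘ ψ₁) S₁ :=
  (P₂.contMDiffOn_inv.comp P₁.contMDiffOn h).contDiffOn

/-- This is the chain rule for `ψ₁ = ψ₂ ∘ (χ₂ ∘ ψ₁)`: the transition map is an isometry for the two
coordinate metrics. -/
lemma matForm_transition (g : C2Metric I M) (hy : y ∈ S₁) (u v : 𝔼) :
    matForm (coordMetric g ψ₁ S₁ y) u v = matForm (coordMetric g ψ₂ S₂ ((χ₂ ∘ ψ₁) y))
      (fderivWithin ℝ (χ₂ ∘ ψ₁) S₁ y u) (fderivWithin ℝ (χ₂ ∘ ψ₁) S₁ y v) := by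
  have hs := fun y hy => transition_spec P₂ h (y := y) hy
  have hd : MDifferentiableWithinAt 𝓘(ℝ, 𝔼) 𝓘(ℝ, 𝔼) (χ₂ ∘ ψ₁) S₁ y :=
    (((contDiffOn_transition P₁ P₂ h).contMDiffOn) y hy).mdifferentiableWithinAt (by simp)
  have hc := mfderivWithin_comp y (P₂.mdifferentiableWithinAt (hs y hy).1) hd
    (fun z hz => (hs z hz).1) (P₁.uniqueDiffOn.uniqueMDiffOn y hy)
  rw [mfderivWithin_eq_fderivWithin] at hc
  rw [matForm_coordMetric, matForm_coordMetric]
  -- The base points `ψ₂ (χ₂ (ψ₁ y))` and `ψ₁ y` agree only propositionally, so the two derivatives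
  -- have different types; heterogeneous equality transports one to the other.
  have key : ∀ (p : M) (D : 𝔼 →L[ℝ] TangentSpace I p), p = ψ₁ y →
      HEq D (mfderivWithin 𝓘(ℝ, 𝔼) I ψ₁ S₁ y) →
      g.inner (ψ₁ y) (mfderivWithin 𝓘(ℝ, 𝔼) I ψ₁ S₁ y u) (mfderivWithin 𝓘(ℝ, 𝔼) I ψ₁ S₁ y v) =
      g.inner p (D u) (D v) := by
    rintro p D rfl hD
    rw [eq_of_heq hD]
    rfl
  refine key (ψ₂ ((χ₂ ∘ ψ₁) y)) ((mfderivWithin 𝓘(ℝ, 𝔼) I ψ₂ S₂ ((χ₂ ∘ ψ₁) y)).comp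
    (fderivWithin ℝ (χ₂ ∘ ψ₁) S₁ y)) (hs y hy).2 ?_
  refine (heq_of_eq hc.symm).trans ?_
  have e : EqOn (ψ₂ ∘ χ₂ ∘ ψ₁) ψ₁ S₁ := fun z hz => (hs z hz).2
  exact heq_of_eq (mfderivWithin_congr_of_mem (fun z hz => e hz) hy)

/-- The pulled back metric is nondegenerate, so the kernel of the derivative is trivial. In finite
dimension this is enough, and the inverse transition map is not needed. -/
lemma bijective_fderivWithin_transition (g : C2Metric I M) (hy : y ∈ S₁) :
    Function.Bijective (fderivWithin ℝ (χ₂ ∘ ψ₁) S₁ y) := by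
  refine bijective_of_injective _ ((injective_iff_map_eq_zero _).2 fun u hu => ?_)
  refine (P₁.isC2MetricOn g).matForm_nondegenerate hy u fun w => ?_
  rw [matForm_transition P₁ P₂ h g hy, hu]
  simp

lemma coordScalarCurvature_transition (g : C2Metric I M) (hy : y ∈ S₁) :
    coordScalarCurvature S₁ (coordMetric g ψ₁ S₁) y =
      coordScalarCurvature S₂ (coordMetric g ψ₂ S₂) ((χ₂ ∘ ψ₁) y) := by
  have hm : MapsTo (χ₂ ∘ ψ₁) S₁ S₂ := fun z hz => (transition_spec P₂ h hz).1
  have h3 : ContDiffOn ℝ 3 (χ₂ ∘ ψ₁) S₁ := (contDiffOn_transition P₁ P₂ h).of_le (by norm_cast)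
  have hJ := fun z hz => bijective_fderivWithin_transition P₁ P₂ h g (y := z) hz
  have hG := fun z hz => matForm_transition P₁ P₂ h g (y := z) hz
  have e := coordScalarCurvature_map (φ := χ₂ ∘ ψ₁) P₁.uniqueDiffOn P₁.subset_closure_interior
    P₂.uniqueDiffOn h3 hm hy (P₂.isC2MetricOn g) (P₁.isC2MetricOn g) hJ hG
  exact e

end Transition

end IsParam

end Parametrizations

/-! ### Computing curvature and volume in an arbitrary parametrization -/

section Volume

variable {n : ℕ} {H : Type*} [TopologicalSpace H]
  {I : ModelWithCorners ℝ (EuclideanSpace ℝ (Fin n)) H}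
  {M : Type*} [TopologicalSpace M] [ChartedSpace H M] [IsManifold I ∞ M]

local notation "𝔼" => EuclideanSpace ℝ (Fin n)

lemma isParam_extChartAt (p : M) :
    IsParam I (extChartAt I p).symm (extChartAt I p) (extChartAt I p).target where
  uniqueDiffOn := uniqueDiffOn_extChartAt_target p
  subset_closure_interior := extChartAt_target_subset_closure_interior
  measurableSet := by
    rw [extChartAt_target]
    exact ((chartAt H p).open_target.preimage I.continuous_symm).measurableSet.inter
      I.isClosed_range.measurableSet
  contMDiffOn := contMDiffOn_extChartAt_symm p
  contMDiffOn_inv := by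
    rw [(extChartAt I p).symm_image_target_eq_source, extChartAt_source]
    exact contMDiffOn_extChartAt
  left_inv y hy := (extChartAt I p).right_inv hy
  isOpen_image := by
    rw [(extChartAt I p).symm_image_target_eq_source]
    exact isOpen_extChartAt_source p

lemma isOpen_exterior (r : ℝ) : IsOpen (exterior n r) :=
  isOpen_lt continuous_const continuous_norm

lemma EndChart.exterior_subset (Φ : EndChart I M) : exterior n Φ.r₀ ⊆ Φ.chart.target :=
  fun x hx => Φ.subset_target (show Φ.r₀ ≤ ‖x‖ from le_of_lt hx)

lemma EndChart.isParam (Φ : EndChart I M) {S : Set 𝔼} (hS : IsOpen S)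
    (h : S ⊆ Φ.chart.target) : IsParam I Φ.chart.symm Φ.chart S where
  uniqueDiffOn := hS.uniqueDiffOn
  subset_closure_interior := by rw [hS.interior_eq]; exact subset_closure
  measurableSet := hS.measurableSet
  contMDiffOn := Φ.contMDiffOn_symm.mono h
  contMDiffOn_inv := Φ.contMDiffOn.mono (by
    rintro _ ⟨y, hy, rfl⟩
    exact Φ.chart.map_target (h hy))
  left_inv y hy := Φ.chart.right_inv (h hy)
  isOpen_image := Φ.chart.isOpen_image_symm_of_subset_target hS h

namespace IsParam

variable {ψ ψ₁ ψ₂ : EuclideanSpace ℝ (Fin n) → M} {χ χ₁ χ₂ : M → EuclideanSpace ℝ (Fin n)}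
  {S S₁ S₂ : Set (EuclideanSpace ℝ (Fin n))} {y : EuclideanSpace ℝ (Fin n)}

/-- The domain `S` may contain boundary points, so the preimage of an open set is only relatively
open. Writing it as `S ∩ U` allows `IsParam.inter` to be applied. -/
lemma exists_isOpen_inter (P : IsParam I ψ χ S) {O : Set M} (hO : IsOpen O) :
    ∃ U, IsOpen U ∧ S ∩ U = S ∩ ψ ⁻¹' O := by
  obtain ⟨U, hU, e⟩ := continuousOn_iff'.1 P.continuousOn O hO
  exact ⟨U, hU, by rw [inter_comm, ← e, inter_comm]⟩

/-- The scalar curvature computed in two parametrizations is the same. -/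
lemma coordScalarCurvature_eq (P₁ : IsParam I ψ₁ χ₁ S₁) (P₂ : IsParam I ψ₂ χ₂ S₂)
    (g : C2Metric I M) (hy : y ∈ S₁) (h : ψ₁ y ∈ ψ₂ '' S₂) :
    coordScalarCurvature S₁ (coordMetric g ψ₁ S₁) y =
      coordScalarCurvature S₂ (coordMetric g ψ₂ S₂) (χ₂ (ψ₁ y)) := by
  obtain ⟨U, hU, e⟩ := P₁.exists_isOpen_inter P₂.isOpen_image
  have hyU : y ∈ S₁ ∩ U := by rw [e]; exact ⟨hy, h⟩
  have hm : MapsTo ψ₁ (S₁ ∩ U) (ψ₂ '' S₂) := fun z hz => by rw [e] at hz; exact hz.2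
  have := coordScalarCurvature_transition (P₁.inter hU) P₂ hm g hyU
  rw [← coordScalarCurvature_inter hU hyU fun z hz => coordMetric_inter g hU hz]
  exact this

/-- The scalar curvature can be computed in any parametrization. -/
lemma scalarCurvature_eq (P : IsParam I ψ χ S) (g : C2Metric I M) (hy : y ∈ S) :
    scalarCurvature g (ψ y) = coordScalarCurvature S (coordMetric g ψ S) y := by
  refine (P.coordScalarCurvature_eq (isParam_extChartAt (I := I) (ψ y)) g hy ?_).symm
  rw [(extChartAt I (ψ y)).symm_image_target_eq_source]
  exact mem_extChartAt_source (ψ y)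

/-- The density of the Riemannian volume in coordinates. -/
def density (G : Matrix (Fin n) (Fin n) ℝ) : ℝ≥0∞ := ENNReal.ofReal (Real.sqrt G.det)

lemma continuousOn_sqrt_det {G : 𝔼 → Matrix (Fin n) (Fin n) ℝ} (h : IsC2MetricOn S G) :
    ContinuousOn (fun y => Real.sqrt (G y).det) S :=
  Real.continuous_sqrt.comp_continuousOn (contDiffOn_det h.contDiffOn).continuousOn

/-- The Riemannian volume measure of the image of a parametrization. -/
def measure [MeasurableSpace M] (g : C2Metric I M) (ψ : EuclideanSpace ℝ (Fin n) → M)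
    (S : Set (EuclideanSpace ℝ (Fin n))) : Measure M :=
  Measure.map ψ ((volume.restrict S).withDensity fun y => density (coordMetric g ψ S y))

variable [MeasurableSpace M] [BorelSpace M]

lemma aemeasurable_density (P : IsParam I ψ χ S) (g : C2Metric I M) :
    AEMeasurable (fun y => density (coordMetric g ψ S y)) (volume.restrict S) :=
  ((continuousOn_sqrt_det (P.isC2MetricOn g)).aemeasurable P.measurableSet).ennreal_ofReal

lemma aemeasurable (P : IsParam I ψ χ S) : AEMeasurable ψ (volume.restrict S) := by
  refine aemeasurable_restrict_of_measurable_subtype P.measurableSet ?_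
  exact P.continuousOn.domRestrict.measurable

lemma aemeasurable_withDensity (P : IsParam I ψ χ S) (f : 𝔼 → ℝ≥0∞) :
    AEMeasurable ψ ((volume.restrict S).withDensity f) :=
  P.aemeasurable.mono_ac (withDensity_absolutelyContinuous _ _)

lemma measurableSet_inter_preimage (P : IsParam I ψ χ S) {B : Set M} (hB : MeasurableSet B) :
    MeasurableSet (S ∩ ψ ⁻¹' B) := by
  have h := MeasurableSet.subtype_image P.measurableSet
    (P.continuousOn.domRestrict.measurable hB)
  convert h using 1
  ext x
  simp [and_comm]

lemma measure_restrict (P : IsParam I ψ χ S) (g : C2Metric I M) {B : Set M}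
    (hB : MeasurableSet B) : (measure g ψ S).restrict B =
      Measure.map ψ ((volume.restrict (S ∩ ψ ⁻¹' B)).withDensity
        fun y => density (coordMetric g ψ S y)) := by
  rw [measure, Measure.restrict_map_of_aemeasurable (P.aemeasurable_withDensity _) hB,
    restrict_withDensity', Measure.restrict_restrict' P.measurableSet, inter_comm]

lemma measure_apply (P : IsParam I ψ χ S) (g : C2Metric I M) {B : Set M} (hB : MeasurableSet B) :
    measure g ψ S B = ∫⁻ y in S ∩ ψ ⁻¹' B, density (coordMetric g ψ S y) := by
  rw [measure, Measure.map_apply_of_aemeasurable (P.aemeasurable_withDensity _) hB,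
    withDensity_apply', Measure.restrict_restrict' P.measurableSet, inter_comm]

/-- The hypothesis is `A' = Jᵀ A J` in matrix terms. Hence `√det` picks up the factor `|det J|` that
the change of variables formula requires. -/
lemma det_eq_of_matForm {A A' : Matrix (Fin n) (Fin n) ℝ} (J : 𝔼 →L[ℝ] 𝔼)
    (h : ∀ u v, matForm A' u v = matForm A (J u) (J v)) : A'.det = J.det ^ 2 * A.det := by
  set b := (EuclideanSpace.basisFun (Fin n) ℝ).toBasis
  have hb : ∀ i, b i = EuclideanSpace.single i 1 := fun i => by simp [b]
  have m : ∀ A : Matrix (Fin n) (Fin n) ℝ, ∀ B : 𝔼 →ₗ[ℝ] 𝔼 →ₗ[ℝ] ℝ,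
      (∀ u v, B u v = matForm A u v) → LinearMap.toMatrix₂ b b B = A := by
    intro A B hB
    ext i j
    rw [LinearMap.toMatrix₂_apply, hB, hb, hb, matForm_single]
  let B : 𝔼 →ₗ[ℝ] 𝔼 →ₗ[ℝ] ℝ := LinearMap.mk₂ ℝ (fun u v => matForm A u v)
    (by simp) (by simp) (by simp) (by simp)
  have e := LinearMap.toMatrix₂_compl₁₂ b b b b B J.toLinearMap J.toLinearMap
  rw [m A' (B.compl₁₂ J.toLinearMap J.toLinearMap) fun u v => (h u v).symm,
    m A B fun u v => rfl] at e
  rw [e, Matrix.det_mul, Matrix.det_mul, Matrix.det_transpose, LinearMap.det_toMatrix]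
  change LinearMap.det J.toLinearMap * _ * LinearMap.det J.toLinearMap =
    LinearMap.det J.toLinearMap ^ 2 * _
  ring

/-- The volume measures of two parametrizations agree on the intersection of their images. -/
lemma measure_eq (P₁ : IsParam I ψ₁ χ₁ S₁) (P₂ : IsParam I ψ₂ χ₂ S₂) (g : C2Metric I M)
    {B : Set M} (hB : MeasurableSet B) (h₁ : B ⊆ ψ₁ '' S₁) (h₂ : B ⊆ ψ₂ '' S₂) :
    measure g ψ₁ S₁ B = measure g ψ₂ S₂ B := by
  rw [P₁.measure_apply g hB, P₂.measure_apply g hB]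
  obtain ⟨U, hU, e⟩ := P₁.exists_isOpen_inter P₂.isOpen_image
  set T := S₁ ∩ U with hT
  have PT : IsParam I ψ₁ χ₁ T := P₁.inter hU
  have hm : MapsTo ψ₁ T (ψ₂ '' S₂) := fun z hz => by rw [e] at hz; exact hz.2
  set A := S₁ ∩ ψ₁ ⁻¹' B with hA
  have hAT : A ⊆ T := fun z hz => by rw [e]; exact ⟨hz.1, h₂ hz.2⟩
  have him : S₂ ∩ ψ₂ ⁻¹' B = (χ₂ ∘ ψ₁) '' A := by
    ext z
    constructor
    · rintro ⟨hz, hzB⟩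
      obtain ⟨y, hy, hyz⟩ := h₁ hzB
      refine ⟨y, ⟨hy, by rw [mem_preimage, hyz]; exact hzB⟩, ?_⟩
      rw [Function.comp_apply, hyz, P₂.left_inv z hz]
    · rintro ⟨y, hy, rfl⟩
      have := transition_spec P₂ hm (hAT hy)
      refine ⟨this.1, ?_⟩
      rw [mem_preimage, Function.comp_apply, this.2]
      exact hy.2
  have hinj : InjOn (χ₂ ∘ ψ₁) A := fun a ha b hb hab => by
    refine P₁.injOn ha.1 hb.1 ?_
    rw [← (transition_spec P₂ hm (hAT ha)).2, ← (transition_spec P₂ hm (hAT hb)).2]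
    exact congrArg ψ₂ hab
  have hd : ∀ x ∈ A, HasFDerivWithinAt (χ₂ ∘ ψ₁) (fderivWithin ℝ (χ₂ ∘ ψ₁) T x) A x :=
    fun x hx => (((contDiffOn_transition PT P₂ hm).differentiableOn (by simp) x
      (hAT hx)).hasFDerivWithinAt).mono hAT
  rw [him, lintegral_image_eq_lintegral_abs_det_fderiv_mul volume
    (P₁.measurableSet_inter_preimage hB) hd hinj]
  refine setLIntegral_congr_fun (P₁.measurableSet_inter_preimage hB) fun x hx => ?_
  have hdet := det_eq_of_matForm _ (matForm_transition PT P₂ hm g (hAT hx))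
  rw [hT, coordMetric_inter g hU (hAT hx)] at hdet
  simp only [density]
  rw [hdet, Real.sqrt_mul (sq_nonneg _), Real.sqrt_sq_eq_abs, ENNReal.ofReal_mul (abs_nonneg _)]

lemma volumeMeasure_eq_iSup (g : C2Metric I M) : volumeMeasure g =
    ⨆ p : M, measure g (extChartAt I p).symm (extChartAt I p).target := rfl

/-- On the domain of a preferred chart, the volume measure is that of the chart. -/
lemma volumeMeasure_apply_of_subset_source (g : C2Metric I M) (q : M) {B : Set M}
    (hB : MeasurableSet B) (h : B ⊆ (extChartAt I q).source) :
    volumeMeasure g B = measure g (extChartAt I q).symm (extChartAt I q).target B := by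
  set Q := isParam_extChartAt (I := I) q
  have him := (extChartAt I q).symm_image_target_eq_source
  refine le_antisymm ?_ ?_
  -- The supremum is bounded by a competitor: the measure of the chart at `q`, plus infinite mass at
  -- every point outside the chart domain. It dominates all chart measures, by `measure_eq` inside
  -- the domain and trivially outside, and on `B` the extra term vanishes.
  · set ν : Measure M := measure g (extChartAt I q).symm (extChartAt I q).target +
      ((⊤ : ℝ≥0∞) • Measure.count).restrict ((extChartAt I q).source)ᶜ with hν
    have hsrc : MeasurableSet (extChartAt I q).source := (isOpen_extChartAt_source q).measurableSet
    have hle : volumeMeasure g ≤ ν := by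
      rw [volumeMeasure_eq_iSup]
      refine iSup_le fun p => Measure.le_iff.2 fun s hs => ?_
      by_cases hne : (s ∩ ((extChartAt I q).source)ᶜ).Nonempty
      · refine le_top.trans (le_of_eq ?_)
        rw [hν, Measure.add_apply, Measure.restrict_apply hs, Measure.smul_apply, smul_eq_mul,
          ENNReal.top_mul]
        · simp
        · exact (Measure.count_ne_zero_iff.2 hne)
      · have hsq : s ⊆ (extChartAt I q).source := fun x hx => by
          by_contra hc
          exact hne ⟨x, hx, hc⟩
        set P := isParam_extChartAt (I := I) p
        have hp := (extChartAt I p).symm_image_target_eq_source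
        have hs' : MeasurableSet (s ∩ (extChartAt I p).source) :=
          hs.inter (isOpen_extChartAt_source p).measurableSet
        have e : measure g (extChartAt I p).symm (extChartAt I p).target s =
            measure g (extChartAt I p).symm (extChartAt I p).target
              (s ∩ (extChartAt I p).source) := by
          rw [P.measure_apply g hs, P.measure_apply g hs']
          congr 2
          ext x
          simp only [mem_inter_iff, mem_preimage]
          exact ⟨fun hx => ⟨hx.1, hx.2, (extChartAt I p).map_target hx.1⟩,
            fun hx => ⟨hx.1, hx.2.1⟩⟩
        rw [e, P.measure_eq Q g hs' (by rw [hp]; exact inter_subset_right)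
          (by rw [him]; exact inter_subset_left.trans hsq)]
        refine (measure_mono inter_subset_left).trans ?_
        rw [hν, Measure.add_apply]
        exact le_self_add
    refine (hle B).trans (le_of_eq ?_)
    rw [hν, Measure.add_apply, Measure.restrict_apply hB]
    have : B ∩ ((extChartAt I q).source)ᶜ = ∅ := by
      ext x
      simp only [mem_inter_iff, mem_compl_iff, mem_empty_iff_false, iff_false, not_and, not_not]
      exact fun hx => h hx
    rw [this]
    simp
  · rw [volumeMeasure_eq_iSup]
    exact (le_iSup (fun p : M => measure g (extChartAt I p).symm (extChartAt I p).target) q) B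

variable [SecondCountableTopology M]

/-- On the image of any parametrization, the volume measure is that of the parametrization. -/
lemma volumeMeasure_restrict_image (P : IsParam I ψ χ S) (g : C2Metric I M) :
    (volumeMeasure g).restrict (ψ '' S) = measure g ψ S := by
  -- Second countability gives a countable cover by chart domains, so the two measures need only be
  -- compared on each of them.
  obtain ⟨t, ht, hcov⟩ := TopologicalSpace.countable_cover_nhds (α := M)
    (f := fun p => (extChartAt I p).source) fun p => extChartAt_source_mem_nhds p
  have : Countable t := ht.to_subtype
  have hcov' : ⋃ p : t, (extChartAt I (p : M)).source = univ := by
    rw [← hcov, iUnion_coe_set]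
  refine (Measure.ext_iff_of_iUnion_eq_univ hcov').2 fun p => ?_
  ext B hB
  have hBs := hB.inter (isOpen_extChartAt_source (I := I) (p : M)).measurableSet
  rw [Measure.restrict_apply hB, Measure.restrict_apply hBs, Measure.restrict_apply hB]
  have e : measure g ψ S (B ∩ (extChartAt I (p : M)).source) =
      measure g ψ S (B ∩ (extChartAt I (p : M)).source ∩ ψ '' S) := by
    rw [P.measure_apply g hBs, P.measure_apply g (hBs.inter P.isOpen_image.measurableSet)]
    congr 2
    ext x
    simp only [mem_inter_iff, mem_preimage]
    exact ⟨fun hx => ⟨hx.1, hx.2, mem_image_of_mem _ hx.1⟩, fun hx => ⟨hx.1, hx.2.1⟩⟩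
  rw [e, volumeMeasure_apply_of_subset_source g p (hBs.inter P.isOpen_image.measurableSet)
    (inter_subset_left.trans inter_subset_right)]
  refine (P.measure_eq (isParam_extChartAt (I := I) (p : M)) g
    (hBs.inter P.isOpen_image.measurableSet) inter_subset_right ?_).symm
  rw [(extChartAt I (p : M)).symm_image_target_eq_source]
  exact inter_subset_left.trans inter_subset_right

lemma volumeMeasure_restrict (P : IsParam I ψ χ S) (g : C2Metric I M) {B : Set M}
    (hB : MeasurableSet B) (h : B ⊆ ψ '' S) : (volumeMeasure g).restrict B =
      Measure.map ψ ((volume.restrict (S ∩ ψ ⁻¹' B)).withDensity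
        fun y => density (coordMetric g ψ S y)) := by
  rw [← P.measure_restrict g hB, ← P.volumeMeasure_restrict_image g,
    Measure.restrict_restrict hB, inter_eq_self_of_subset_left h]

lemma aemeasurable_inter_preimage (P : IsParam I ψ χ S) (B : Set M) (f : 𝔼 → ℝ≥0∞) :
    AEMeasurable ψ ((volume.restrict (S ∩ ψ ⁻¹' B)).withDensity f) :=
  (P.aemeasurable.mono_measure (Measure.restrict_mono inter_subset_left le_rfl)).mono_ac
    (withDensity_absolutelyContinuous _ _)

lemma setIntegral_eq (P : IsParam I ψ χ S) (g : C2Metric I M) {B : Set M}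
    (hB : MeasurableSet B) (h : B ⊆ ψ '' S) {f : M → ℝ}
    (hf : AEStronglyMeasurable f (volumeMeasure g)) : ∫ x in B, f x ∂(volumeMeasure g) =
      ∫ y in S ∩ ψ ⁻¹' B, Real.sqrt (coordMetric g ψ S y).det * f (ψ y) := by
  have hf' := hf.mono_measure (Measure.restrict_le_self (s := B))
  rw [P.volumeMeasure_restrict g hB h] at hf' ⊢
  rw [integral_map (P.aemeasurable_inter_preimage B _) hf',
    integral_withDensity_eq_integral_toReal_smul₀ ((P.aemeasurable_density g).mono_measure
      (Measure.restrict_mono inter_subset_left le_rfl)) (by simp [density])]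
  refine integral_congr_ae (Eventually.of_forall fun y => ?_)
  simp only [density, smul_eq_mul]
  rw [ENNReal.toReal_ofReal (Real.sqrt_nonneg _)]

lemma integrableOn_of_integrable (P : IsParam I ψ χ S) (g : C2Metric I M) {B : Set M}
    (hB : MeasurableSet B) (h : B ⊆ ψ '' S) {f : M → ℝ}
    (hf : Integrable f (volumeMeasure g)) :
    IntegrableOn (fun y => Real.sqrt (coordMetric g ψ S y).det * f (ψ y)) (S ∩ ψ ⁻¹' B) := by
  have hf' := hf.mono_measure (Measure.restrict_le_self (s := B))
  rw [P.volumeMeasure_restrict g hB h] at hf'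
  rw [integrable_map_measure hf'.aestronglyMeasurable (P.aemeasurable_inter_preimage B _),
    integrable_withDensity_iff_integrable_smul₀' ((P.aemeasurable_density g).mono_measure
      (Measure.restrict_mono inter_subset_left le_rfl)) (by simp [density])] at hf'
  refine hf'.congr (Eventually.of_forall fun y => ?_)
  simp only [density, smul_eq_mul, Function.comp_apply]
  rw [ENNReal.toReal_ofReal (Real.sqrt_nonneg _)]

end IsParam

end Volume

/-! ### Weak derivatives of continuous functions on a half-line -/

section WeakDerivative

lemma deriv_smoothTransition_eq_zero {s : ℝ} (hs : s ∉ Icc (0 : ℝ) 1) :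
    deriv Real.smoothTransition s = 0 := by
  rw [mem_Icc, not_and_or, not_le, not_le] at hs
  have h : ∃ c : ℝ, Real.smoothTransition =ᶠ[𝓝 s] fun _ => c := by
    rcases hs with hs | hs
    · exact ⟨0, mem_of_superset (Iio_mem_nhds hs) fun x hx =>
         Real.smoothTransition.zero_of_nonpos (le_of_lt hx)⟩
    · exact ⟨1, mem_of_superset (Ioi_mem_nhds hs) fun x hx =>
         Real.smoothTransition.one_of_one_le (le_of_lt hx)⟩
  obtain ⟨c, hc⟩ := h
  rw [hc.deriv_eq, deriv_const]

lemma continuous_deriv_smoothTransition : Continuous (deriv Real.smoothTransition) :=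
  (Real.smoothTransition.contDiff (n := 1)).continuous_deriv (by simp)

/-- The weighted average of `h` over `[a, a + δ]`. -/
lemma integral_deriv_smoothTransition_scale (h : ℝ → ℝ) (a : ℝ) {δ : ℝ} (hδ : 0 < δ) :
    ∫ r, deriv Real.smoothTransition ((r - a) / δ) * δ⁻¹ * h r =
      ∫ s in Icc (0 : ℝ) 1, deriv Real.smoothTransition s * h (a + δ * s) := by
  rw [setIntegral_eq_integral_of_forall_compl_eq_zero fun s hs => by
    rw [deriv_smoothTransition_eq_zero hs, zero_mul]]
  have e1 := integral_sub_right_eq_self (μ := volume)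
    (fun r : ℝ => deriv Real.smoothTransition (r / δ) * δ⁻¹ * h (a + r)) a
  have e2 := Measure.integral_comp_div
    (fun s : ℝ => deriv Real.smoothTransition s * δ⁻¹ * h (a + δ * s)) δ
  simp only [add_sub_cancel] at e1
  rw [e1]
  have e3 : ∀ r : ℝ, δ * (r / δ) = r := fun r => by field_simp
  simp only [e3] at e2
  rw [e2, abs_of_pos hδ, smul_eq_mul, ← integral_const_mul]
  congr 1
  funext s
  field_simp

lemma integral_deriv_smoothTransition :
    ∫ s in Icc (0 : ℝ) 1, deriv Real.smoothTransition s = 1 := by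
  rw [integral_Icc_eq_integral_Ioc, ← intervalIntegral.integral_of_le zero_le_one,
    intervalIntegral.integral_deriv_eq_sub
      (fun x _ => (Real.smoothTransition.contDiff (n := 1)).differentiable (by simp) x)
      (continuous_deriv_smoothTransition.intervalIntegrable _ _)]
  simp

/-- A continuous function whose weak derivative vanishes is constant. -/
lemma eq_of_forall_integral_deriv_mul_eq_zero {h : ℝ → ℝ} (hc : Continuous h) {c : ℝ}
    (H : ∀ η : ℝ → ℝ, ContDiff ℝ 1 η → HasCompactSupport η → tsupport η ⊆ Ioi c →
      ∫ r, deriv η r * h r = 0) {a b : ℝ} (ha : c < a) (hab : a ≤ b) : h a = h b := by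
  -- An average of `h (a + ·) - h (b + ·)` over scale `δ`, written so that it makes sense and is
  -- continuous at `δ = 0`, where its value is `h a - h b`.
  set K : ℝ → ℝ := fun δ => ∫ s in Icc (0 : ℝ) 1,
    deriv Real.smoothTransition s * (h (a + δ * s) - h (b + δ * s)) with hK
  have hKc : Continuous K := by
    refine continuous_parametric_integral_of_continuous (f := fun δ s : ℝ =>
      deriv Real.smoothTransition s * (h (a + δ * s) - h (b + δ * s))) ?_ isCompact_Icc
    have := continuous_deriv_smoothTransition
    simp only [Function.uncurry_def]
    fun_prop
  have hK0 : K 0 = h a - h b := by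
    simp only [hK, zero_mul, add_zero]
    rw [integral_mul_const, integral_deriv_smoothTransition, one_mul]
  have hKpos : ∀ δ > 0, K δ = 0 := by
    intro δ hδ
    set T := Real.smoothTransition
    -- A smoothed indicator function of `[a, b]`. Testing with it yields exactly `K δ = 0`.
    set η : ℝ → ℝ := fun r => T ((r - a) / δ) - T ((r - b) / δ) with hη
    have hT : ∀ r, HasDerivAt T (deriv T r) r := fun r =>
      ((Real.smoothTransition.contDiff (n := 1)).differentiable (by simp) r).hasDerivAt
    have hTs : ∀ x r : ℝ, HasDerivAt (fun r => T ((r - x) / δ)) (deriv T ((r - x) / δ) * δ⁻¹) r := by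
      intro x r
      have : HasDerivAt (fun r : ℝ => (r - x) / δ) (δ⁻¹) r := by
        simpa using ((hasDerivAt_id r).sub_const x).div_const δ
      exact (hT _).comp r this
    have hsub : tsupport η ⊆ Icc a (b + δ) := by
      refine closure_minimal (fun r hr => ?_) isClosed_Icc
      rw [Function.mem_support] at hr
      by_contra hn
      rw [mem_Icc, not_and_or, not_le, not_le] at hn
      apply hr
      rcases hn with hn | hn
      · change Real.smoothTransition _ - Real.smoothTransition _ = 0
        rw [Real.smoothTransition.zero_of_nonpos, Real.smoothTransition.zero_of_nonpos, sub_zero]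
        · exact div_nonpos_of_nonpos_of_nonneg (by linarith) hδ.le
        · exact div_nonpos_of_nonpos_of_nonneg (by linarith) hδ.le
      · change Real.smoothTransition _ - Real.smoothTransition _ = 0
        rw [Real.smoothTransition.one_of_one_le, Real.smoothTransition.one_of_one_le, sub_self]
        · rw [le_div_iff₀ hδ]; linarith
        · rw [le_div_iff₀ hδ]; linarith
    have hcd : ∀ x : ℝ, ContDiff ℝ 1 (fun r => T ((r - x) / δ)) := fun x =>
      (Real.smoothTransition.contDiff (n := 1)).comp
        ((contDiff_id.sub contDiff_const).div_const δ)
    have e := H η ((hcd a).sub (hcd b)) (isCompact_Icc.of_isClosed_subset (isClosed_tsupport η) hsub)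
      (hsub.trans fun r hr => lt_of_lt_of_le ha hr.1)
    have hd : ∀ r, deriv η r = deriv T ((r - a) / δ) * δ⁻¹ - deriv T ((r - b) / δ) * δ⁻¹ :=
      fun r => ((hTs a r).sub (hTs b r)).deriv
    simp only [hd, sub_mul] at e
    have hint : ∀ x, Integrable fun r => deriv T ((r - x) / δ) * δ⁻¹ * h r := by
      intro x
      refine Continuous.integrable_of_hasCompactSupport ?_ ?_
      · have := continuous_deriv_smoothTransition
        exact ((this.comp ((continuous_id.sub continuous_const).div_const δ)).mul
          continuous_const).mul hc
      · refine HasCompactSupport.intro (isCompact_Icc (a := x) (b := x + δ)) fun r hr => ?_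
        rw [deriv_smoothTransition_eq_zero, zero_mul, zero_mul]
        intro hm
        apply hr
        rw [mem_Icc, div_le_iff₀ hδ, le_div_iff₀ hδ] at hm
        exact ⟨by linarith [hm.1], by linarith [hm.2]⟩
    rw [integral_sub (hint a) (hint b), integral_deriv_smoothTransition_scale h a hδ,
      integral_deriv_smoothTransition_scale h b hδ, ← integral_sub] at e
    · simpa only [hK, mul_sub] using e
    · exact ((continuous_deriv_smoothTransition.mul (by fun_prop)).continuousOn).integrableOn_compact
        isCompact_Icc
    · exact ((continuous_deriv_smoothTransition.mul (by fun_prop)).continuousOn).integrableOn_compact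
        isCompact_Icc
  have hlim : Tendsto K (𝓝[>] 0) (𝓝 (K 0)) := hKc.continuousAt.tendsto.mono_left nhdsWithin_le_nhds
  have hlim0 : Tendsto K (𝓝[>] 0) (𝓝 0) :=
    (tendsto_congr' (eventually_nhdsWithin_of_forall fun δ hδ => hKpos δ hδ)).2 tendsto_const_nhds
  have := tendsto_nhds_unique hlim hlim0
  linarith

/-- If `D` is the weak derivative of `F` on `(c, ∞)`, both continuous, then
`F b - F a = ∫ₐᵇ D`. -/
lemma sub_eq_integral_of_weak_deriv {F D : ℝ → ℝ} (hF : Continuous F) (hD : Continuous D) {c : ℝ}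
    (H : ∀ η : ℝ → ℝ, ContDiff ℝ 1 η → HasCompactSupport η → tsupport η ⊆ Ioi c →
      ∫ r, (η r * D r + deriv η r * F r) = 0) {a b : ℝ} (ha : c < a) (hab : a ≤ b) :
    F b - F a = ∫ r in a..b, D r := by
  set P : ℝ → ℝ := fun r => ∫ t in c..r, D t with hP
  have hPd : ∀ r, HasDerivAt P (D r) r := fun r => hD.integral_hasStrictDerivAt c r |>.hasDerivAt
  have hPc : Continuous P := continuous_iff_continuousAt.2 fun r => (hPd r).continuousAt
  -- `F` minus an antiderivative of `D` has vanishing weak derivative, by integration by parts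
  -- against `η`.
  have key := eq_of_forall_integral_deriv_mul_eq_zero (h := fun r => F r - P r) (hF.sub hPc)
    (c := c) (fun η h1 h2 h3 => ?_) ha hab
  · have : P b - P a = ∫ r in a..b, D r := by
      rw [hP]
      exact intervalIntegral.integral_interval_sub_left (hD.intervalIntegrable _ _)
        (hD.intervalIntegrable _ _)
    linarith
  · have hη' : Continuous (deriv η) := h1.continuous_deriv (by simp)
    have i1 : Integrable fun r => η r * D r :=
      (h1.continuous.mul hD).integrable_of_hasCompactSupport h2.mul_right
    have i2 : ∀ f : ℝ → ℝ, Continuous f → Integrable fun r => deriv η r * f r := fun f hf =>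
      (hη'.mul hf).integrable_of_hasCompactSupport h2.deriv.mul_right
    have e := H η h1 h2 h3
    rw [integral_add i1 (i2 F hF)] at e
    have parts := integral_mul_deriv_eq_deriv_mul_of_integrable (u := η) (v := P) (u' := deriv η)
      (v' := D) (fun x _ => (h1.differentiable (by simp) x).hasDerivAt) (fun x _ => hPd x) i1
      (i2 P hPc) ((h1.continuous.mul hPc).integrable_of_hasCompactSupport h2.mul_right)
    simp only [mul_sub]
    rw [integral_sub (i2 F hF) (i2 P hPc)]
    linarith

end WeakDerivative

/-! ### Polar coordinates -/

section Polar

variable {n : ℕ}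

local notation "𝔼" => EuclideanSpace ℝ (Fin n)

lemma integrable_prod_of_integrable {f : 𝔼 → ℝ} (hf : Integrable f) :
    Integrable (fun p : Metric.sphere (0 : 𝔼) 1 × Ioi (0 : ℝ) => f ((p.2 : ℝ) • (p.1 : 𝔼)))
      ((volume : Measure 𝔼).toSphere.prod (.volumeIoiPow (Module.finrank ℝ 𝔼 - 1))) := by
  have h := (volume : Measure 𝔼).measurePreserving_homeomorphUnitSphereProd
  rw [← h.integrable_comp_emb (Homeomorph.measurableEmbedding _)]
  have e : ((fun p : Metric.sphere (0 : 𝔼) 1 × Ioi (0 : ℝ) => f ((p.2 : ℝ) • (p.1 : 𝔼))) ∘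
      homeomorphUnitSphereProd 𝔼) = f ∘ Subtype.val := by
    funext x
    have := congrArg Subtype.val ((homeomorphUnitSphereProd 𝔼).symm_apply_apply x)
    rw [homeomorphUnitSphereProd_symm_apply_coe] at this
    simp only [Function.comp_apply, this]
  rw [e, ← integrableOn_iff_comap_subtypeVal (measurableSet_singleton _).compl]
  exact hf.integrableOn

/-- Integration in polar coordinates. -/
lemma integral_eq_integral_sphereIntegral (hn : 0 < n) {f : 𝔼 → ℝ} (hf : Integrable f) :
    ∫ x, f x = ∫ r in Ioi (0 : ℝ), sphereIntegral r f := by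
  have : Nonempty (Fin n) := ⟨⟨0, hn⟩⟩
  have h := (volume : Measure 𝔼).measurePreserving_homeomorphUnitSphereProd
  calc ∫ x, f x = ∫ x : ({(0)}ᶜ : Set 𝔼), f x.1 ∂((volume : Measure 𝔼).comap (↑)) := by
        rw [integral_subtype_comap (measurableSet_singleton _).compl f, restrict_compl_singleton]
    _ = ∫ p : Metric.sphere (0 : 𝔼) 1 × Ioi (0 : ℝ), f ((p.2 : ℝ) • (p.1 : 𝔼))
          ∂((volume : Measure 𝔼).toSphere.prod (.volumeIoiPow (Module.finrank ℝ 𝔼 - 1))) := by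
        rw [← h.integral_comp (Homeomorph.measurableEmbedding _)]
        congr 1
        funext x
        have := congrArg Subtype.val ((homeomorphUnitSphereProd 𝔼).symm_apply_apply x)
        rw [homeomorphUnitSphereProd_symm_apply_coe] at this
        simp only [this]
    _ = ∫ r : Ioi (0 : ℝ), (∫ u : Metric.sphere (0 : 𝔼) 1, f ((r : ℝ) • (u : 𝔼))
          ∂(volume : Measure 𝔼).toSphere) ∂(.volumeIoiPow (n - 1)) := by
        rw [integral_prod_symm _ (integrable_prod_of_integrable hf), finrank_euclideanSpace_fin]
    _ = _ := by
        simp only [Measure.volumeIoiPow, ENNReal.ofReal]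
        rw [integral_withDensity_eq_integral_smul (by fun_prop),
          integral_subtype_comap measurableSet_Ioi fun r : ℝ => Real.toNNReal (r ^ (n - 1)) •
            ∫ u : Metric.sphere (0 : 𝔼) 1, f ((r : ℝ) • (u : 𝔼)) ∂(volume : Measure 𝔼).toSphere]
        refine setIntegral_congr_fun measurableSet_Ioi fun r hr => ?_
        simp only [sphereIntegral]
        rw [NNReal.smul_def, Real.coe_toNNReal _ (pow_nonneg (le_of_lt hr) _), smul_eq_mul]

/-! ### The divergence theorem in annuli -/

section Divergence

variable {r₀ : ℝ} {f : EuclideanSpace ℝ (Fin n) → ℝ} {η : ℝ → ℝ}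

/-- The values of `f` off the exterior region are arbitrary, but the cutoff vanishes near the
complement of that region. -/
lemma continuous_cutoff_mul (hη : Continuous η) (hs : tsupport η ⊆ Ioi r₀)
    (hf : ContinuousOn f (exterior n r₀)) : Continuous fun x : 𝔼 => η ‖x‖ * f x := by
  refine ContinuousOn.continuous_of_tsupport_subset
    ((hη.comp continuous_norm).continuousOn.mul hf) (isOpen_exterior r₀) ?_
  have : tsupport (fun x : 𝔼 => η ‖x‖ * f x) ⊆ (fun x : 𝔼 => ‖x‖) ⁻¹' tsupport η :=
    closure_minimal (fun x hx => subset_tsupport η (left_ne_zero_of_mul hx))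
      ((isClosed_tsupport η).preimage continuous_norm)
  exact fun x hx => hs (this hx)

lemma hasCompactSupport_cutoff_mul (hc : HasCompactSupport η) (f : 𝔼 → ℝ) :
    HasCompactSupport fun x : 𝔼 => η ‖x‖ * f x := by
  obtain ⟨R, hR⟩ := hc.isCompact.isBounded.subset_closedBall 0
  refine HasCompactSupport.intro (isCompact_closedBall (0 : 𝔼) R) fun x hx => ?_
  rw [mem_closedBall_zero_iff, not_le] at hx
  have h0 : η ‖x‖ = 0 := image_eq_zero_of_notMem_tsupport fun h => by
    have := hR h
    rw [mem_closedBall_zero_iff, norm_norm] at this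
    linarith
  rw [h0, zero_mul]

lemma integrable_cutoff_mul (hη : Continuous η) (hc : HasCompactSupport η)
    (hs : tsupport η ⊆ Ioi r₀) (hf : ContinuousOn f (exterior n r₀)) :
    Integrable fun x : 𝔼 => η ‖x‖ * f x :=
  (continuous_cutoff_mul hη hs hf).integrable_of_hasCompactSupport
    (hasCompactSupport_cutoff_mul hc f)

lemma hasFDerivAt_norm {x : 𝔼} (hx : x ≠ 0) :
    HasFDerivAt (fun x : 𝔼 => ‖x‖) (‖x‖⁻¹ • innerSL ℝ x) x := by
  have h := (hasStrictFDerivAt_norm_sq x).hasFDerivAt.sqrt (by positivity)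
  simp only [Real.sqrt_sq (norm_nonneg _)] at h
  have e : (1 / (2 * ‖x‖)) • 2 • innerSL ℝ x = ‖x‖⁻¹ • innerSL ℝ x := by
    rw [← Nat.cast_smul_eq_nsmul ℝ, smul_smul]
    congr 1
    push_cast
    field_simp
  rw [← e]
  exact h

lemma continuousOn_div_norm (hr₀ : 0 ≤ r₀) (j : Fin n) :
    ContinuousOn (fun x : 𝔼 => x j / ‖x‖) (exterior n r₀) :=
  ContinuousOn.div (by fun_prop) continuous_norm.continuousOn
    fun x hx => (lt_of_le_of_lt hr₀ hx).ne'

lemma continuousOn_pderiv {S : Set 𝔼} (hS : UniqueDiffOn ℝ S) (hf : ContDiffOn ℝ 1 f S)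
    (j : Fin n) : ContinuousOn (pderiv S j f) S :=
  (hf.continuousOn_fderivWithin hS le_rfl).clm_apply continuousOn_const

/-- The integrand is the `j`-th derivative of the compactly supported function `η(|x|) f`, so no
boundary term appears. -/
lemma integral_cutoff_pderiv (hr₀ : 0 ≤ r₀) (hη : ContDiff ℝ 1 η) (hc : HasCompactSupport η)
    (hs : tsupport η ⊆ Ioi r₀) (hf : ContDiffOn ℝ 1 f (exterior n r₀)) (j : Fin n) :
    ∫ x : 𝔼, (η ‖x‖ * pderiv (exterior n r₀) j f x + deriv η ‖x‖ * (f x * (x j / ‖x‖))) = 0 := by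
  have hη' : Continuous (deriv η) := hη.continuous_deriv (by simp)
  have hs' : tsupport (deriv η) ⊆ Ioi r₀ :=
    (closure_minimal (support_deriv_subset) (isClosed_tsupport η)).trans hs
  have hd : ∀ x : 𝔼, DifferentiableAt ℝ (fun x : 𝔼 => η ‖x‖ * f x) x ∧
      fderiv ℝ (fun x : 𝔼 => η ‖x‖ * f x) x (EuclideanSpace.single j 1) =
      η ‖x‖ * pderiv (exterior n r₀) j f x + deriv η ‖x‖ * (f x * (x j / ‖x‖)) := by
    intro x
    by_cases hx : ‖x‖ ∈ tsupport η
    · have hxe : x ∈ exterior n r₀ := hs hx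
      have hx0 : x ≠ 0 := norm_pos_iff.1 (lt_of_le_of_lt hr₀ hxe)
      have h1 := ((hη.differentiable (by simp) ‖x‖).hasDerivAt).comp_hasFDerivAt x
        (hasFDerivAt_norm hx0)
      have h2 : HasFDerivAt f (fderivWithin ℝ f (exterior n r₀) x) x :=
        ((hf.differentiableOn (by simp) x hxe).hasFDerivWithinAt).hasFDerivAt
          ((isOpen_exterior r₀).mem_nhds hxe)
      have h3 := h1.mul h2
      refine ⟨h3.differentiableAt, ?_⟩
      have := congrArg (fun L : 𝔼 →L[ℝ] ℝ => L (EuclideanSpace.single j 1)) h3.fderiv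
      simp only [add_apply, smul_apply, innerSL_apply_apply, EuclideanSpace.inner_single_right,
        smul_eq_mul, Function.comp_apply] at this
      refine this.trans ?_
      simp [pderiv]
      ring
    · have h0 : (fun x : 𝔼 => η ‖x‖ * f x) =ᶠ[𝓝 x] fun _ => 0 := by
        have : (fun x : 𝔼 => ‖x‖) ⁻¹' (tsupport η)ᶜ ∈ 𝓝 x :=
          ((isClosed_tsupport η).isOpen_compl.preimage continuous_norm).mem_nhds hx
        filter_upwards [this] with y hy
        rw [image_eq_zero_of_notMem_tsupport hy, zero_mul]
      refine ⟨(differentiableAt_const _).congr_of_eventuallyEq h0, ?_⟩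
      rw [h0.fderiv_eq, image_eq_zero_of_notMem_tsupport hx,
        Function.notMem_support.1 fun h => hx (support_deriv_subset h)]
      simp
  have i1 : Integrable fun x : 𝔼 => η ‖x‖ * pderiv (exterior n r₀) j f x +
      deriv η ‖x‖ * (f x * (x j / ‖x‖)) := (integrable_cutoff_mul hη.continuous hc hs
    (continuousOn_pderiv (isOpen_exterior r₀).uniqueDiffOn hf j)).add
    (integrable_cutoff_mul hη' hc.deriv hs' (hf.continuousOn.mul (continuousOn_div_norm hr₀ j)))
  have i2 := integrable_cutoff_mul hη.continuous hc hs hf.continuousOn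
  have := integral_mul_fderiv_eq_neg_fderiv_mul_of_integrable (μ := volume) (f := fun _ : 𝔼 => (1 : ℝ))
    (g := fun x : 𝔼 => η ‖x‖ * f x) (v := EuclideanSpace.single j 1) (by simp)
    (by simpa only [one_mul, hd] using i1)
    (by simpa only [one_mul] using i2) (fun x _ => differentiableAt_const _)
    (fun x _ => (hd x).1)
  simpa [hd] using this

/-- Truncating the radius at `r₁ > r₀` gives a function continuous on all of `ℝ`, as the weak
derivative lemmas require, without changing it for `r ≥ r₁`. -/
lemma continuous_sphereIntegral_max {r₁ : ℝ} (h₀ : 0 ≤ r₀) (h₁ : r₀ < r₁)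
    (hf : ContinuousOn f (exterior n r₀)) :
    Continuous fun r : ℝ => sphereIntegral (max r r₁) f := by
  unfold sphereIntegral
  refine ((continuous_id.max continuous_const).pow _).mul ?_
  have := continuous_parametric_integral_of_continuous
    (μ := (volume : Measure 𝔼).toSphere)
    (f := fun (r : ℝ) (u : Metric.sphere (0 : 𝔼) 1) => f (max r r₁ • (u : 𝔼))) ?_ isCompact_univ
  · simpa using this
  · refine hf.comp_continuous (by fun_prop) fun p => ?_
    have : ‖(p.2 : 𝔼)‖ = 1 := by simp
    have hp : 0 ≤ max p.1 r₁ := (h₀.trans h₁.le).trans (le_max_right _ _)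
    simp only [exterior, mem_ofPred_eq, norm_smul, this, mul_one, Real.norm_eq_abs, abs_of_nonneg hp]
    exact lt_of_lt_of_le h₁ (le_max_right _ _)

lemma continuous_comp_sphere {r : ℝ} (h₀ : 0 ≤ r₀) (hr : r₀ < r)
    (hf : ContinuousOn f (exterior n r₀)) :
    Continuous fun u : Metric.sphere (0 : 𝔼) 1 => f (r • (u : 𝔼)) := by
  refine hf.comp_continuous (by fun_prop) fun u => ?_
  have : ‖(u : 𝔼)‖ = 1 := by simp
  simp only [exterior, mem_ofPred_eq, norm_smul, this, mul_one, Real.norm_eq_abs,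
    abs_of_nonneg (h₀.trans hr.le)]
  exact hr

lemma integrable_comp_sphere {r : ℝ} (h₀ : 0 ≤ r₀) (hr : r₀ < r)
    (hf : ContinuousOn f (exterior n r₀)) :
    Integrable (fun u : Metric.sphere (0 : 𝔼) 1 => f (r • (u : 𝔼)))
      (volume : Measure 𝔼).toSphere :=
  (continuous_comp_sphere h₀ hr hf).integrable_of_hasCompactSupport
    (HasCompactSupport.of_compactSpace _)

lemma sphereIntegral_cutoff_mul {r : ℝ} (hr : 0 ≤ r) (f : 𝔼 → ℝ) (η : ℝ → ℝ) :
    sphereIntegral r (fun x => η ‖x‖ * f x) = η r * sphereIntegral r f := by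
  simp only [sphereIntegral, norm_smul, Real.norm_eq_abs, abs_of_nonneg hr, norm_eq_of_mem_sphere,
    mul_one]
  rw [integral_const_mul]
  ring

/-- The divergence of the vector field with components `V j`, on the exterior region. -/
def divergence (r₀ : ℝ) (V : Fin n → EuclideanSpace ℝ (Fin n) → ℝ)
    (x : EuclideanSpace ℝ (Fin n)) : ℝ := ∑ j, pderiv (exterior n r₀) j (V j) x

/-- The flux of the vector field with components `V j` through the sphere of radius `r`. -/
def flux (V : Fin n → EuclideanSpace ℝ (Fin n) → ℝ) (r : ℝ) : ℝ :=
  sphereIntegral r fun x => ∑ j, V j x * (x j / ‖x‖)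

variable {V : Fin n → EuclideanSpace ℝ (Fin n) → ℝ}

lemma continuousOn_divergence (hV : ∀ j, ContDiffOn ℝ 1 (V j) (exterior n r₀)) :
    ContinuousOn (divergence r₀ V) (exterior n r₀) :=
  continuousOn_finsetSum _ fun j _ =>
    continuousOn_pderiv (isOpen_exterior r₀).uniqueDiffOn (hV j) j

/-- The divergence theorem in an annulus, in polar form. -/
lemma flux_sub_flux (hn : 0 < n) (h₀ : 0 ≤ r₀) (hV : ∀ j, ContDiffOn ℝ 1 (V j) (exterior n r₀)) {a b : ℝ}
    (ha : r₀ < a) (hab : a ≤ b) :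
    flux V b - flux V a = ∫ r in a..b, sphereIntegral r (divergence r₀ V) := by
  obtain ⟨r₁, h₁, h₁a⟩ := exists_between ha
  have hD := continuousOn_divergence hV
  have hN : ContinuousOn (fun x : 𝔼 => ∑ j, V j x * (x j / ‖x‖)) (exterior n r₀) :=
    continuousOn_finsetSum _ fun j _ => (hV j).continuousOn.mul (continuousOn_div_norm h₀ j)
  have key := sub_eq_integral_of_weak_deriv (F := fun r => flux V (max r r₁))
    (D := fun r => sphereIntegral (max r r₁) (divergence r₀ V))
    (continuous_sphereIntegral_max h₀ h₁ hN) (continuous_sphereIntegral_max h₀ h₁ hD) (c := r₁)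
    (fun η h1 h2 h3 => ?_) h₁a hab
  · simp only [max_eq_left h₁a.le, max_eq_left (h₁a.le.trans hab)] at key
    rw [key]
    refine intervalIntegral.integral_congr fun r hr => ?_
    rw [uIcc_of_le hab] at hr
    simp only [max_eq_left (h₁a.le.trans hr.1)]
  · have h3' : tsupport η ⊆ Ioi r₀ := h3.trans (Ioi_subset_Ioi h₁.le)
    have hη' : Continuous (deriv η) := h1.continuous_deriv (by simp)
    have hs' : tsupport (deriv η) ⊆ Ioi r₀ :=
      (closure_minimal (support_deriv_subset) (isClosed_tsupport η)).trans h3'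
    have z : ∀ r, r ≤ r₁ → η r = 0 ∧ deriv η r = 0 := fun r hr => by
      have : r ∉ tsupport η := fun h => not_lt.2 hr (h3 h)
      exact ⟨image_eq_zero_of_notMem_tsupport this,
        Function.notMem_support.1 fun h => this (support_deriv_subset h)⟩
    have i1 := integrable_cutoff_mul h1.continuous h2 h3' hD
    have i2 := integrable_cutoff_mul hη' h2.deriv hs' hN
    -- The integral of `div (η(|x|) V)` vanishes. In polar coordinates this says that the sphere
    -- integral of `div V` is the weak derivative of the flux.
    have e : ∫ x : 𝔼, (η ‖x‖ * divergence r₀ V x +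
        deriv η ‖x‖ * ∑ j, V j x * (x j / ‖x‖)) = 0 := by
      have : ∀ x : 𝔼, η ‖x‖ * divergence r₀ V x + deriv η ‖x‖ * ∑ j, V j x * (x j / ‖x‖) =
          ∑ j, (η ‖x‖ * pderiv (exterior n r₀) j (V j) x +
            deriv η ‖x‖ * (V j x * (x j / ‖x‖))) := fun x => by
        rw [divergence, Finset.mul_sum, Finset.mul_sum, Finset.sum_add_distrib]
      simp only [this]
      rw [integral_finsetSum]
      · exact Finset.sum_eq_zero fun j _ => integral_cutoff_pderiv h₀ h1 h2 h3' (hV j) j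
      · exact fun j _ => (integrable_cutoff_mul h1.continuous h2 h3'
          (continuousOn_pderiv (isOpen_exterior r₀).uniqueDiffOn (hV j) j)).add
          (integrable_cutoff_mul hη' h2.deriv hs'
            ((hV j).continuousOn.mul (continuousOn_div_norm h₀ j)))
    rw [integral_eq_integral_sphereIntegral hn (f := fun x => η ‖x‖ * divergence r₀ V x +
        deriv η ‖x‖ * ∑ j, V j x * (x j / ‖x‖)) (i1.add i2)] at e
    rw [← e, ← setIntegral_eq_integral_of_forall_compl_eq_zero (s := Ioi (0 : ℝ))]
    · refine setIntegral_congr_fun measurableSet_Ioi fun r hr => ?_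
      have hr0 : (0 : ℝ) ≤ r := le_of_lt hr
      rcases le_or_gt r r₁ with hle | hlt
      · simp only [sphereIntegral, norm_smul, Real.norm_eq_abs, abs_of_nonneg hr0,
          norm_eq_of_mem_sphere, mul_one, (z r hle).1, (z r hle).2]
        simp
      · have hlt0 := h₁.trans hlt
        simp only [max_eq_left hlt.le]
        rw [flux, ← sphereIntegral_cutoff_mul hr0, ← sphereIntegral_cutoff_mul hr0]
        simp only [sphereIntegral]
        rw [← mul_add, ← integral_add]
        · exact integrable_comp_sphere h₀ hlt0
            (continuous_cutoff_mul h1.continuous h3' hD).continuousOn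
        · exact integrable_comp_sphere h₀ hlt0
            (continuous_cutoff_mul hη' hs' hN).continuousOn
    · intro r hr
      have hr : r ≤ r₁ := (not_lt.1 hr).trans (h₀.trans h₁.le)
      simp only [(z r hr).1, (z r hr).2]
      simp

lemma integrableOn_annulus {a b : ℝ} (ha : r₀ < a) (hf : ContinuousOn f (exterior n r₀)) :
    IntegrableOn f {x : 𝔼 | a < ‖x‖ ∧ ‖x‖ ≤ b} := by
  have hc : IsCompact {x : 𝔼 | a ≤ ‖x‖ ∧ ‖x‖ ≤ b} := by
    refine (isCompact_closedBall (0 : 𝔼) b).of_isClosed_subset ?_ fun x hx => by simpa using hx.2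
    exact (isClosed_le continuous_const continuous_norm).inter
      (isClosed_le continuous_norm continuous_const)
  exact ((hf.mono fun x hx => lt_of_lt_of_le ha hx.1).integrableOn_compact hc).mono_set
    fun x hx => ⟨hx.1.le, hx.2⟩

/-- The divergence theorem in an annulus. -/
theorem flux_sub_flux_eq_setIntegral (hn : 0 < n) (h₀ : 0 ≤ r₀)
    (hV : ∀ j, ContDiffOn ℝ 1 (V j) (exterior n r₀)) {a b : ℝ} (ha : r₀ < a) (hab : a ≤ b) :
    flux V b - flux V a = ∫ x in {x : 𝔼 | a < ‖x‖ ∧ ‖x‖ ≤ b}, divergence r₀ V x := by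
  have hm : MeasurableSet {x : 𝔼 | a < ‖x‖ ∧ ‖x‖ ≤ b} :=
    (measurableSet_lt measurable_const measurable_norm).inter
      (measurableSet_le measurable_norm measurable_const)
  have hi := integrableOn_annulus (b := b) ha (continuousOn_divergence hV)
  rw [flux_sub_flux hn h₀ hV ha hab, ← integral_indicator hm,
    integral_eq_integral_sphereIntegral hn ((integrable_indicator_iff hm).2 hi),
    intervalIntegral.integral_of_le hab]
  have e : ∀ r ∈ Ioi (0 : ℝ), sphereIntegral r
      ({x : 𝔼 | a < ‖x‖ ∧ ‖x‖ ≤ b}.indicator (divergence r₀ V)) =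
      (Ioc a b).indicator (fun r => sphereIntegral r (divergence r₀ V)) r := by
    intro r hr
    have hr0 : (0 : ℝ) ≤ r := le_of_lt hr
    simp only [sphereIntegral, indicator_apply, mem_ofPred_eq, norm_smul, Real.norm_eq_abs,
      abs_of_nonneg hr0, norm_eq_of_mem_sphere, mul_one, mem_Ioc]
    split_ifs with h
    · rfl
    · simp
  rw [setIntegral_congr_fun measurableSet_Ioi e, setIntegral_indicator measurableSet_Ioc,
    inter_eq_self_of_subset_right
      (show Ioc a b ⊆ Ioi 0 from fun r hr => lt_of_le_of_lt (h₀.trans ha.le) hr.1)]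

end Divergence

end Polar

/-! ### The scalar curvature as a function of the 2-jet of the metric -/

section Jets

variable {n : ℕ}

local notation "𝔼" => EuclideanSpace ℝ (Fin n)

/-- `∂ᵢ gₘⱼ + ∂ⱼ gₘᵢ - ∂ₘ gᵢⱼ` in terms of the first derivatives `d l a b = ∂ₗ gₐᵦ`. -/
def lowerJet (d : Fin n → Fin n → Fin n → ℝ) (m i j : Fin n) : ℝ := d i m j + d j m i - d m i j

/-- The Christoffel symbols in terms of the inverse `P` and the first derivatives `d`. -/
def christoffelJet (P : Matrix (Fin n) (Fin n) ℝ) (d : Fin n → Fin n → Fin n → ℝ)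
    (k i j : Fin n) : ℝ := (1 / 2) * ∑ m, P k m * lowerJet d m i j

/-- The derivatives of the inverse metric. -/
def invJet (P : Matrix (Fin n) (Fin n) ℝ) (d : Fin n → Fin n → Fin n → ℝ) (l k m : Fin n) : ℝ :=
  -∑ b, (∑ a, P k a * d l a b) * P b m

/-- The derivatives `∂ₗ Γᵏᵢⱼ` of the Christoffel symbols, in terms of the inverse metric `P`, and
the first and second derivatives `d`, `dd` of the metric. -/
def christoffelDerivJet (P : Matrix (Fin n) (Fin n) ℝ) (d : Fin n → Fin n → Fin n → ℝ)
    (dd : Fin n → Fin n → Fin n → Fin n → ℝ) (l k i j : Fin n) : ℝ :=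
  (1 / 2) * ∑ m, (invJet P d l k m * lowerJet d m i j + P k m * lowerJet (dd l) m i j)

/-- The sum over `i` in the formula of the scalar curvature. -/
def ricciJet (P : Matrix (Fin n) (Fin n) ℝ) (d : Fin n → Fin n → Fin n → ℝ)
    (dd : Fin n → Fin n → Fin n → Fin n → ℝ) (j k : Fin n) : ℝ :=
  ∑ i, (christoffelDerivJet P d dd i i j k - christoffelDerivJet P d dd k i i j
    + ∑ m, (christoffelJet P d m j k * christoffelJet P d i i m
      - christoffelJet P d m i j * christoffelJet P d i k m))

/-- The scalar curvature as a polynomial in the inverse metric and the first and second derivatives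
of the metric. -/
def scalarJet (P : Matrix (Fin n) (Fin n) ℝ) (d : Fin n → Fin n → Fin n → ℝ)
    (dd : Fin n → Fin n → Fin n → Fin n → ℝ) : ℝ := ∑ j, ∑ k, P j k * ricciJet P d dd j k

/-- The first derivatives of the metric components. -/
def metricDeriv (S : Set (EuclideanSpace ℝ (Fin n)))
    (G : EuclideanSpace ℝ (Fin n) → Matrix (Fin n) (Fin n) ℝ) (y : EuclideanSpace ℝ (Fin n))
    (l a b : Fin n) : ℝ := pderiv S l (fun z => G z a b) y

/-- The second derivatives of the metric components. -/
def metricDeriv₂ (S : Set (EuclideanSpace ℝ (Fin n)))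
    (G : EuclideanSpace ℝ (Fin n) → Matrix (Fin n) (Fin n) ℝ) (y : EuclideanSpace ℝ (Fin n))
    (l i a b : Fin n) : ℝ := pderiv S l (pderiv S i fun z => G z a b) y

section Rules

variable {S : Set (EuclideanSpace ℝ (Fin n))} {y : EuclideanSpace ℝ (Fin n)}
  {f f' : EuclideanSpace ℝ (Fin n) → ℝ}

lemma pderiv_add (hS : UniqueDiffWithinAt ℝ S y) (hf : DifferentiableWithinAt ℝ f S y)
    (hf' : DifferentiableWithinAt ℝ f' S y) (i : Fin n) :
    pderiv S i (fun z => f z + f' z) y = pderiv S i f y + pderiv S i f' y := by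
  rw [pderiv, fderivWithin_fun_add hS hf hf']
  rfl

lemma pderiv_sub (hS : UniqueDiffWithinAt ℝ S y) (hf : DifferentiableWithinAt ℝ f S y)
    (hf' : DifferentiableWithinAt ℝ f' S y) (i : Fin n) :
    pderiv S i (fun z => f z - f' z) y = pderiv S i f y - pderiv S i f' y := by
  rw [pderiv, fderivWithin_fun_sub hS hf hf']
  rfl

lemma pderiv_mul (hS : UniqueDiffWithinAt ℝ S y) (hf : DifferentiableWithinAt ℝ f S y)
    (hf' : DifferentiableWithinAt ℝ f' S y) (i : Fin n) :
    pderiv S i (fun z => f z * f' z) y = pderiv S i f y * f' y + f y * pderiv S i f' y := by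
  rw [pderiv, fderivWithin_fun_mul hS hf hf']
  simp [pderiv]
  ring

lemma pderiv_const_mul (hS : UniqueDiffWithinAt ℝ S y) (hf : DifferentiableWithinAt ℝ f S y)
    (c : ℝ) (i : Fin n) : pderiv S i (fun z => c * f z) y = c * pderiv S i f y := by
  rw [pderiv, fderivWithin_const_mul hS hf]
  rfl

lemma pderiv_sum (hS : UniqueDiffWithinAt ℝ S y) {ι : Type*} {s : Finset ι}
    {F : ι → EuclideanSpace ℝ (Fin n) → ℝ} (h : ∀ m ∈ s, DifferentiableWithinAt ℝ (F m) S y)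
    (i : Fin n) : pderiv S i (fun z => ∑ m ∈ s, F m z) y = ∑ m ∈ s, pderiv S i (F m) y := by
  rw [pderiv, fderivWithin_fun_sum hS h]
  simp [pderiv]

lemma pderiv_const (c : ℝ) (i : Fin n) : pderiv S i (fun _ => c) y = 0 := by
  simp [pderiv]

end Rules

variable {S : Set (EuclideanSpace ℝ (Fin n))} {y : EuclideanSpace ℝ (Fin n)}
  {G : EuclideanSpace ℝ (Fin n) → Matrix (Fin n) (Fin n) ℝ}

lemma IsC2MetricOn.differentiableOn_pderiv (h : IsC2MetricOn S G) (hS : UniqueDiffOn ℝ S)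
    (l i j : Fin n) : DifferentiableOn ℝ (pderiv S l (fun z => G z i j)) S :=
  (h.contDiffOn_pderiv hS l i j).differentiableOn (by norm_num)

/-- Differentiate `G⁻¹ G = 1` and multiply by `G⁻¹` on the right. -/
lemma IsC2MetricOn.pderiv_inv (h : IsC2MetricOn S G) (hS : UniqueDiffOn ℝ S) (hy : y ∈ S)
    (l k m : Fin n) : pderiv S l (fun z => (G z)⁻¹ k m) y =
      invJet (G y)⁻¹ (metricDeriv S G y) l k m := by
  have hP : ∀ i j, DifferentiableWithinAt ℝ (fun z => (G z)⁻¹ i j) S y := fun i j =>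
    (h.contDiffOn_inv i j).differentiableOn (by norm_num) y hy
  have hG : ∀ i j, DifferentiableWithinAt ℝ (fun z => G z i j) S y := fun i j =>
    h.differentiableOn i j y hy
  set DP : Matrix (Fin n) (Fin n) ℝ := Matrix.of fun i j => pderiv S l (fun z => (G z)⁻¹ i j) y
  set DG : Matrix (Fin n) (Fin n) ℝ := Matrix.of fun i j => metricDeriv S G y l i j
  have e : DP * G y + (G y)⁻¹ * DG = 0 := by
    ext i j
    have h1 : pderiv S l (fun z => ∑ b, (G z)⁻¹ i b * G z b j) y = 0 := by
      rw [pderiv_congr (f' := fun _ => (1 : Matrix (Fin n) (Fin n) ℝ) i j) (fun z hz => ?_) hy,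
        pderiv_const]
      rw [← h.inv_mul hz, Matrix.mul_apply]
    rw [pderiv_sum (hS y hy) fun b _ => (hP i b).fun_mul (hG b j)] at h1
    simp only [Matrix.add_apply, Matrix.mul_apply, Matrix.zero_apply]
    rw [← h1, ← Finset.sum_add_distrib]
    refine Finset.sum_congr rfl fun b _ => ?_
    rw [pderiv_mul (hS y hy) (hP i b) (hG b j)]
    rfl
  have e2 : DP = -((G y)⁻¹ * DG * (G y)⁻¹) := by
    have e3 : DP * G y = -((G y)⁻¹ * DG) := eq_neg_of_add_eq_zero_left e
    rw [← Matrix.neg_mul, ← e3, Matrix.mul_assoc,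
      Matrix.mul_nonsing_inv _ (h.det_ne_zero hy).isUnit, Matrix.mul_one]
  have := congrFun (congrFun e2 k) m
  simp only [Matrix.neg_apply, Matrix.mul_apply] at this
  exact this

lemma IsC2MetricOn.coordScalarCurvature_eq (h : IsC2MetricOn S G) (hS : UniqueDiffOn ℝ S)
    (hy : y ∈ S) : coordScalarCurvature S G y =
      scalarJet (G y)⁻¹ (metricDeriv S G y) (metricDeriv₂ S G y) := by
  have hP : ∀ i j, DifferentiableWithinAt ℝ (fun z => (G z)⁻¹ i j) S y := fun i j =>
    (h.contDiffOn_inv i j).differentiableOn (by norm_num) y hy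
  have hd : ∀ l i j, DifferentiableWithinAt ℝ (pderiv S l (fun z => G z i j)) S y := fun l i j =>
    h.differentiableOn_pderiv hS l i j y hy
  have e : ∀ l k i j, pderiv S l (christoffel S G k i j) y =
      christoffelDerivJet (G y)⁻¹ (metricDeriv S G y) (metricDeriv₂ S G y) l k i j := by
    intro l k i j
    have hA : ∀ m, DifferentiableWithinAt ℝ (fun y => pderiv S i (fun z => G z m j) y +
        pderiv S j (fun z => G z m i) y - pderiv S m (fun z => G z i j) y) S y := fun m =>
      ((hd i m j).fun_add (hd j m i)).fun_sub (hd m i j)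
    unfold christoffel christoffelDerivJet
    rw [pderiv_const_mul (hS y hy) (DifferentiableWithinAt.fun_sum fun m _ => (hP k m).fun_mul (hA m)),
      pderiv_sum (hS y hy) fun m _ => (hP k m).fun_mul (hA m)]
    congr 1
    refine Finset.sum_congr rfl fun m _ => ?_
    rw [pderiv_mul (hS y hy) (hP k m) (hA m), h.pderiv_inv hS hy,
      pderiv_sub (hS y hy) ((hd i m j).fun_add (hd j m i)) (hd m i j),
      pderiv_add (hS y hy) (hd i m j) (hd j m i)]
    rfl
  simp only [coordScalarCurvature, e]
  rfl

/-! ### Dependence of the scalar curvature on the jet of the metric -/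

section Limits

variable {α : Type*} {l : Filter α} {P : α → Matrix (Fin n) (Fin n) ℝ}
  {d : α → Fin n → Fin n → Fin n → ℝ} {dd : α → Fin n → Fin n → Fin n → Fin n → ℝ}

/-- The expression is a polynomial in its arguments. A general filter is kept because, through
`tendsto_sqrt_det_mul_scalarJet`, the lemma serves continuity in the point, convergence along the
sequence, and joint convergence in both. -/
lemma tendsto_scalarJet {P₀ : Matrix (Fin n) (Fin n) ℝ} {d₀ : Fin n → Fin n → Fin n → ℝ}
    {dd₀ : Fin n → Fin n → Fin n → Fin n → ℝ}
    (hP : ∀ i j, Tendsto (fun x => P x i j) l (𝓝 (P₀ i j)))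
    (hd : ∀ i j k, Tendsto (fun x => d x i j k) l (𝓝 (d₀ i j k)))
    (hdd : ∀ i j k m, Tendsto (fun x => dd x i j k m) l (𝓝 (dd₀ i j k m))) :
    Tendsto (fun x => scalarJet (P x) (d x) (dd x)) l (𝓝 (scalarJet P₀ d₀ dd₀)) := by
  have hA : ∀ m i j, Tendsto (fun x => lowerJet (d x) m i j) l (𝓝 (lowerJet d₀ m i j)) :=
    fun m i j => ((hd _ _ _).add (hd _ _ _)).sub (hd _ _ _)
  have hB : ∀ r m i j, Tendsto (fun x => lowerJet (dd x r) m i j) l (𝓝 (lowerJet (dd₀ r) m i j)) :=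
    fun r m i j => ((hdd _ _ _ _).add (hdd _ _ _ _)).sub (hdd _ _ _ _)
  have hC : ∀ k i j, Tendsto (fun x => christoffelJet (P x) (d x) k i j) l
      (𝓝 (christoffelJet P₀ d₀ k i j)) := fun k i j =>
    (tendsto_finsetSum _ fun m _ => (hP _ _).mul (hA _ _ _)).const_mul _
  have hQ : ∀ r k m, Tendsto (fun x => invJet (P x) (d x) r k m) l (𝓝 (invJet P₀ d₀ r k m)) :=
    fun r k m => (tendsto_finsetSum _ fun b _ =>
      (tendsto_finsetSum _ fun a _ => (hP _ _).mul (hd _ _ _)).mul (hP _ _)).neg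
  have hD : ∀ r k i j, Tendsto (fun x => christoffelDerivJet (P x) (d x) (dd x) r k i j) l
      (𝓝 (christoffelDerivJet P₀ d₀ dd₀ r k i j)) := fun r k i j =>
    (tendsto_finsetSum _ fun m _ =>
      ((hQ _ _ _).mul (hA _ _ _)).add ((hP _ _).mul (hB _ _ _ _))).const_mul _
  exact tendsto_finsetSum _ fun j _ => tendsto_finsetSum _ fun k _ => (hP _ _).mul
    (tendsto_finsetSum _ fun i _ => ((hD _ _ _ _).sub (hD _ _ _ _)).add
      (tendsto_finsetSum _ fun m _ => ((hC _ _ _).mul (hC _ _ _)).sub ((hC _ _ _).mul (hC _ _ _))))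

lemma tendsto_det {A : α → Matrix (Fin n) (Fin n) ℝ} {A₀ : Matrix (Fin n) (Fin n) ℝ}
    (h : ∀ i j, Tendsto (fun x => A x i j) l (𝓝 (A₀ i j))) :
    Tendsto (fun x => (A x).det) l (𝓝 A₀.det) :=
  ((continuous_id.matrix_det).tendsto A₀).comp
    (tendsto_pi_nhds.2 fun i => tendsto_pi_nhds.2 fun j => h i j)

lemma tendsto_matrix_inv {A : α → Matrix (Fin n) (Fin n) ℝ} {A₀ : Matrix (Fin n) (Fin n) ℝ}
    (h : ∀ i j, Tendsto (fun x => A x i j) l (𝓝 (A₀ i j))) (h₀ : A₀.det ≠ 0) (i j : Fin n) :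
    Tendsto (fun x => (A x)⁻¹ i j) l (𝓝 (A₀⁻¹ i j)) := by
  have h1 : Tendsto A l (𝓝 A₀) := tendsto_pi_nhds.2 fun i => tendsto_pi_nhds.2 fun j => h i j
  have h2 : Tendsto (fun x => (A x).adjugate) l (𝓝 A₀.adjugate) :=
    ((continuous_id.matrix_adjugate).tendsto A₀).comp h1
  simp only [Matrix.inv_def, Matrix.smul_apply, Ring.inverse_eq_inv', smul_eq_mul]
  exact ((tendsto_det h).inv₀ h₀).mul (tendsto_pi_nhds.1 (tendsto_pi_nhds.1 h2 i) j)

/-- The density `R √g` of the total scalar curvature depends continuously on the jet of the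
metric. -/
lemma tendsto_sqrt_det_mul_scalarJet {A : α → Matrix (Fin n) (Fin n) ℝ}
    {A₀ : Matrix (Fin n) (Fin n) ℝ} {d₀ : Fin n → Fin n → Fin n → ℝ}
    {dd₀ : Fin n → Fin n → Fin n → Fin n → ℝ} (h₀ : A₀.det ≠ 0)
    (hA : ∀ i j, Tendsto (fun x => A x i j) l (𝓝 (A₀ i j)))
    (hd : ∀ i j k, Tendsto (fun x => d x i j k) l (𝓝 (d₀ i j k)))
    (hdd : ∀ i j k m, Tendsto (fun x => dd x i j k m) l (𝓝 (dd₀ i j k m))) :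
    Tendsto (fun x => Real.sqrt (A x).det * scalarJet (A x)⁻¹ (d x) (dd x)) l
      (𝓝 (Real.sqrt A₀.det * scalarJet A₀⁻¹ d₀ dd₀)) :=
  (tendsto_det hA).sqrt.mul (tendsto_scalarJet (tendsto_matrix_inv hA h₀) hd hdd)

end Limits

/-! ### The quadratic error of the linearized scalar curvature -/

section Estimates

open Asymptotics

variable {α : Type*} {l : Filter α} {P : α → Matrix (Fin n) (Fin n) ℝ}
  {d : α → Fin n → Fin n → Fin n → ℝ} {dd : α → Fin n → Fin n → Fin n → Fin n → ℝ}
  {a b c : α → ℝ}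

/-- The linearization `∑ ∂ⱼ (∂ᵢ gᵢⱼ - ∂ⱼ gᵢᵢ)` of the scalar curvature at the flat metric. -/
def linearJet (dd : Fin n → Fin n → Fin n → Fin n → ℝ) : ℝ := ∑ j, ∑ i, (dd j i i j - dd j j i i)

/-- The scalar curvature agrees with its linearization at the flat metric up to quadratic terms. -/
lemma isBigO_scalarJet_sub_linearJet
    (hP : ∀ i j, (fun x => P x i j - (1 : Matrix (Fin n) (Fin n) ℝ) i j) =O[l] a)
    (ha : a =O[l] fun _ => (1 : ℝ)) (hd : ∀ i j k, (fun x => d x i j k) =O[l] b)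
    (hdd : ∀ i j k m, (fun x => dd x i j k m) =O[l] c)
    (hbb : (fun x => b x * b x) =O[l] fun x => a x * c x)
    (hsymm : ∀ x i j k m, dd x i j k m = dd x i j m k) :
    (fun x => scalarJet (P x) (d x) (dd x) - linearJet (dd x)) =O[l] fun x => a x * c x := by
  -- Here `a`, `b`, `c` bound `g⁻¹ - δ`, `∂g` and `∂²g`. The hypothesis `hbb` puts products of two
  -- first derivatives into the same error class as `(g⁻¹ - δ) ∂²g`.
  have hP1 : ∀ i j, (fun x => P x i j) =O[l] fun _ => (1 : ℝ) := fun i j => by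
    have := ((hP i j).trans ha).add
      (isBigO_const_const ((1 : Matrix (Fin n) (Fin n) ℝ) i j) one_ne_zero l)
    simpa using this
  have one_b : ∀ f g : α → ℝ, f =O[l] (fun _ => (1 : ℝ)) → g =O[l] b →
      (fun x => f x * g x) =O[l] b := fun f g hf hg => by simpa using hf.mul hg
  have hac : (fun x => a x * c x) =O[l] c := by simpa using ha.mul (isBigO_refl c l)
  have hA : ∀ m i j, (fun x => lowerJet (d x) m i j) =O[l] b := fun m i j =>
    ((hd _ _ _).add (hd _ _ _)).sub (hd _ _ _)
  have hB : ∀ r m i j, (fun x => lowerJet (dd x r) m i j) =O[l] c := fun r m i j =>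
    ((hdd _ _ _ _).add (hdd _ _ _ _)).sub (hdd _ _ _ _)
  have hC : ∀ k i j, (fun x => christoffelJet (P x) (d x) k i j) =O[l] b := fun k i j =>
    (IsBigO.fun_sum fun m _ => one_b _ _ (hP1 _ _) (hA _ _ _)).const_mul_left _
  have hQ : ∀ r k m, (fun x => invJet (P x) (d x) r k m) =O[l] b := fun r k m => by
    refine IsBigO.neg_left (IsBigO.fun_sum fun e _ => ?_)
    simp only [mul_comm _ (P _ e m)]
    exact one_b _ _ (hP1 _ _) (IsBigO.fun_sum fun f _ => one_b _ _ (hP1 _ _) (hd _ _ _))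
  -- The main term arises by replacing `g⁻¹` with the identity. The errors are the derivative of
  -- `g⁻¹` times `∂g`, of size `b²`, and `(g⁻¹ - δ) ∂²g`, of size `a c`.
  have hD : ∀ r k i j, (fun x => christoffelDerivJet (P x) (d x) (dd x) r k i j -
      (1 / 2) * lowerJet (dd x r) k i j) =O[l] fun x => a x * c x := by
    intro r k i j
    have e : ∀ x, christoffelDerivJet (P x) (d x) (dd x) r k i j -
        (1 / 2) * lowerJet (dd x r) k i j = (1 / 2) * ∑ m, (invJet (P x) (d x) r k m *
        lowerJet (d x) m i j + (P x k m - (1 : Matrix (Fin n) (Fin n) ℝ) k m) *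
          lowerJet (dd x r) m i j) := by
      intro x
      have : ∑ m, (1 : Matrix (Fin n) (Fin n) ℝ) k m * lowerJet (dd x r) m i j =
          lowerJet (dd x r) k i j := by simp [Matrix.one_apply]
      simp only [christoffelDerivJet, sub_mul, Finset.sum_add_distrib, Finset.sum_sub_distrib, this]
      ring
    simp only [e]
    exact (IsBigO.fun_sum fun m _ => (((hQ _ _ _).mul (hA _ _ _)).trans hbb).add
      ((hP _ _).mul (hB _ _ _ _))).const_mul_left _
  have hX : ∀ j k, (fun x => ricciJet (P x) (d x) (dd x) j k -
      ∑ i, ((1 / 2) * lowerJet (dd x i) i j k - (1 / 2) * lowerJet (dd x k) i i j)) =O[l]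
      fun x => a x * c x := by
    intro j k
    simp only [ricciJet, ← Finset.sum_sub_distrib]
    refine IsBigO.fun_sum fun i _ => ?_
    have h1 := ((hD i i j k).sub (hD k i i j)).add (IsBigO.fun_sum (s := Finset.univ) fun m _ =>
      (((hC m j k).mul (hC i i m)).sub ((hC m i j).mul (hC i k m))).trans hbb)
    refine h1.congr_left fun x => ?_
    ring
  have hY : ∀ j k, (fun x => ∑ i, ((1 / 2) * lowerJet (dd x i) i j k -
      (1 / 2) * lowerJet (dd x k) i i j)) =O[l] c := fun j k =>
    IsBigO.fun_sum fun i _ => ((hB _ _ _ _).const_mul_left _).sub ((hB _ _ _ _).const_mul_left _)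
  have hX' : ∀ j k, (fun x => ricciJet (P x) (d x) (dd x) j k) =O[l] c := fun j k => by
    have := ((hX j k).trans hac).add (hY j k)
    simpa using this
  -- Setting `g⁻¹ = δ` in the main terms gives the linearization. Only relabelling and the symmetry
  -- of the metric components are used; the two derivatives are never exchanged.
  have hlin : ∀ x, linearJet (dd x) = ∑ j, ∑ k, (1 : Matrix (Fin n) (Fin n) ℝ) j k *
      ∑ i, ((1 / 2) * lowerJet (dd x i) i j k - (1 / 2) * lowerJet (dd x k) i i j) := by
    intro x
    have e1 : ∀ j, ∑ k, (1 : Matrix (Fin n) (Fin n) ℝ) j k *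
        ∑ i, ((1 / 2) * lowerJet (dd x i) i j k - (1 / 2) * lowerJet (dd x k) i i j) =
        ∑ i, ((1 / 2) * lowerJet (dd x i) i j j - (1 / 2) * lowerJet (dd x j) i i j) := by
      intro j
      simp [Matrix.one_apply]
    rw [Finset.sum_congr rfl fun j _ => e1 j]
    simp only [linearJet, lowerJet, Finset.sum_sub_distrib, Finset.sum_add_distrib, mul_add,
      mul_sub]
    have s1 : ∑ j, ∑ i, 1 / 2 * dd x i j i j = ∑ j, ∑ i, 1 / 2 * dd x j i i j := by
      rw [Finset.sum_comm]
      exact Finset.sum_congr rfl fun j _ => Finset.sum_congr rfl fun i _ => by rw [hsymm x j i j i]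
    have s2 : ∑ j, ∑ i, 1 / 2 * dd x i i j j = ∑ j, ∑ i, 1 / 2 * dd x j j i i := Finset.sum_comm
    rw [s1, s2]
    simp only [← Finset.mul_sum]
    ring
  have e : ∀ x, scalarJet (P x) (d x) (dd x) - linearJet (dd x) =
      ∑ j, ∑ k, ((P x j k - (1 : Matrix (Fin n) (Fin n) ℝ) j k) * ricciJet (P x) (d x) (dd x) j k +
        (1 : Matrix (Fin n) (Fin n) ℝ) j k * (ricciJet (P x) (d x) (dd x) j k -
        ∑ i, ((1 / 2) * lowerJet (dd x i) i j k - (1 / 2) * lowerJet (dd x k) i i j))) := by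
    intro x
    rw [hlin, scalarJet, ← Finset.sum_sub_distrib]
    refine Finset.sum_congr rfl fun j _ => ?_
    rw [← Finset.sum_sub_distrib]
    exact Finset.sum_congr rfl fun k _ => by ring
  simp only [e]
  exact IsBigO.fun_sum fun j _ => IsBigO.fun_sum fun k _ => ((hP j k).mul (hX' j k)).add
    ((hX j k).const_mul_left _)

/-- With `L` the linearization, `s R - L = s (R - L) + (s - 1) L`: the first term is controlled by
the previous estimate, the second by `a c`. The factor `s` will be `√det g`. -/
lemma isBigO_sqrt_mul_scalarJet_sub_linearJet {s : α → ℝ}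
    (hs : (fun x => s x - 1) =O[l] a)
    (hP : ∀ i j, (fun x => P x i j - (1 : Matrix (Fin n) (Fin n) ℝ) i j) =O[l] a)
    (ha : a =O[l] fun _ => (1 : ℝ)) (hd : ∀ i j k, (fun x => d x i j k) =O[l] b)
    (hdd : ∀ i j k m, (fun x => dd x i j k m) =O[l] c)
    (hbb : (fun x => b x * b x) =O[l] fun x => a x * c x)
    (hsymm : ∀ x i j k m, dd x i j k m = dd x i j m k) :
    (fun x => s x * scalarJet (P x) (d x) (dd x) - linearJet (dd x)) =O[l]
      fun x => a x * c x := by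
  have h1 := isBigO_scalarJet_sub_linearJet hP ha hd hdd hbb hsymm
  have hlin : (fun x => linearJet (dd x)) =O[l] c := IsBigO.fun_sum fun j _ => IsBigO.fun_sum fun i _ =>
    (hdd _ _ _ _).sub (hdd _ _ _ _)
  have hs1 : s =O[l] fun _ => (1 : ℝ) := by
    have := (hs.trans ha).add (isBigO_refl (fun _ => (1 : ℝ)) l)
    simpa using this
  have h2 : (fun x => s x * (scalarJet (P x) (d x) (dd x) - linearJet (dd x))) =O[l]
      fun x => a x * c x := by simpa using hs1.mul h1
  refine (h2.add (hs.mul hlin)).congr_left fun x => ?_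
  ring

end Estimates

end Jets

/-! ### Uniform convergence as joint convergence -/

section UniformLimits

variable {X : Type*} [TopologicalSpace X] {D : Set X} {F : ℕ → X → ℝ} {f : X → ℝ}

/-- Together with its converse on compact sets below, this turns uniform convergence into a plain
limit along `atTop ×ˢ 𝓝[D] x`, so that the continuity of the curvature in the jet applies directly.
-/
lemma tendsto_prod_of_tendstoUniformlyOn (h : TendstoUniformlyOn F f atTop D)
    (hf : ContinuousOn f D) {x : X} (hx : x ∈ D) :
    Tendsto (fun q : ℕ × X => F q.1 q.2) (atTop ×ˢ 𝓝[D] x) (𝓝 (f x)) := by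
  have h1 : Tendsto (fun q : ℕ × X => F q.1 q.2 - f q.2) (atTop ×ˢ 𝓝[D] x) (𝓝 0) := by
    rw [Metric.tendsto_nhds]
    intro ε hε
    have h2 := Metric.tendstoUniformlyOn_iff.1 h ε hε
    filter_upwards [h2.prod_mk (eventually_mem_nhdsWithin (s := D) (a := x))] with q hq
    rw [Real.dist_eq, sub_zero, ← Real.dist_eq, dist_comm]
    exact hq.1 _ hq.2
  have h2 : Tendsto (fun q : ℕ × X => f q.2) (atTop ×ˢ 𝓝[D] x) (𝓝 (f x)) :=
    (hf x hx).tendsto.comp tendsto_snd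
  simpa using h1.add h2

lemma tendstoUniformlyOn_of_tendsto_prod (hD : IsCompact D) (hf : ContinuousOn f D)
    (h : ∀ x ∈ D, Tendsto (fun q : ℕ × X => F q.1 q.2) (atTop ×ˢ 𝓝[D] x) (𝓝 (f x))) :
    TendstoUniformlyOn F f atTop D := by
  rw [← tendstoLocallyUniformlyOn_iff_tendstoUniformlyOn_of_compact hD,
    Metric.tendstoLocallyUniformlyOn_iff]
  intro ε hε x hx
  have h2 : Tendsto (fun q : ℕ × X => f q.2) (atTop ×ˢ 𝓝[D] x) (𝓝 (f x)) :=
    (hf x hx).tendsto.comp tendsto_snd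
  have h3 := (h2.dist (h x hx)).eventually (gt_mem_nhds (by rwa [dist_self]) :
    ∀ᶠ r in 𝓝 (dist (f x) (f x)), r < ε)
  obtain ⟨pa, ha, pb, hb, hab⟩ := eventually_prod_iff.1 h3
  exact ⟨{y | pb y}, hb, ha.mono fun ℓ hℓ y hy => hab hℓ hy⟩

end UniformLimits

/-! ### The total scalar curvature of a compact set -/

section Core

variable {n : ℕ}

local notation "𝔼" => EuclideanSpace ℝ (Fin n)

lemma pderiv_pderiv_eq {S : Set 𝔼} {f : 𝔼 → ℝ} {y : 𝔼} (hS : UniqueDiffOn ℝ S)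
    (hf : ContDiffOn ℝ 2 f S) (hy : y ∈ S) (l i : Fin n) :
    pderiv S l (pderiv S i f) y = fderivWithin ℝ (fderivWithin ℝ f S) S y
      (EuclideanSpace.single l 1) (EuclideanSpace.single i 1) := by
  have hd : DifferentiableWithinAt ℝ (fderivWithin ℝ f S) S y :=
    (hf.fderivWithin hS (m := 1) (by norm_num)).differentiableOn (by norm_num) y hy
  have := (hd.hasFDerivWithinAt.clm_apply
    (hasFDerivWithinAt_const (EuclideanSpace.single i (1 : ℝ) : 𝔼) y S)).fderivWithin (hS y hy)
  unfold pderiv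
  rw [this]
  simp

/-- The density `R √g` of the metric with components `G`. -/
def scalarDensity (S : Set (EuclideanSpace ℝ (Fin n)))
    (G : EuclideanSpace ℝ (Fin n) → Matrix (Fin n) (Fin n) ℝ) (y : EuclideanSpace ℝ (Fin n)) : ℝ :=
  Real.sqrt (G y).det * scalarJet (G y)⁻¹ (metricDeriv S G y) (metricDeriv₂ S G y)

variable {S : Set (EuclideanSpace ℝ (Fin n))}
  {G : EuclideanSpace ℝ (Fin n) → Matrix (Fin n) (Fin n) ℝ}
  {Gs : ℕ → EuclideanSpace ℝ (Fin n) → Matrix (Fin n) (Fin n) ℝ}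

lemma IsC2MetricOn.continuousOn_metricDeriv (h : IsC2MetricOn S G) (hS : UniqueDiffOn ℝ S)
    (l a b : Fin n) : ContinuousOn (fun y => metricDeriv S G y l a b) S :=
  (h.contDiffOn_pderiv hS l a b).continuousOn

lemma IsC2MetricOn.continuousOn_metricDeriv₂ (h : IsC2MetricOn S G) (hS : UniqueDiffOn ℝ S)
    (l i a b : Fin n) : ContinuousOn (fun y => metricDeriv₂ S G y l i a b) S :=
  continuousOn_pderiv hS (h.contDiffOn_pderiv hS i a b) l

lemma IsC2MetricOn.continuousOn_scalarDensity (h : IsC2MetricOn S G) (hS : UniqueDiffOn ℝ S) :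
    ContinuousOn (scalarDensity S G) S := fun y hy =>
  tendsto_sqrt_det_mul_scalarJet (h.det_ne_zero hy)
    (fun i j => (h.contDiffOn i j).continuousOn y hy)
    (fun l i j => h.continuousOn_metricDeriv hS l i j y hy)
    (fun l i a b => h.continuousOn_metricDeriv₂ hS l i a b y hy)

/-- If the components of metrics converge in `C²` on a compact set, then so do the densities of the
total scalar curvature. -/
lemma tendstoUniformlyOn_scalarDensity (hS : UniqueDiffOn ℝ S) (h : IsC2MetricOn S G)
    (hs : ∀ ℓ, IsC2MetricOn S (Gs ℓ)) {D : Set 𝔼} (hD : IsCompact D) (hDS : D ⊆ S)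
    (hconv : ∀ i j : Fin n, ∀ m : ℕ, m ≤ 2 → TendstoUniformlyOn
      (fun ℓ => iteratedFDerivWithin ℝ m (fun y => Gs ℓ y i j) S)
      (iteratedFDerivWithin ℝ m (fun y => G y i j) S) atTop D) :
    TendstoUniformlyOn (fun ℓ => scalarDensity S (Gs ℓ)) (scalarDensity S G) atTop D := by
  -- Evaluating the iterated derivatives on fixed vectors turns their convergence into that of the
  -- partial derivatives.
  have happ : ∀ i j : Fin n, ∀ m : ℕ, m ≤ 2 → ∀ v : Fin m → 𝔼, TendstoUniformlyOn
      (fun ℓ y => iteratedFDerivWithin ℝ m (fun y => Gs ℓ y i j) S y v)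
      (fun y => iteratedFDerivWithin ℝ m (fun y => G y i j) S y v) atTop D :=
    fun i j m hm v => ((ContinuousMultilinearMap.apply ℝ (fun _ : Fin m => 𝔼) ℝ
      v).uniformContinuous).comp_tendstoUniformlyOn (hconv i j m hm)
  have h0 : ∀ i j, TendstoUniformlyOn (fun ℓ y => Gs ℓ y i j) (fun y => G y i j) atTop D :=
    fun i j => by simpa only [iteratedFDerivWithin_zero_apply] using happ i j 0 (by norm_num) ![]
  have h1 : ∀ l i j, TendstoUniformlyOn (fun ℓ y => metricDeriv S (Gs ℓ) y l i j)
      (fun y => metricDeriv S G y l i j) atTop D := by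
    intro l i j
    have := happ i j 1 (by norm_num) ![EuclideanSpace.single l 1]
    refine (this.congr (Eventually.of_forall fun ℓ y hy => ?_)).congr_right fun y hy => ?_
    · simp only [iteratedFDerivWithin_one_apply (hS y (hDS hy))]
      rfl
    · simp only [iteratedFDerivWithin_one_apply (hS y (hDS hy))]
      rfl
  have h2 : ∀ l k i j, TendstoUniformlyOn (fun ℓ y => metricDeriv₂ S (Gs ℓ) y l k i j)
      (fun y => metricDeriv₂ S G y l k i j) atTop D := by
    intro l k i j
    have := happ i j 2 le_rfl ![EuclideanSpace.single l 1, EuclideanSpace.single k 1]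
    refine (this.congr (Eventually.of_forall fun ℓ y hy => ?_)).congr_right fun y hy => ?_
    · simp only [iteratedFDerivWithin_two_apply _ hS (hDS hy)]
      exact (pderiv_pderiv_eq hS ((hs ℓ).contDiffOn i j) (hDS hy) l k).symm
    · simp only [iteratedFDerivWithin_two_apply _ hS (hDS hy)]
      exact (pderiv_pderiv_eq hS (h.contDiffOn i j) (hDS hy) l k).symm
  refine tendstoUniformlyOn_of_tendsto_prod hD ((h.continuousOn_scalarDensity hS).mono hDS)
    fun x hx => tendsto_sqrt_det_mul_scalarJet (h.det_ne_zero (hDS hx)) (fun i j => ?_)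
    (fun l i j => ?_) (fun l k i j => ?_)
  · exact tendsto_prod_of_tendstoUniformlyOn (h0 i j)
      ((h.contDiffOn i j).continuousOn.mono hDS) hx
  · exact tendsto_prod_of_tendstoUniformlyOn (h1 l i j)
      ((h.continuousOn_metricDeriv hS l i j).mono hDS) hx
  · exact tendsto_prod_of_tendstoUniformlyOn (h2 l k i j)
      ((h.continuousOn_metricDeriv₂ hS l k i j).mono hDS) hx

/-- The limit is bounded on the compact set `D` by some `C`, so the sequence is eventually bounded
by `C + 1`, which is integrable over the finite-measure set `A`. -/
lemma tendsto_setIntegral_of_tendstoUniformlyOn {F : ℕ → 𝔼 → ℝ} {f : 𝔼 → ℝ} {A D : Set 𝔼}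
    (hD : IsCompact D) (hA : MeasurableSet A) (hAD : A ⊆ D) (hf : ContinuousOn f D)
    (hF : ∀ ℓ, ContinuousOn (F ℓ) D) (h : TendstoUniformlyOn F f atTop D) :
    Tendsto (fun ℓ => ∫ y in A, F ℓ y) atTop (𝓝 (∫ y in A, f y)) := by
  obtain ⟨C, hC⟩ := hD.exists_bound_of_continuousOn hf
  have hfin : volume A < ⊤ := (measure_mono hAD).trans_lt hD.measure_lt_top
  have : IsFiniteMeasure (volume.restrict A) := ⟨by rwa [Measure.restrict_apply_univ]⟩
  refine tendsto_integral_filter_of_dominated_convergence (fun _ => C + 1) ?_ ?_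
    (integrable_const _) ?_
  · exact Eventually.of_forall fun ℓ => ((hF ℓ).mono hAD).aestronglyMeasurable hA
  · filter_upwards [Metric.tendstoUniformlyOn_iff.1 h 1 one_pos] with ℓ hℓ
    filter_upwards [ae_restrict_mem hA] with y hy
    have h1 := hC y (hAD hy)
    have h2 := hℓ y (hAD hy)
    rw [dist_comm, dist_eq_norm] at h2
    calc ‖F ℓ y‖ = ‖f y + (F ℓ y - f y)‖ := by congr 1; ring
      _ ≤ ‖f y‖ + ‖F ℓ y - f y‖ := norm_add_le _ _
      _ ≤ C + 1 := by linarith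
  · filter_upwards [ae_restrict_mem hA] with y hy
    exact h.tendsto_at (hAD hy)

variable {H : Type*} [TopologicalSpace H]
  {I : ModelWithCorners ℝ (EuclideanSpace ℝ (Fin n)) H}
  {M : Type*} [TopologicalSpace M] [ChartedSpace H M] [IsManifold I ∞ M]

lemma IsParam.sqrt_det_mul_scalarCurvature {ψ : 𝔼 → M} {χ : M → 𝔼} {S : Set 𝔼} {y : 𝔼}
    (P : IsParam I ψ χ S) (g : C2Metric I M) (hy : y ∈ S) :
    Real.sqrt (coordMetric g ψ S y).det * scalarCurvature g (ψ y) =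
      scalarDensity S (coordMetric g ψ S) y := by
  rw [P.scalarCurvature_eq g hy,
    (P.isC2MetricOn g).coordScalarCurvature_eq P.uniqueDiffOn hy, scalarDensity]

variable [MeasurableSpace M] [BorelSpace M] [SecondCountableTopology M]

/-- The total scalar curvature of a subset of the image of a parametrization. -/
lemma IsParam.setIntegral_scalarCurvature {ψ : 𝔼 → M} {χ : M → 𝔼} {S : Set 𝔼}
    (P : IsParam I ψ χ S) (g : C2Metric I M) {B : Set M} (hB : MeasurableSet B) (h : B ⊆ ψ '' S)
    (hg : Integrable (scalarCurvature g) (volumeMeasure g)) :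
    ∫ x in B, scalarCurvature g x ∂(volumeMeasure g) =
      ∫ y in S ∩ ψ ⁻¹' B, scalarDensity S (coordMetric g ψ S) y := by
  rw [P.setIntegral_eq g hB h hg.aestronglyMeasurable]
  exact setIntegral_congr_fun (P.measurableSet_inter_preimage hB) fun y hy =>
    P.sqrt_det_mul_scalarCurvature g hy.1

variable [T2Space M]

/-- The total scalar curvature of a compact set is continuous under `C²` convergence. -/
theorem tendsto_setIntegral_scalarCurvature {K : Set M} (hK : IsCompact K)
    {gs : ℕ → C2Metric I M} {g : C2Metric I M} (hconv : C2ConvergesOn K gs g)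
    (hgs : ∀ ℓ, Integrable (scalarCurvature (gs ℓ)) (volumeMeasure (gs ℓ)))
    (hg : Integrable (scalarCurvature g) (volumeMeasure g)) :
    Tendsto (fun ℓ => ∫ x in K, scalarCurvature (gs ℓ) x ∂(volumeMeasure (gs ℓ))) atTop
      (𝓝 (∫ x in K, scalarCurvature g x ∂(volumeMeasure g))) := by
  have : LocallyCompactSpace M := Manifold.locallyCompact_of_finiteDimensional I
  -- Convergence for one set does not pass to subsets or unions, so the property used for compact
  -- induction asks for it on all measurable subsets of a measurable hull. Unions are then split
  -- into `B' ∩ B₁` and `B' \ B₁`.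
  let p : Set M → Prop := fun B => ∃ B₁, MeasurableSet B₁ ∧ B ⊆ B₁ ∧ ∀ B' ⊆ B₁, MeasurableSet B' →
    Tendsto (fun ℓ => ∫ x in B', scalarCurvature (gs ℓ) x ∂(volumeMeasure (gs ℓ))) atTop
      (𝓝 (∫ x in B', scalarCurvature g x ∂(volumeMeasure g)))
  have hp : p K := by
    refine hK.induction_on (p := p) ?_ ?_ ?_ ?_
    · refine ⟨∅, MeasurableSet.empty, Subset.rfl, fun B' hB' _ => ?_⟩
      rw [subset_empty_iff.1 hB']
      simp
    · rintro s t hst ⟨B₁, h1, h2, h3⟩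
      exact ⟨B₁, h1, hst.trans h2, h3⟩
    · rintro s t ⟨B₁, h1, h2, h3⟩ ⟨C₁, k1, k2, k3⟩
      refine ⟨B₁ ∪ C₁, h1.union k1, union_subset_union h2 k2, fun B' hB' hm => ?_⟩
      have hd : Disjoint (B' ∩ B₁) (B' \ B₁) := disjoint_inf_sdiff
      have e : ∀ g : C2Metric I M, Integrable (scalarCurvature g) (volumeMeasure g) →
          ∫ x in B', scalarCurvature g x ∂(volumeMeasure g) =
          ∫ x in B' ∩ B₁, scalarCurvature g x ∂(volumeMeasure g) +
          ∫ x in B' \ B₁, scalarCurvature g x ∂(volumeMeasure g) := fun g hg => by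
        rw [← setIntegral_union hd (hm.diff h1) hg.integrableOn hg.integrableOn,
          inter_union_sdiff]
      simp only [e _ (hgs _), e _ hg]
      refine (h3 _ inter_subset_right (hm.inter h1)).add (k3 _ ?_ (hm.diff h1))
      rintro x ⟨hx, hxB⟩
      exact (hB' hx).resolve_left hxB
    · intro x _
      obtain ⟨C, hC, hxC, hCs⟩ := exists_compact_subset (chartAt H x).open_source
        (mem_chart_source H x)
      refine ⟨K ∩ C, inter_mem_nhdsWithin K (mem_interior_iff_mem_nhds.1 hxC), K ∩ C,
        (hK.inter hC).measurableSet, Subset.rfl, fun B' hB' hm => ?_⟩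
      have hKC : IsCompact (K ∩ C) := hK.inter hC
      have hsub : K ∩ C ⊆ K ∩ (chartAt H x).source := inter_subset_inter_right K hCs
      set P := isParam_extChartAt (I := I) x
      have hsrc : K ∩ C ⊆ (extChartAt I x).source := by
        rw [extChartAt_source]
        exact inter_subset_right.trans hCs
      have hB'S : B' ⊆ (extChartAt I x).symm '' (extChartAt I x).target := by
        rw [(extChartAt I x).symm_image_target_eq_source]
        exact hB'.trans hsrc
      have hD : IsCompact (extChartAt I x '' (K ∩ C)) :=
        hKC.image_of_continuousOn ((continuousOn_extChartAt x).mono hsrc)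
      have hDS : extChartAt I x '' (K ∩ C) ⊆ (extChartAt I x).target := by
        rintro _ ⟨y, hy, rfl⟩
        exact (extChartAt I x).map_source (hsrc hy)
      have hA : (extChartAt I x).target ∩ (extChartAt I x).symm ⁻¹' B' ⊆
          extChartAt I x '' (K ∩ C) := fun y hy =>
        ⟨(extChartAt I x).symm y, hB' hy.2, (extChartAt I x).right_inv hy.1⟩
      rw [P.setIntegral_scalarCurvature g hm hB'S hg]
      simp only [fun ℓ => P.setIntegral_scalarCurvature (gs ℓ) hm hB'S (hgs ℓ)]
      refine tendsto_setIntegral_of_tendstoUniformlyOn hD (P.measurableSet_inter_preimage hm) hA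
        (((P.isC2MetricOn g).continuousOn_scalarDensity P.uniqueDiffOn).mono hDS)
        (fun ℓ => ((P.isC2MetricOn (gs ℓ)).continuousOn_scalarDensity P.uniqueDiffOn).mono hDS) ?_
      exact tendstoUniformlyOn_scalarDensity P.uniqueDiffOn (P.isC2MetricOn g)
        (fun ℓ => P.isC2MetricOn (gs ℓ)) hD hDS (hconv x _ hKC hsub)
  obtain ⟨B₁, _, h2, h3⟩ := hp
  exact h3 K h2 hK.measurableSet

end Core

/-! ### Asymptotics of determinants and inverses of matrices -/

section Asymptotics

open Asymptotics

variable {α ι : Type*} {l : Filter α} {a : α → ℝ} {n : ℕ}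

lemma isBigO_one_prod (s : Finset ι) {f : ι → α → ℝ} (hf : ∀ i, f i =O[l] fun _ => (1 : ℝ)) :
    (fun x => ∏ i ∈ s, f i x) =O[l] fun _ => (1 : ℝ) := by
  classical
  induction s using Finset.induction_on with
  | empty => simpa using isBigO_refl (fun _ => (1 : ℝ)) l
  | insert i s hi ih =>
    simp only [Finset.prod_insert hi]
    simpa using (hf i).mul ih

/-- Telescoping changes one factor at a time: `f p - g q = (f - g) p + g (p - q)`. -/
lemma isBigO_prod_sub_prod (s : Finset ι) {f g : ι → α → ℝ}
    (hf : ∀ i, f i =O[l] fun _ => (1 : ℝ)) (hg : ∀ i, g i =O[l] fun _ => (1 : ℝ))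
    (h : ∀ i, (fun x => f i x - g i x) =O[l] a) :
    (fun x => ∏ i ∈ s, f i x - ∏ i ∈ s, g i x) =O[l] a := by
  classical
  induction s using Finset.induction_on with
  | empty => simpa using isBigO_zero a l
  | insert i s hi ih =>
    simp only [Finset.prod_insert hi]
    have h1 := (h i).mul (isBigO_one_prod s hf)
    have h2 := (hg i).mul ih
    simp only [mul_one, one_mul] at h1 h2
    refine (h1.add h2).congr_left fun x => ?_
    ring

variable {A B : α → Matrix (Fin n) (Fin n) ℝ}

lemma isBigO_one_det (hA : ∀ i j, (fun x => A x i j) =O[l] fun _ => (1 : ℝ)) :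
    (fun x => (A x).det) =O[l] fun _ => (1 : ℝ) := by
  simp only [Matrix.det_apply']
  exact IsBigO.fun_sum fun σ _ => (isBigO_one_prod _ fun i => hA (σ i) i).const_mul_left _

lemma isBigO_det_sub_det (hA : ∀ i j, (fun x => A x i j) =O[l] fun _ => (1 : ℝ))
    (hB : ∀ i j, (fun x => B x i j) =O[l] fun _ => (1 : ℝ))
    (h : ∀ i j, (fun x => A x i j - B x i j) =O[l] a) :
    (fun x => (A x).det - (B x).det) =O[l] a := by
  simp only [Matrix.det_apply', ← Finset.sum_sub_distrib, ← mul_sub]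
  exact IsBigO.fun_sum fun σ _ => (isBigO_prod_sub_prod _ (fun i => hA (σ i) i)
    (fun i => hB (σ i) i) fun i => h (σ i) i).const_mul_left _

lemma isBigO_one_matrix_inv (hA : ∀ i j, (fun x => A x i j) =O[l] fun _ => (1 : ℝ)) {δ : ℝ}
    (hδ : 0 < δ) (hdet : ∀ᶠ x in l, δ ≤ (A x).det) (i j : Fin n) :
    (fun x => (A x)⁻¹ i j) =O[l] fun _ => (1 : ℝ) := by
  have h1 : (fun x => ((A x).det)⁻¹) =O[l] fun _ => (1 : ℝ) := by
    refine IsBigO.of_bound δ⁻¹ ?_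
    filter_upwards [hdet] with x hx
    rw [norm_inv, Real.norm_of_nonneg (hδ.le.trans hx), norm_one, mul_one]
    exact inv_anti₀ hδ hx
  have h2 : (fun x => (A x).adjugate i j) =O[l] fun _ => (1 : ℝ) := by
    simp only [Matrix.adjugate_apply]
    refine isBigO_one_det fun k m => ?_
    simp only [Matrix.updateRow_apply]
    split_ifs
    · exact isBigO_const_const _ one_ne_zero l
    · exact hA k m
  have := h1.mul h2
  simp only [mul_one] at this
  refine this.congr_left fun x => ?_
  simp [Matrix.inv_def, Ring.inverse_eq_inv']

lemma isBigO_one_of_sub_one (h : ∀ i j, (fun x => A x i j - (1 : Matrix (Fin n) (Fin n) ℝ) i j) =O[l] a)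
    (ha : a =O[l] fun _ => (1 : ℝ)) (i j : Fin n) : (fun x => A x i j) =O[l] fun _ => (1 : ℝ) := by
  simpa using ((h i j).trans ha).add
    (isBigO_const_const ((1 : Matrix (Fin n) (Fin n) ℝ) i j) one_ne_zero l)

lemma isBigO_det_sub_one
    (h : ∀ i j, (fun x => A x i j - (1 : Matrix (Fin n) (Fin n) ℝ) i j) =O[l] a)
    (ha : a =O[l] fun _ => (1 : ℝ)) : (fun x => (A x).det - 1) =O[l] a := by
  simpa using isBigO_det_sub_det (B := fun _ => 1) (isBigO_one_of_sub_one h ha)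
    (fun i j => isBigO_const_const _ one_ne_zero l) h

/-- For `t ≥ 0`, `|√t - 1| ≤ |√t - 1| (√t + 1) = |t - 1|`. -/
lemma isBigO_sqrt_det_sub_one
    (h : ∀ i j, (fun x => A x i j - (1 : Matrix (Fin n) (Fin n) ℝ) i j) =O[l] a)
    (ha : a =O[l] fun _ => (1 : ℝ)) (hdet : ∀ᶠ x in l, 0 ≤ (A x).det) :
    (fun x => √(A x).det - 1) =O[l] a := by
  refine IsBigO.trans (IsBigO.of_bound 1 ?_) (isBigO_det_sub_one h ha)
  filter_upwards [hdet] with x hx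
  have h1 := Real.sq_sqrt hx
  have h2 := Real.sqrt_nonneg (A x).det
  have h3 : (A x).det - 1 = (√(A x).det - 1) * (√(A x).det + 1) := by nlinarith
  rw [h3, norm_mul, one_mul]
  refine le_mul_of_one_le_right (norm_nonneg _) ?_
  rw [Real.norm_of_nonneg (by positivity)]
  linarith

/-- This rests on `A⁻¹ - 1 = -A⁻¹ (A - 1)`, where `A⁻¹` is bounded because its determinant stays
away from zero. -/
lemma isBigO_matrix_inv_sub_one
    (h : ∀ i j, (fun x => A x i j - (1 : Matrix (Fin n) (Fin n) ℝ) i j) =O[l] a)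
    (ha : a =O[l] fun _ => (1 : ℝ)) {δ : ℝ} (hδ : 0 < δ) (hdet : ∀ᶠ x in l, δ ≤ (A x).det)
    (i j : Fin n) : (fun x => (A x)⁻¹ i j - (1 : Matrix (Fin n) (Fin n) ℝ) i j) =O[l] a := by
  have h1 := isBigO_one_matrix_inv (isBigO_one_of_sub_one h ha) hδ hdet
  have h2 : (fun x => -∑ k, (A x)⁻¹ i k * (A x k j - (1 : Matrix (Fin n) (Fin n) ℝ) k j)) =O[l] a :=
    (IsBigO.fun_sum fun k _ => by simpa using (h1 i k).mul (h k j)).neg_left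
  refine h2.congr' ?_ EventuallyEq.rfl
  filter_upwards [hdet] with x hx
  have h3 : (A x)⁻¹ * (A x - 1) = 1 - (A x)⁻¹ := by
    rw [Matrix.mul_sub, Matrix.nonsing_inv_mul _ (hδ.trans_le hx).ne'.isUnit, mul_one]
  have h4 := congrFun (congrFun h3 i) j
  simp only [Matrix.mul_apply, Matrix.sub_apply] at h4
  rw [h4, neg_sub]

end Asymptotics

/-! ### Pointwise bounds from the weighted norm -/

section Weighted

variable {n : ℕ} {r₀ τ : ℝ} {f : EuclideanSpace ℝ (Fin n) → ℝ} {x : EuclideanSpace ℝ (Fin n)}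

local notation "𝔼" => EuclideanSpace ℝ (Fin n)

lemma abs_le_of_weight_mul_le {ρ s t C : ℝ} (hρ : 0 < ρ)
    (h : ENNReal.ofReal (ρ ^ s * |t|) ≤ ENNReal.ofReal C) (hC : 0 ≤ C) : |t| ≤ C * ρ ^ (-s) := by
  have h1 := (ENNReal.ofReal_le_ofReal_iff hC).1 h
  rw [Real.rpow_neg hρ.le, ← div_eq_mul_inv, le_div_iff₀ (Real.rpow_pos_of_pos hρ s)]
  linarith

lemma abs_le_of_weightedC2Norm_le (h₀ : 0 ≤ r₀) {C : ℝ} (hC : 0 ≤ C)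
    (h : weightedC2Norm r₀ τ f ≤ ENNReal.ofReal C) (hx : x ∈ exterior n r₀) :
    |f x| ≤ C * ‖x‖ ^ (-τ) := by
  refine abs_le_of_weight_mul_le (lt_of_le_of_lt h₀ hx) (le_trans ?_ h) hC
  refine le_trans ?_ (le_self_add.trans le_self_add)
  exact le_iSup₂ (f := fun x (_ : x ∈ exterior n r₀) => ENNReal.ofReal (‖x‖ ^ τ * |f x|)) x hx

lemma abs_pderiv_le_of_weightedC2Norm_le (h₀ : 0 ≤ r₀) {C : ℝ} (hC : 0 ≤ C)
    (h : weightedC2Norm r₀ τ f ≤ ENNReal.ofReal C) (hx : x ∈ exterior n r₀) (i : Fin n) :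
    |pderiv (exterior n r₀) i f x| ≤ C * ‖x‖ ^ (-(1 + τ)) := by
  refine abs_le_of_weight_mul_le (lt_of_le_of_lt h₀ hx) (le_trans ?_ h) hC
  refine le_trans ?_ (le_add_self.trans le_self_add)
  refine le_trans ?_ (Finset.single_le_sum (fun _ _ => zero_le) (Finset.mem_univ i))
  exact le_iSup₂ (f := fun x (_ : x ∈ exterior n r₀) =>
    ENNReal.ofReal (‖x‖ ^ (1 + τ) * |pderiv (exterior n r₀) i f x|)) x hx

lemma abs_pderiv_pderiv_le_of_weightedC2Norm_le (h₀ : 0 ≤ r₀) {C : ℝ} (hC : 0 ≤ C)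
    (hf : ContDiffOn ℝ 2 f (exterior n r₀))
    (h : weightedC2Norm r₀ τ f ≤ ENNReal.ofReal C) (hx : x ∈ exterior n r₀) (i j : Fin n) :
    |pderiv (exterior n r₀) i (pderiv (exterior n r₀) j f) x| ≤ C * ‖x‖ ^ (-(2 + τ)) := by
  -- The norm lists each multi-index of order two once, as a pair `i ≤ j`; symmetry of second
  -- derivatives covers the other order.
  wlog hij : i ≤ j generalizing i j
  · have hS : UniqueDiffOn ℝ (exterior n r₀) := (isOpen_exterior r₀).uniqueDiffOn
    rw [pderiv_pderiv_eq hS hf hx, symm_sndFDerivWithin hS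
      (by rw [(isOpen_exterior r₀).interior_eq]; exact subset_closure) hf hx,
      ← pderiv_pderiv_eq hS hf hx]
    exact this j i (le_of_not_ge hij)
  refine abs_le_of_weight_mul_le (lt_of_le_of_lt h₀ hx) (le_trans ?_ h) hC
  refine le_trans ?_ le_add_self
  refine le_trans ?_ (Finset.single_le_sum (fun _ _ => zero_le) (Finset.mem_univ i))
  refine le_trans ?_ (Finset.single_le_sum (fun _ _ => zero_le) (Finset.mem_Ici.2 hij))
  exact le_iSup₂ (f := fun x (_ : x ∈ exterior n r₀) => ENNReal.ofReal
    (‖x‖ ^ (2 + τ) * |pderiv (exterior n r₀) i (pderiv (exterior n r₀) j f) x|)) x hx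

lemma pderiv_pderiv_sub {S : Set 𝔼} {f f' : 𝔼 → ℝ} {y : 𝔼} (hS : UniqueDiffOn ℝ S)
    (hf : ContDiffOn ℝ 2 f S) (hf' : ContDiffOn ℝ 2 f' S) (hy : y ∈ S) (l i : Fin n) :
    pderiv S l (pderiv S i fun z => f z - f' z) y =
      pderiv S l (pderiv S i f) y - pderiv S l (pderiv S i f') y := by
  have hd : ∀ {f : 𝔼 → ℝ}, ContDiffOn ℝ 2 f S → DifferentiableOn ℝ f S := fun hf =>
    hf.differentiableOn (by norm_num)
  have hdd : ∀ {f : 𝔼 → ℝ}, ContDiffOn ℝ 2 f S → DifferentiableOn ℝ (pderiv S i f) S := fun hf =>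
    ((hf.fderivWithin hS (m := 1) (by norm_num)).clm_apply contDiffOn_const).differentiableOn
      (by norm_num)
  rw [pderiv_congr (f' := fun z => pderiv S i f z - pderiv S i f' z)
    (fun z hz => pderiv_sub (hS z hz) (hd hf z hz) (hd hf' z hz) i) hy,
    pderiv_sub (hS y hy) (hdd hf y hy) (hdd hf' y hy)]

end Weighted

/-! ### Uniform decay along a convergent sequence of metrics -/

section Remainder

open Asymptotics

variable {n : ℕ} {r₀ τ : ℝ} {G : EuclideanSpace ℝ (Fin n) → Matrix (Fin n) (Fin n) ℝ}
  {Gs : ℕ → EuclideanSpace ℝ (Fin n) → Matrix (Fin n) (Fin n) ℝ}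

local notation "𝔼" => EuclideanSpace ℝ (Fin n)

/-- The norms of a sequence of `C²` functions control its jets. -/
lemma jet_le_of_tendsto_weightedC2Norm (h₀ : 0 ≤ r₀) {f : 𝔼 → ℝ} {F : ℕ → 𝔼 → ℝ}
    (hf : ContDiffOn ℝ 2 f (exterior n r₀)) (hF : ∀ ℓ, ContDiffOn ℝ 2 (F ℓ) (exterior n r₀))
    (h : Tendsto (fun ℓ => weightedC2Norm r₀ τ fun x => F ℓ x - f x) atTop (𝓝 0)) :
    ∃ e : ℕ → ℝ, Tendsto e atTop (𝓝 0) ∧ ∀ᶠ ℓ in atTop, ∀ x ∈ exterior n r₀,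
      |F ℓ x - f x| ≤ e ℓ * ‖x‖ ^ (-τ) ∧
      (∀ i, |pderiv (exterior n r₀) i (F ℓ) x - pderiv (exterior n r₀) i f x| ≤
        e ℓ * ‖x‖ ^ (-(1 + τ))) ∧
      ∀ i j, |pderiv (exterior n r₀) i (pderiv (exterior n r₀) j (F ℓ)) x -
        pderiv (exterior n r₀) i (pderiv (exterior n r₀) j f) x| ≤ e ℓ * ‖x‖ ^ (-(2 + τ)) := by
  have hS : UniqueDiffOn ℝ (exterior n r₀) := (isOpen_exterior r₀).uniqueDiffOn
  refine ⟨fun ℓ => (weightedC2Norm r₀ τ fun x => F ℓ x - f x).toReal,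
    (ENNReal.tendsto_toReal ENNReal.zero_ne_top).comp h, ?_⟩
  filter_upwards [h.eventually_lt_const ENNReal.zero_lt_top] with ℓ hℓ x hx
  have h1 := (ENNReal.ofReal_toReal hℓ.ne).ge
  refine ⟨abs_le_of_weightedC2Norm_le h₀ ENNReal.toReal_nonneg h1 hx, fun i => ?_, fun i j => ?_⟩
  · rw [← pderiv_sub (hS x hx) ((hF ℓ).differentiableOn (by norm_num) x hx)
      (hf.differentiableOn (by norm_num) x hx)]
    exact abs_pderiv_le_of_weightedC2Norm_le h₀ ENNReal.toReal_nonneg h1 hx i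
  · rw [← pderiv_pderiv_sub hS (hF ℓ) hf hx]
    exact abs_pderiv_pderiv_le_of_weightedC2Norm_le h₀ ENNReal.toReal_nonneg ((hF ℓ).sub hf) h1 hx
      i j

lemma jet_le_of_weightedC2Norm_lt_top (h₀ : 0 ≤ r₀) {f : 𝔼 → ℝ} {k : ℝ}
    (hf : ContDiffOn ℝ 2 f (exterior n r₀))
    (h : weightedC2Norm r₀ τ (fun x => f x - k) < ⊤) :
    ∃ C : ℝ, ∀ x ∈ exterior n r₀, |f x - k| ≤ C * ‖x‖ ^ (-τ) ∧
      (∀ i, |pderiv (exterior n r₀) i f x| ≤ C * ‖x‖ ^ (-(1 + τ))) ∧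
      ∀ i j, |pderiv (exterior n r₀) i (pderiv (exterior n r₀) j f) x| ≤
        C * ‖x‖ ^ (-(2 + τ)) := by
  have hS : UniqueDiffOn ℝ (exterior n r₀) := (isOpen_exterior r₀).uniqueDiffOn
  refine ⟨(weightedC2Norm r₀ τ fun x => f x - k).toReal, fun x hx => ?_⟩
  have h1 := (ENNReal.ofReal_toReal h.ne).ge
  have e1 : ∀ z ∈ exterior n r₀, ∀ i, pderiv (exterior n r₀) i f z =
      pderiv (exterior n r₀) i (fun x => f x - k) z := fun z hz i => by
    rw [pderiv_sub (hS z hz) (hf.differentiableOn (by norm_num) z hz)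
      (differentiableWithinAt_const k), pderiv_const, sub_zero]
  refine ⟨abs_le_of_weightedC2Norm_le h₀ ENNReal.toReal_nonneg h1 hx, fun i => ?_, fun i j => ?_⟩
  · rw [e1 x hx]
    exact abs_pderiv_le_of_weightedC2Norm_le h₀ ENNReal.toReal_nonneg h1 hx i
  · rw [pderiv_congr (fun z hz => e1 z hz j) hx]
    exact abs_pderiv_pderiv_le_of_weightedC2Norm_le h₀ ENNReal.toReal_nonneg
      (hf.sub contDiffOn_const) h1 hx i j

/-- A bound along `atTop ×ˢ ⊤` on `ℕ × S` means one constant for all large `ℓ` and all points of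
`S`. This filter lets the algebra of `=O` produce dominating functions for a whole sequence. -/
lemma isBigO_of_eventually_forall {X : Type*} {S : Set X} {F : ℕ → X → ℝ} {f : X → ℝ} {w : X → ℝ}
    {e : ℕ → ℝ} (he : Tendsto e atTop (𝓝 0)) {C : ℝ} (hw : ∀ x ∈ S, 0 ≤ w x)
    (h : ∀ᶠ ℓ in atTop, ∀ x ∈ S, |F ℓ x - f x| ≤ e ℓ * w x) (hf : ∀ x ∈ S, |f x| ≤ C * w x) :
    (fun q : ℕ × S => F q.1 q.2) =O[atTop ×ˢ ⊤] fun q => w q.2 := by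
  refine IsBigO.of_bound (1 + C) ?_
  have h1 := (he.eventually_le_const one_pos).and h
  filter_upwards [h1.prod_inl ⊤] with q ⟨hq1, hq2⟩
  have h2 := hq2 q.2 q.2.2
  have h3 := hf q.2 q.2.2
  have h4 := hw q.2 q.2.2
  rw [Real.norm_eq_abs, Real.norm_of_nonneg h4]
  calc |F q.1 q.2| = |(F q.1 q.2 - f q.2) + f q.2| := by congr 1; ring
    _ ≤ |F q.1 q.2 - f q.2| + |f q.2| := abs_add_le _ _
    _ ≤ e q.1 * w q.2 + C * w q.2 := add_le_add h2 h3
    _ ≤ (1 + C) * w q.2 := by nlinarith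

/-- The vector field `∑ᵢ (∂ᵢ gᵢⱼ - ∂ⱼ gᵢᵢ)` whose flux at infinity is the mass. -/
def massField (r₀ : ℝ) (G : EuclideanSpace ℝ (Fin n) → Matrix (Fin n) (Fin n) ℝ) (j : Fin n)
    (x : EuclideanSpace ℝ (Fin n)) : ℝ :=
  ∑ i, (metricDeriv (exterior n r₀) G x i i j - metricDeriv (exterior n r₀) G x j i i)

lemma contDiffOn_massField (h : IsC2MetricOn (exterior n r₀) G) (j : Fin n) :
    ContDiffOn ℝ 1 (massField r₀ G j) (exterior n r₀) := by
  have hS : UniqueDiffOn ℝ (exterior n r₀) := (isOpen_exterior r₀).uniqueDiffOn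
  exact ContDiffOn.sum fun i _ => (h.contDiffOn_pderiv hS i i j).sub (h.contDiffOn_pderiv hS j i i)

lemma divergence_massField (h : IsC2MetricOn (exterior n r₀) G) {x : 𝔼} (hx : x ∈ exterior n r₀) :
    divergence r₀ (massField r₀ G) x = linearJet (metricDeriv₂ (exterior n r₀) G x) := by
  have hS : UniqueDiffOn ℝ (exterior n r₀) := (isOpen_exterior r₀).uniqueDiffOn
  have hd : ∀ l i j, DifferentiableWithinAt ℝ (pderiv (exterior n r₀) l (fun z => G z i j))
      (exterior n r₀) x := fun l i j => h.differentiableOn_pderiv hS l i j x hx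
  refine Finset.sum_congr rfl fun j _ => ?_
  unfold massField metricDeriv
  rw [pderiv_sum (hS x hx) fun i _ => (hd i i j).fun_sub (hd j i i)]
  exact Finset.sum_congr rfl fun i _ => pderiv_sub (hS x hx) (hd i i j) (hd j i i) j

/-- The components `Gs ℓ` of a sequence of metrics converge to `G` in the weighted norm on
`{x : |x| > r₀}`, where `G` is asymptotic to the flat metric and uniformly nondegenerate. -/
structure JetConvergence (r₀ τ : ℝ) (G : EuclideanSpace ℝ (Fin n) → Matrix (Fin n) (Fin n) ℝ)
    (Gs : ℕ → EuclideanSpace ℝ (Fin n) → Matrix (Fin n) (Fin n) ℝ) : Prop where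
  pos : 0 < r₀
  decay_pos : 0 < τ
  limit : IsC2MetricOn (exterior n r₀) G
  seq : ∀ ℓ, IsC2MetricOn (exterior n r₀) (Gs ℓ)
  norm_lt_top : ∀ i j, weightedC2Norm r₀ τ
    (fun x => G x i j - (1 : Matrix (Fin n) (Fin n) ℝ) i j) < ⊤
  tendsto_norm : ∀ i j, Tendsto (fun ℓ => weightedC2Norm r₀ τ fun x => Gs ℓ x i j - G x i j)
    atTop (𝓝 0)
  det_bound : ∃ δ > 0, ∀ x ∈ exterior n r₀, δ ≤ (G x).det

namespace JetConvergence

variable (h : JetConvergence r₀ τ G Gs)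

include h

lemma isBigO_weight_one : (fun q : ℕ × exterior n r₀ => ‖(q.2 : 𝔼)‖ ^ (-τ)) =O[atTop ×ˢ ⊤]
    fun _ => (1 : ℝ) := by
  refine IsBigO.of_bound (r₀ ^ (-τ)) (Eventually.of_forall fun q => ?_)
  rw [Real.norm_of_nonneg (by positivity), norm_one, mul_one]
  exact Real.rpow_le_rpow_of_nonpos h.pos q.2.2.le (neg_nonpos.2 h.decay_pos.le)

lemma isBigO_sub_one (i j : Fin n) : (fun q : ℕ × exterior n r₀ =>
    Gs q.1 q.2 i j - (1 : Matrix (Fin n) (Fin n) ℝ) i j) =O[atTop ×ˢ ⊤]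
      fun q => ‖(q.2 : 𝔼)‖ ^ (-τ) := by
  obtain ⟨e, he, h1⟩ := jet_le_of_tendsto_weightedC2Norm h.pos.le (h.limit.contDiffOn i j)
    (fun ℓ => (h.seq ℓ).contDiffOn i j) (h.tendsto_norm i j)
  obtain ⟨C, h2⟩ := jet_le_of_weightedC2Norm_lt_top h.pos.le (h.limit.contDiffOn i j)
    (h.norm_lt_top i j)
  refine isBigO_of_eventually_forall (F := fun ℓ x => Gs ℓ x i j - (1 : Matrix (Fin n) (Fin n) ℝ) i j)
    (f := fun x => G x i j - (1 : Matrix (Fin n) (Fin n) ℝ) i j) (w := fun x => ‖x‖ ^ (-τ)) he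
    (fun x _ => by positivity)
    (h1.mono fun ℓ hℓ x hx => ?_) fun x hx => (h2 x hx).1
  simpa using (hℓ x hx).1

lemma isBigO_metricDeriv (k i j : Fin n) : (fun q : ℕ × exterior n r₀ =>
    metricDeriv (exterior n r₀) (Gs q.1) q.2 k i j) =O[atTop ×ˢ ⊤]
      fun q => ‖(q.2 : 𝔼)‖ ^ (-(1 + τ)) := by
  obtain ⟨e, he, h1⟩ := jet_le_of_tendsto_weightedC2Norm h.pos.le (h.limit.contDiffOn i j)
    (fun ℓ => (h.seq ℓ).contDiffOn i j) (h.tendsto_norm i j)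
  obtain ⟨C, h2⟩ := jet_le_of_weightedC2Norm_lt_top h.pos.le (h.limit.contDiffOn i j)
    (h.norm_lt_top i j)
  exact isBigO_of_eventually_forall (F := fun ℓ x => metricDeriv (exterior n r₀) (Gs ℓ) x k i j)
    (f := fun x => metricDeriv (exterior n r₀) G x k i j) (w := fun x => ‖x‖ ^ (-(1 + τ))) he
    (fun x _ => by positivity)
    (h1.mono fun ℓ hℓ x hx => (hℓ x hx).2.1 k) fun x hx => (h2 x hx).2.1 k

lemma isBigO_metricDeriv₂ (k m i j : Fin n) : (fun q : ℕ × exterior n r₀ =>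
    metricDeriv₂ (exterior n r₀) (Gs q.1) q.2 k m i j) =O[atTop ×ˢ ⊤]
      fun q => ‖(q.2 : 𝔼)‖ ^ (-(2 + τ)) := by
  obtain ⟨e, he, h1⟩ := jet_le_of_tendsto_weightedC2Norm h.pos.le (h.limit.contDiffOn i j)
    (fun ℓ => (h.seq ℓ).contDiffOn i j) (h.tendsto_norm i j)
  obtain ⟨C, h2⟩ := jet_le_of_weightedC2Norm_lt_top h.pos.le (h.limit.contDiffOn i j)
    (h.norm_lt_top i j)
  exact isBigO_of_eventually_forall (F := fun ℓ x => metricDeriv₂ (exterior n r₀) (Gs ℓ) x k m i j)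
    (f := fun x => metricDeriv₂ (exterior n r₀) G x k m i j) (w := fun x => ‖x‖ ^ (-(2 + τ))) he
    (fun x _ => by positivity)
    (h1.mono fun ℓ hℓ x hx => (hℓ x hx).2.2 k m) fun x hx => (h2 x hx).2.2 k m

lemma tendsto_sub (i j : Fin n) : Tendsto (fun q : ℕ × exterior n r₀ =>
    Gs q.1 q.2 i j - G q.2 i j) (atTop ×ˢ ⊤) (𝓝 0) := by
  obtain ⟨e, he, h1⟩ := jet_le_of_tendsto_weightedC2Norm h.pos.le (h.limit.contDiffOn i j)
    (fun ℓ => (h.seq ℓ).contDiffOn i j) (h.tendsto_norm i j)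
  have h2 : (fun q : ℕ × exterior n r₀ => Gs q.1 q.2 i j - G q.2 i j) =O[atTop ×ˢ ⊤]
      fun q => e q.1 * ‖(q.2 : 𝔼)‖ ^ (-τ) := by
    refine IsBigO.of_bound 1 ?_
    filter_upwards [h1.prod_inl ⊤] with q hq
    rw [one_mul]
    exact ((hq q.2 q.2.2).1).trans (le_abs_self _)
  refine (h2.trans ?_).trans_tendsto (he.comp tendsto_fst)
  have h3 := (isBigO_refl (fun q : ℕ × exterior n r₀ => e q.1) (atTop ×ˢ ⊤)).mul
    h.isBigO_weight_one
  simp only [mul_one] at h3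
  exact h3

lemma tendsto_metricDeriv {x : 𝔼} (hx : x ∈ exterior n r₀) (k i j : Fin n) :
    Tendsto (fun ℓ => metricDeriv (exterior n r₀) (Gs ℓ) x k i j) atTop
      (𝓝 (metricDeriv (exterior n r₀) G x k i j)) := by
  obtain ⟨e, he, h1⟩ := jet_le_of_tendsto_weightedC2Norm h.pos.le (h.limit.contDiffOn i j)
    (fun ℓ => (h.seq ℓ).contDiffOn i j) (h.tendsto_norm i j)
  rw [tendsto_iff_dist_tendsto_zero]
  refine squeeze_zero' (Eventually.of_forall fun _ => dist_nonneg)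
    (h1.mono fun ℓ hℓ => (hℓ x hx).2.1 k) ?_
  simpa using he.mul_const (‖x‖ ^ (-(1 + τ)))

lemma tendsto_metricDeriv₂ {x : 𝔼} (hx : x ∈ exterior n r₀) (k m i j : Fin n) :
    Tendsto (fun ℓ => metricDeriv₂ (exterior n r₀) (Gs ℓ) x k m i j) atTop
      (𝓝 (metricDeriv₂ (exterior n r₀) G x k m i j)) := by
  obtain ⟨e, he, h1⟩ := jet_le_of_tendsto_weightedC2Norm h.pos.le (h.limit.contDiffOn i j)
    (fun ℓ => (h.seq ℓ).contDiffOn i j) (h.tendsto_norm i j)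
  rw [tendsto_iff_dist_tendsto_zero]
  refine squeeze_zero' (Eventually.of_forall fun _ => dist_nonneg)
    (h1.mono fun ℓ hℓ => (hℓ x hx).2.2 k m) ?_
  simpa using he.mul_const (‖x‖ ^ (-(2 + τ)))

lemma tendsto_scalarDensity {x : 𝔼} (hx : x ∈ exterior n r₀) :
    Tendsto (fun ℓ => scalarDensity (exterior n r₀) (Gs ℓ) x) atTop
      (𝓝 (scalarDensity (exterior n r₀) G x)) := by
  refine tendsto_sqrt_det_mul_scalarJet (h.limit.det_ne_zero hx) (fun i j => ?_)
    (h.tendsto_metricDeriv hx) (h.tendsto_metricDeriv₂ hx)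
  have h1 : Tendsto (fun ℓ : ℕ => (ℓ, (⟨x, hx⟩ : exterior n r₀))) atTop (atTop ×ˢ ⊤) :=
    tendsto_id.prodMk tendsto_top
  simpa using ((h.tendsto_sub i j).comp h1).add_const (G x i j)

lemma tendsto_massField {x : 𝔼} (hx : x ∈ exterior n r₀) (j : Fin n) :
    Tendsto (fun ℓ => massField r₀ (Gs ℓ) j x) atTop (𝓝 (massField r₀ G j x)) :=
  tendsto_finsetSum _ fun _ _ => (h.tendsto_metricDeriv hx _ _ _).sub (h.tendsto_metricDeriv hx _ _ _)

lemma tendsto_divergence {x : 𝔼} (hx : x ∈ exterior n r₀) :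
    Tendsto (fun ℓ => divergence r₀ (massField r₀ (Gs ℓ)) x) atTop
      (𝓝 (divergence r₀ (massField r₀ G) x)) := by
  simp only [divergence_massField (h.seq _) hx, divergence_massField h.limit hx]
  exact tendsto_finsetSum _ fun _ _ => tendsto_finsetSum _ fun _ _ =>
    (h.tendsto_metricDeriv₂ hx _ _ _ _).sub (h.tendsto_metricDeriv₂ hx _ _ _ _)

lemma isBigO_massField (j : Fin n) : (fun q : ℕ × exterior n r₀ => massField r₀ (Gs q.1) j q.2)
    =O[atTop ×ˢ ⊤] fun q => ‖(q.2 : 𝔼)‖ ^ (-(1 + τ)) :=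
  IsBigO.fun_sum fun _ _ => (h.isBigO_metricDeriv _ _ _).sub (h.isBigO_metricDeriv _ _ _)

lemma isBigO_divergence : (fun q : ℕ × exterior n r₀ => divergence r₀ (massField r₀ (Gs q.1)) q.2)
    =O[atTop ×ˢ ⊤] fun q => ‖(q.2 : 𝔼)‖ ^ (-(2 + τ)) := by
  refine IsBigO.congr_left (f₁ := fun q : ℕ × exterior n r₀ =>
    linearJet (metricDeriv₂ (exterior n r₀) (Gs q.1) q.2)) ?_ fun q =>
      (divergence_massField (h.seq q.1) q.2.2).symm
  exact IsBigO.fun_sum fun _ _ => IsBigO.fun_sum fun _ _ =>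
    (h.isBigO_metricDeriv₂ _ _ _ _).sub (h.isBigO_metricDeriv₂ _ _ _ _)

/-- The components of `Gs ℓ - G` tend to zero uniformly on the end, hence so does the difference of
determinants, and half of the lower bound for `G` survives. -/
lemma exists_le_det : ∃ δ > 0, ∀ᶠ q : ℕ × exterior n r₀ in atTop ×ˢ ⊤, δ ≤ (Gs q.1 q.2).det := by
  obtain ⟨δ, hδ, hdet⟩ := h.det_bound
  refine ⟨δ / 2, by positivity, ?_⟩
  have h1 := isBigO_one_of_sub_one h.isBigO_sub_one h.isBigO_weight_one
  have h2 : ∀ i j, (fun q : ℕ × exterior n r₀ => G q.2 i j) =O[atTop ×ˢ ⊤] fun _ => (1 : ℝ) :=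
    fun i j => by
      simpa using (h1 i j).sub ((h.tendsto_sub i j).isBigO_one ℝ)
  let a : ℕ × exterior n r₀ → ℝ := fun q => ∑ i, ∑ j, |Gs q.1 q.2 i j - G q.2 i j|
  have ha : Tendsto a (atTop ×ˢ ⊤) (𝓝 0) := by
    have : Tendsto a (atTop ×ˢ ⊤) (𝓝 (∑ _i : Fin n, ∑ _j : Fin n, |(0 : ℝ)|)) :=
      tendsto_finsetSum _ fun i _ => tendsto_finsetSum _ fun j _ => (h.tendsto_sub i j).abs
    simpa using this
  have h3 : (fun q : ℕ × exterior n r₀ => (Gs q.1 q.2).det - (G q.2).det) =O[atTop ×ˢ ⊤] a := by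
    refine isBigO_det_sub_det h1 h2 fun i j => IsBigO.of_bound 1 (Eventually.of_forall fun q => ?_)
    rw [one_mul]
    refine le_trans ?_ (le_abs_self _)
    refine le_trans ?_ (Finset.single_le_sum (f := fun i => ∑ j, |Gs q.1 q.2 i j - G q.2 i j|)
      (fun _ _ => Finset.sum_nonneg fun _ _ => abs_nonneg _) (Finset.mem_univ i))
    exact Finset.single_le_sum (f := fun j => |Gs q.1 q.2 i j - G q.2 i j|)
      (fun _ _ => abs_nonneg _) (Finset.mem_univ j)
  filter_upwards [(h3.trans_tendsto ha).eventually_const_le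
    (show -(δ / 2) < 0 by linarith)] with q hq
  have := hdet q.2 q.2.2
  linarith

/-- The density of the total scalar curvature is a divergence up to an error that is integrable,
uniformly along the sequence. -/
theorem isBigO_scalarDensity_sub_divergence : (fun q : ℕ × exterior n r₀ =>
    scalarDensity (exterior n r₀) (Gs q.1) q.2 - divergence r₀ (massField r₀ (Gs q.1)) q.2)
      =O[atTop ×ˢ ⊤] fun q => ‖(q.2 : 𝔼)‖ ^ (-(2 + 2 * τ)) := by
  obtain ⟨δ, hδ, hdet⟩ := h.exists_le_det
  have hx : ∀ q : ℕ × exterior n r₀, 0 < ‖(q.2 : 𝔼)‖ := fun q => h.pos.trans q.2.2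
  -- The weights `a = |x|^(-τ)`, `b = |x|^(-1-τ)`, `c = |x|^(-2-τ)` satisfy `a c = b² = |x|^(-2-2τ)`
  -- exactly.
  have e1 : ∀ q : ℕ × exterior n r₀, ‖(q.2 : 𝔼)‖ ^ (-τ) * ‖(q.2 : 𝔼)‖ ^ (-(2 + τ)) =
      ‖(q.2 : 𝔼)‖ ^ (-(2 + 2 * τ)) := fun q => by
    rw [← Real.rpow_add (hx q)]; ring_nf
  have e2 : ∀ q : ℕ × exterior n r₀, ‖(q.2 : 𝔼)‖ ^ (-(1 + τ)) * ‖(q.2 : 𝔼)‖ ^ (-(1 + τ)) =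
      ‖(q.2 : 𝔼)‖ ^ (-(2 + 2 * τ)) := fun q => by
    rw [← Real.rpow_add (hx q)]; ring_nf
  have key := isBigO_sqrt_mul_scalarJet_sub_linearJet
    (isBigO_sqrt_det_sub_one h.isBigO_sub_one h.isBigO_weight_one
      (hdet.mono fun q hq => hδ.le.trans hq))
    (isBigO_matrix_inv_sub_one h.isBigO_sub_one h.isBigO_weight_one hδ hdet)
    h.isBigO_weight_one h.isBigO_metricDeriv h.isBigO_metricDeriv₂
    (by simp only [e1, e2]; exact isBigO_refl _ _)
    (fun q l i j k => by
      refine pderiv_congr (fun z hz => pderiv_congr (fun z hz => ?_) hz i) q.2.2 l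
      exact (h.seq q.1).symm hz j k)
  simp only [e1] at key
  refine key.congr_left fun q => ?_
  rw [divergence_massField (h.seq q.1) q.2.2, scalarDensity]

end JetConvergence

end Remainder

/-! ### Integration over the end -/

section EndAnalysis

open Asymptotics

variable {n : ℕ} {r₀ τ : ℝ} {G : EuclideanSpace ℝ (Fin n) → Matrix (Fin n) (Fin n) ℝ}
  {Gs : ℕ → EuclideanSpace ℝ (Fin n) → Matrix (Fin n) (Fin n) ℝ}

local notation "𝔼" => EuclideanSpace ℝ (Fin n)

/-- On the exterior `1 ≤ |x| / r₀`, so `1 + |x| ≤ (1 + 1/r₀) |x|`, and the integrable function `(1 +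
|x|)^(-s)` dominates up to the constant `(1 + 1/r₀)^s`. -/
lemma integrableOn_rpow_norm (h₀ : 0 < r₀) {s : ℝ} (hs : (n : ℝ) < s) :
    IntegrableOn (fun x : 𝔼 => ‖x‖ ^ (-s)) (exterior n r₀) := by
  have h1 : Integrable (fun x : 𝔼 => ((1 + r₀⁻¹) ^ s) * (1 + ‖x‖) ^ (-s)) :=
    (integrable_one_add_norm (by simpa using hs)).const_mul _
  refine h1.integrableOn.mono' (measurable_norm.pow_const _).aestronglyMeasurable ?_
  filter_upwards [ae_restrict_mem (isOpen_exterior r₀).measurableSet] with x hx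
  have hx0 : 0 < ‖x‖ := h₀.trans hx
  have hs0 : 0 ≤ s := (Nat.cast_nonneg n).trans hs.le
  rw [Real.norm_of_nonneg (by positivity), Real.rpow_neg hx0.le, Real.rpow_neg (by positivity),
    ← div_eq_mul_inv, le_div_iff₀ (by positivity), inv_mul_le_iff₀ (by positivity),
    ← Real.mul_rpow hx0.le (by positivity)]
  refine Real.rpow_le_rpow (by positivity) ?_ hs0
  have : 1 ≤ ‖x‖ * r₀⁻¹ := by
    rw [← div_eq_mul_inv, one_le_div h₀]
    exact hx.le
  linarith

lemma exists_bound_of_isBigO {X : Type*} {S : Set X} {F : ℕ → X → ℝ} {w : X → ℝ}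
    (h : (fun q : ℕ × S => F q.1 q.2) =O[atTop ×ˢ ⊤] fun q => w q.2) :
    ∃ C, ∀ᶠ ℓ in atTop, ∀ x ∈ S, ‖F ℓ x‖ ≤ C * ‖w x‖ := by
  obtain ⟨C, hC⟩ := h.bound
  rw [← principal_univ, eventually_prod_principal_iff] at hC
  exact ⟨C, hC.mono fun ℓ hℓ x hx => hℓ ⟨x, hx⟩ (mem_univ _)⟩

/-- Fatou's lemma for Bochner integrals. -/
lemma eventually_lt_integral_of_nonneg {X : Type*} [MeasurableSpace X] {μ : Measure X}
    {F : ℕ → X → ℝ} {f : X → ℝ} (hF : ∀ ℓ, Integrable (F ℓ) μ) (hf : Integrable f μ)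
    (h0 : ∀ ℓ, 0 ≤ᵐ[μ] F ℓ) (h : ∀ᵐ x ∂μ, Tendsto (fun ℓ => F ℓ x) atTop (𝓝 (f x)))
    {b : ℝ} (hb : b < ∫ x, f x ∂μ) : ∀ᶠ ℓ in atTop, b < ∫ x, F ℓ x ∂μ := by
  -- A negative `b` is handled separately because `ENNReal.ofReal` sends all negative numbers to
  -- zero.
  rcases lt_or_ge b 0 with hb0 | hb0
  · exact Eventually.of_forall fun ℓ => hb0.trans_le (integral_nonneg_of_ae (h0 ℓ))
  have hf0 : 0 ≤ᵐ[μ] f := by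
    filter_upwards [h, ae_all_iff.2 h0] with x hx hx0
    exact ge_of_tendsto' hx hx0
  have h1 : ENNReal.ofReal (∫ x, f x ∂μ) ≤
      liminf (fun ℓ => ENNReal.ofReal (∫ x, F ℓ x ∂μ)) atTop := by
    simp only [ofReal_integral_eq_lintegral_ofReal hf hf0,
      fun ℓ => ofReal_integral_eq_lintegral_ofReal (hF ℓ) (h0 ℓ)]
    refine le_trans (le_of_eq ?_)
      (lintegral_liminf_le' fun ℓ => (hF ℓ).aestronglyMeasurable.aemeasurable.ennreal_ofReal)
    refine lintegral_congr_ae ?_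
    filter_upwards [h] with x hx
    exact ((ENNReal.tendsto_ofReal hx).liminf_eq).symm
  have h2 := eventually_lt_of_lt_liminf
    (lt_of_lt_of_le ((ENNReal.ofReal_lt_ofReal_iff (hb0.trans_lt hb)).2 hb) h1)
  exact h2.mono fun ℓ hℓ => (ENNReal.ofReal_lt_ofReal_iff_of_nonneg hb0).1 hℓ

lemma weightedC2Norm_zero : weightedC2Norm r₀ τ (fun _ : 𝔼 => 0) = 0 := by
  have h1 : ∀ j : Fin n, pderiv (exterior n r₀) j (fun _ : 𝔼 => (0 : ℝ)) = fun _ => 0 :=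
    fun j => funext fun x => pderiv_const 0 j
  simp [weightedC2Norm, h1]

namespace JetConvergence

/-- Estimates proved for sequences become estimates for a single metric by applying them to the
constant sequence. -/
lemma constant (h₀ : 0 < r₀) (hτ : 0 < τ) (hG : IsC2MetricOn (exterior n r₀) G)
    (h : ∀ i j, weightedC2Norm r₀ τ
      (fun x => G x i j - (1 : Matrix (Fin n) (Fin n) ℝ) i j) < ⊤)
    (hdet : ∃ δ > 0, ∀ x ∈ exterior n r₀, δ ≤ (G x).det) : JetConvergence r₀ τ G fun _ => G where
  pos := h₀
  decay_pos := hτ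
  limit := hG
  seq _ := hG
  norm_lt_top := h
  tendsto_norm i j := by simp [weightedC2Norm_zero]
  det_bound := hdet

section Single

variable (h : JetConvergence r₀ τ G fun _ => G)

include h

lemma integrableOn_sub_divergence (hτ : (n : ℝ) < 2 + 2 * τ) :
    IntegrableOn (fun x => scalarDensity (exterior n r₀) G x - divergence r₀ (massField r₀ G) x)
      (exterior n r₀) := by
  have hS : UniqueDiffOn ℝ (exterior n r₀) := (isOpen_exterior r₀).uniqueDiffOn
  obtain ⟨C, hC⟩ := exists_bound_of_isBigO (F := fun _ x => scalarDensity (exterior n r₀) G x -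
    divergence r₀ (massField r₀ G) x) (w := fun x => ‖x‖ ^ (-(2 + 2 * τ)))
    h.isBigO_scalarDensity_sub_divergence
  obtain ⟨_, hℓ⟩ := hC.exists
  refine ((integrableOn_rpow_norm h.pos hτ).norm.const_mul C).mono' ?_ ?_
  · exact ((h.limit.continuousOn_scalarDensity hS).sub (continuousOn_divergence
      (contDiffOn_massField h.limit))).aestronglyMeasurable (isOpen_exterior r₀).measurableSet
  · filter_upwards [ae_restrict_mem (isOpen_exterior r₀).measurableSet] with x hx
    exact hℓ x hx

/-- The divergence is the curvature density minus an integrable error; this is where integrability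
of the scalar curvature enters the existence of the mass. -/
lemma integrableOn_divergence (hτ : (n : ℝ) < 2 + 2 * τ)
    (hR : IntegrableOn (scalarDensity (exterior n r₀) G) (exterior n r₀)) :
    IntegrableOn (divergence r₀ (massField r₀ G)) (exterior n r₀) := by
  refine (Integrable.sub hR (h.integrableOn_sub_divergence hτ)).congr (Eventually.of_forall
    fun x => ?_)
  simp

/-- The flux through large spheres converges if the scalar curvature is integrable. -/
lemma tendsto_flux (hn : 0 < n) (hτ : (n : ℝ) < 2 + 2 * τ)
    (hR : IntegrableOn (scalarDensity (exterior n r₀) G) (exterior n r₀)) {r₁ : ℝ} (hr : r₀ < r₁) :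
    Tendsto (flux (massField r₀ G)) atTop (𝓝 (flux (massField r₀ G) r₁ +
      ∫ x in exterior n r₁, divergence r₀ (massField r₀ G) x)) := by
  have hU : ⋃ r : ℝ, {x : 𝔼 | r₁ < ‖x‖ ∧ ‖x‖ ≤ r} = exterior n r₁ := by
    ext x
    simp only [mem_iUnion, mem_ofPred_eq, exterior]
    exact ⟨fun ⟨_, h⟩ => h.1, fun h => ⟨‖x‖, h, le_rfl⟩⟩
  have h1 : Tendsto (fun r : ℝ => ∫ x in {x : 𝔼 | r₁ < ‖x‖ ∧ ‖x‖ ≤ r},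
      divergence r₀ (massField r₀ G) x) atTop
      (𝓝 (∫ x in exterior n r₁, divergence r₀ (massField r₀ G) x)) := by
    rw [← hU]
    refine tendsto_setIntegral_of_monotone (fun r => ?_) (fun r s hrs x hx => ?_) ?_
    · exact (measurableSet_lt measurable_const measurable_norm).inter
        (measurableSet_le measurable_norm measurable_const)
    · exact ⟨hx.1, hx.2.trans hrs⟩
    · rw [hU]
      exact (h.integrableOn_divergence hτ hR).mono_set fun x hx => hr.trans hx
  refine (h1.const_add (flux (massField r₀ G) r₁)).congr' ?_
  filter_upwards [eventually_ge_atTop r₁] with r hr1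
  rw [← flux_sub_flux_eq_setIntegral hn h.pos.le (contDiffOn_massField h.limit) hr hr1]
  ring

end Single

variable (h : JetConvergence r₀ τ G Gs)

include h

/-- Dominated convergence over the whole unbounded end is possible because the quadratic error has
the uniform bound `C |x|^(-2-2τ)`, although neither of its two terms need be dominated. -/
lemma tendsto_integral_sub_divergence (hτ : (n : ℝ) < 2 + 2 * τ) :
    Tendsto (fun ℓ => ∫ x in exterior n r₀, (scalarDensity (exterior n r₀) (Gs ℓ) x -
        divergence r₀ (massField r₀ (Gs ℓ)) x)) atTop
      (𝓝 (∫ x in exterior n r₀, (scalarDensity (exterior n r₀) G x -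
        divergence r₀ (massField r₀ G) x))) := by
  have hS : UniqueDiffOn ℝ (exterior n r₀) := (isOpen_exterior r₀).uniqueDiffOn
  have hm : MeasurableSet (exterior n r₀) := (isOpen_exterior r₀).measurableSet
  obtain ⟨C, hC⟩ := exists_bound_of_isBigO (F := fun ℓ x => scalarDensity (exterior n r₀) (Gs ℓ) x -
    divergence r₀ (massField r₀ (Gs ℓ)) x) (w := fun x => ‖x‖ ^ (-(2 + 2 * τ)))
    h.isBigO_scalarDensity_sub_divergence
  refine tendsto_integral_filter_of_dominated_convergence _ ?_ ?_
    ((integrableOn_rpow_norm h.pos hτ).norm.const_mul C) ?_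
  · exact Eventually.of_forall fun ℓ => (((h.seq ℓ).continuousOn_scalarDensity hS).sub
      (continuousOn_divergence (contDiffOn_massField (h.seq ℓ)))).aestronglyMeasurable hm
  · filter_upwards [hC] with ℓ hℓ
    filter_upwards [ae_restrict_mem hm] with x hx
    exact hℓ x hx
  · filter_upwards [ae_restrict_mem hm] with x hx
    exact (h.tendsto_scalarDensity hx).sub (h.tendsto_divergence hx)

/-- On a bounded annulus the weak bound `|x|^(-2-τ) ≤ r₀^(-2-τ)` already suffices for dominated
convergence. -/
lemma tendsto_integral_divergence (r₁ : ℝ) :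
    Tendsto (fun ℓ => ∫ x in {x : 𝔼 | r₀ < ‖x‖ ∧ ‖x‖ ≤ r₁}, divergence r₀ (massField r₀ (Gs ℓ)) x)
      atTop (𝓝 (∫ x in {x : 𝔼 | r₀ < ‖x‖ ∧ ‖x‖ ≤ r₁}, divergence r₀ (massField r₀ G) x)) := by
  have hm : MeasurableSet {x : 𝔼 | r₀ < ‖x‖ ∧ ‖x‖ ≤ r₁} :=
    (measurableSet_lt measurable_const measurable_norm).inter
      (measurableSet_le measurable_norm measurable_const)
  have hfin : volume {x : 𝔼 | r₀ < ‖x‖ ∧ ‖x‖ ≤ r₁} < ⊤ :=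
    (measure_mono fun x hx => by simpa using hx.2).trans_lt
      (isCompact_closedBall (0 : 𝔼) r₁).measure_lt_top
  have : IsFiniteMeasure (volume.restrict {x : 𝔼 | r₀ < ‖x‖ ∧ ‖x‖ ≤ r₁}) :=
    ⟨by rwa [Measure.restrict_apply_univ]⟩
  obtain ⟨C, hC⟩ := exists_bound_of_isBigO
    (F := fun ℓ x => divergence r₀ (massField r₀ (Gs ℓ)) x) (w := fun x => ‖x‖ ^ (-(2 + τ)))
    h.isBigO_divergence
  refine tendsto_integral_filter_of_dominated_convergence (fun _ => |C| * r₀ ^ (-(2 + τ))) ?_ ?_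
    (integrable_const _) ?_
  · exact Eventually.of_forall fun ℓ => ((continuousOn_divergence
      (contDiffOn_massField (h.seq ℓ))).mono fun x hx => hx.1).aestronglyMeasurable hm
  · filter_upwards [hC] with ℓ hℓ
    filter_upwards [ae_restrict_mem hm] with x hx
    refine (hℓ x hx.1).trans (mul_le_mul (le_abs_self C) ?_ (norm_nonneg _) (abs_nonneg _))
    rw [Real.norm_of_nonneg (by positivity)]
    exact Real.rpow_le_rpow_of_nonpos h.pos hx.1.le (by linarith [h.decay_pos])
  · filter_upwards [ae_restrict_mem hm] with x hx
    exact h.tendsto_divergence hx.1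

lemma tendsto_flux_apply {r₁ : ℝ} (hr : r₀ < r₁) :
    Tendsto (fun ℓ => flux (massField r₀ (Gs ℓ)) r₁) atTop (𝓝 (flux (massField r₀ G) r₁)) := by
  have hx : ∀ u : Metric.sphere (0 : 𝔼) 1, r₁ • (u : 𝔼) ∈ exterior n r₀ := fun u => by
    simpa [exterior, norm_smul, abs_of_pos (h.pos.trans hr)] using hr
  have hN : ∀ ℓ, ContinuousOn (fun x : 𝔼 => ∑ j, massField r₀ (Gs ℓ) j x * (x j / ‖x‖))
      (exterior n r₀) := fun ℓ => continuousOn_finsetSum _ fun j _ =>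
    (contDiffOn_massField (h.seq ℓ) j).continuousOn.mul (continuousOn_div_norm h.pos.le j)
  choose C hC using fun j => exists_bound_of_isBigO (F := fun ℓ x => massField r₀ (Gs ℓ) j x)
    (w := fun x => ‖x‖ ^ (-(1 + τ))) (h.isBigO_massField j)
  refine Tendsto.const_mul _ (tendsto_integral_filter_of_dominated_convergence
    (fun _ => ∑ j, C j * ‖r₁ ^ (-(1 + τ))‖) ?_ ?_ (integrable_const _) ?_)
  · exact Eventually.of_forall fun ℓ =>
      (integrable_comp_sphere h.pos.le hr (hN ℓ)).aestronglyMeasurable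
  · filter_upwards [eventually_all.2 hC] with ℓ hℓ
    refine Eventually.of_forall fun u => (norm_sum_le _ _).trans (Finset.sum_le_sum fun j _ => ?_)
    have e : ‖r₁ • (u : 𝔼)‖ = r₁ := by simp [norm_smul, abs_of_pos (h.pos.trans hr)]
    have h1 := hℓ j _ (hx u)
    rw [e] at h1
    rw [norm_mul]
    refine (mul_le_of_le_one_right (norm_nonneg _) ?_).trans h1
    rw [norm_div, norm_norm]
    exact div_le_one_of_le₀ (PiLp.norm_apply_le _ j) (norm_nonneg _)
  · exact Eventually.of_forall fun u => tendsto_finsetSum _ fun j _ =>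
      (h.tendsto_massField (hx u) j).mul_const _

end JetConvergence

end EndAnalysis

/-! ### The mass: existence, continuity and semicontinuity -/

section Mass

variable {n : ℕ} {H : Type*} [TopologicalSpace H]
  {I : ModelWithCorners ℝ (EuclideanSpace ℝ (Fin n)) H}
  {M : Type*} [TopologicalSpace M] [ChartedSpace H M] [IsManifold I ∞ M]
  {Φ : EndChart I M} {τ : ℝ} {gs : ℕ → C2Metric I M} {g : C2Metric I M}

local notation "𝔼" => EuclideanSpace ℝ (Fin n)

lemma isC2MetricOn_endMetric (Φ : EndChart I M) (g : C2Metric I M) :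
    IsC2MetricOn (exterior n Φ.r₀) (endMetric Φ g) :=
  (Φ.isParam (isOpen_exterior _) Φ.exterior_subset).isC2MetricOn g

/-- The components of an asymptotically flat metric have determinant bounded away from zero, up to
the boundary of the end. -/
lemma exists_le_det_endMetric (hτ : 0 < τ) (hg : MemMet Φ τ g) :
    ∃ δ > 0, ∀ x ∈ exterior n Φ.r₀, δ ≤ (endMetric Φ g x).det := by
  have hG := isC2MetricOn_endMetric Φ g
  choose C hC using fun i j => jet_le_of_weightedC2Norm_lt_top Φ.r₀_pos.le (hG.contDiffOn i j)
    (hg i j)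
  -- At infinity the metric tends to the flat one, so its determinant is eventually at least `1/2`.
  have h1 : ∀ i j, Tendsto (fun x => endMetric Φ g x i j) (comap norm atTop ⊓ 𝓟 (exterior n Φ.r₀))
      (𝓝 ((1 : Matrix (Fin n) (Fin n) ℝ) i j)) := fun i j => by
    rw [tendsto_iff_dist_tendsto_zero]
    refine squeeze_zero' (g := fun x => C i j * ‖x‖ ^ (-τ)) (Eventually.of_forall fun _ => dist_nonneg) ?_ ?_
    · filter_upwards [mem_inf_of_right (mem_principal_self _)] with x hx
      exact (hC i j x hx).1
    · have := ((tendsto_rpow_neg_atTop hτ).comp (tendsto_comap (f := fun x : 𝔼 => ‖x‖))).const_mul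
        (C i j)
      rw [mul_zero] at this
      exact this.mono_left inf_le_left
  have h2 := (tendsto_det h1).eventually_const_le (show (1 / 2 : ℝ) < _ by norm_num)
  rw [eventually_inf_principal, eventually_comap] at h2
  obtain ⟨R, hR⟩ := eventually_atTop.1 h2
  -- On the remaining shell compactness is used. It includes the sphere `|x| = r₀`, which is where
  -- the chart has to extend beyond the open exterior region.
  have hT := (Φ.isParam Φ.chart.open_target Subset.rfl).isC2MetricOn g
  have hK : IsCompact {x : 𝔼 | Φ.r₀ ≤ ‖x‖ ∧ ‖x‖ ≤ R} :=
    (isCompact_closedBall (0 : 𝔼) R).of_isClosed_subset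
      ((isClosed_le continuous_const continuous_norm).inter
        (isClosed_le continuous_norm continuous_const)) fun x hx => by simpa using hx.2
  have hcont : ContinuousOn (fun x => (coordMetric g Φ.chart.symm Φ.chart.target x).det)
      {x : 𝔼 | Φ.r₀ ≤ ‖x‖ ∧ ‖x‖ ≤ R} := fun x hx => tendsto_det fun i j =>
    ((hT.contDiffOn i j).continuousOn.mono fun y hy => Φ.subset_target hy.1) x hx
  obtain ⟨δ, hδ, h3⟩ := hK.exists_forall_le' hcont
    fun x hx => (hT.posDef x (Φ.subset_target hx.1)).det_pos
  refine ⟨min δ (1 / 2), lt_min hδ (by norm_num), fun x hx => ?_⟩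
  rcases le_total ‖x‖ R with hxR | hxR
  · have e : endMetric Φ g x = coordMetric g Φ.chart.symm Φ.chart.target x := by
      have := IsParam.coordMetric_inter (ψ := Φ.chart.symm) g
        (isOpen_exterior Φ.r₀) (mem_inter (Φ.exterior_subset hx) hx)
      rwa [inter_eq_right.2 Φ.exterior_subset] at this
    rw [e]
    exact (min_le_left _ _).trans (h3 x ⟨hx.le, hxR⟩)
  · exact (min_le_right _ _).trans (hR ‖x‖ hxR x rfl hx)

lemma jetConvergence_endMetric (hτ : 0 < τ) (hg : MemMet Φ τ g) (h : MetConverges Φ τ gs g) :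
    JetConvergence Φ.r₀ τ (endMetric Φ g) fun ℓ => endMetric Φ (gs ℓ) where
  pos := Φ.r₀_pos
  decay_pos := hτ
  limit := isC2MetricOn_endMetric Φ g
  seq ℓ := isC2MetricOn_endMetric Φ (gs ℓ)
  norm_lt_top := hg
  tendsto_norm := h.1
  det_bound := exists_le_det_endMetric hτ hg

lemma jetConvergence_const_endMetric (hτ : 0 < τ) (hg : MemMet Φ τ g) :
    JetConvergence Φ.r₀ τ (endMetric Φ g) fun _ => endMetric Φ g :=
  JetConvergence.constant Φ.r₀_pos hτ (isC2MetricOn_endMetric Φ g) hg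
    (exists_le_det_endMetric hτ hg)

lemma admFlux_eq (Φ : EndChart I M) (g : C2Metric I M) {r : ℝ} (hr : 0 < r) :
    admFlux Φ g r = 1 / (2 * ((n : ℝ) - 1) * unitSphereArea n) *
      flux (massField Φ.r₀ (endMetric Φ g)) r := by
  unfold admFlux flux sphereIntegral
  congr 3
  ext u
  have e : ‖r • (u : 𝔼)‖ = r := by simp [norm_smul, abs_of_pos hr]
  beta_reduce
  rw [Finset.sum_comm, e]
  simp only [massField, metricDeriv, Finset.sum_mul]

lemma EndChart.compl_core (Φ : EndChart I M) : Φ.coreᶜ = Φ.chart.symm '' exterior n Φ.r₀ := by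
  rw [core, compl_compl, Φ.chart.symm_image_eq_source_inter_preimage Φ.exterior_subset]

lemma EndChart.isOpen_compl_core (Φ : EndChart I M) : IsOpen Φ.coreᶜ := by
  rw [Φ.compl_core]
  exact Φ.chart.isOpen_image_symm_of_subset_target (isOpen_exterior _) Φ.exterior_subset

lemma EndChart.exterior_inter_preimage (Φ : EndChart I M) :
    exterior n Φ.r₀ ∩ Φ.chart.symm ⁻¹' Φ.coreᶜ = exterior n Φ.r₀ := by
  rw [inter_eq_left, Φ.compl_core]
  exact fun x hx => ⟨x, hx, rfl⟩

/-! ### The total scalar curvature split into core and end -/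

section CurvatureIntegral

variable [MeasurableSpace M] [BorelSpace M] [SecondCountableTopology M]

lemma integrableOn_scalarDensity (Φ : EndChart I M)
    (hg : Integrable (scalarCurvature g) (volumeMeasure g)) :
    IntegrableOn (scalarDensity (exterior n Φ.r₀) (endMetric Φ g)) (exterior n Φ.r₀) := by
  have P := Φ.isParam (isOpen_exterior _) Φ.exterior_subset
  have := P.integrableOn_of_integrable g Φ.isOpen_compl_core.measurableSet Φ.compl_core.subset hg
  rw [Φ.exterior_inter_preimage] at this
  exact this.congr_fun (fun y hy => P.sqrt_det_mul_scalarCurvature g hy)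
    (isOpen_exterior _).measurableSet

lemma totalScalarCurvature_eq (Φ : EndChart I M)
    (hg : Integrable (scalarCurvature g) (volumeMeasure g)) :
    totalScalarCurvature g = ∫ x in Φ.core, scalarCurvature g x ∂(volumeMeasure g) +
      ∫ x in exterior n Φ.r₀, scalarDensity (exterior n Φ.r₀) (endMetric Φ g) x := by
  have P := Φ.isParam (isOpen_exterior _) Φ.exterior_subset
  have hm := Φ.isOpen_compl_core.measurableSet
  have h := P.setIntegral_scalarCurvature g hm Φ.compl_core.subset hg
  rw [Φ.exterior_inter_preimage] at h
  rw [totalScalarCurvature, ← integral_add_compl hm.of_compl hg, h]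
  rfl

/-- The mass as a flux through a finite sphere plus a convergent volume integral. -/
lemma tendsto_admFlux_of_lt (hn : 0 < n) (hτ : 0 < τ) (hτn : (n : ℝ) < 2 + 2 * τ)
    (hg : IsAsymptoticallyFlat Φ τ g) {r₁ : ℝ} (hr : Φ.r₀ < r₁) :
    Tendsto (admFlux Φ g) atTop (𝓝 (1 / (2 * ((n : ℝ) - 1) * unitSphereArea n) *
      (flux (massField Φ.r₀ (endMetric Φ g)) r₁ +
        ∫ x in exterior n r₁, divergence Φ.r₀ (massField Φ.r₀ (endMetric Φ g)) x))) := by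
  have h := jetConvergence_const_endMetric hτ hg.1
  refine ((h.tendsto_flux hn hτn (integrableOn_scalarDensity Φ hg.2) hr).const_mul _).congr' ?_
  filter_upwards [eventually_gt_atTop 0] with r hr0
  rw [admFlux_eq Φ g hr0]

/-- The difference of the mass and the normalized total scalar curvature is the integral of terms
that are continuous in the metric. -/
lemma admMass_sub_totalScalarCurvature (hn : 0 < n) (hτ : 0 < τ) (hτn : (n : ℝ) < 2 + 2 * τ)
    (hg : IsAsymptoticallyFlat Φ τ g) {r₁ : ℝ} (hr : Φ.r₀ < r₁) :
    admMass Φ g - 1 / (2 * ((n : ℝ) - 1) * unitSphereArea n) * totalScalarCurvature g =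
      1 / (2 * ((n : ℝ) - 1) * unitSphereArea n) *
        (flux (massField Φ.r₀ (endMetric Φ g)) r₁
          - (∫ x in Φ.core, scalarCurvature g x ∂(volumeMeasure g))
          - (∫ x in exterior n Φ.r₀, (scalarDensity (exterior n Φ.r₀) (endMetric Φ g) x
              - divergence Φ.r₀ (massField Φ.r₀ (endMetric Φ g)) x))
          - ∫ x in {x : 𝔼 | Φ.r₀ < ‖x‖ ∧ ‖x‖ ≤ r₁},
              divergence Φ.r₀ (massField Φ.r₀ (endMetric Φ g)) x) := by
  have h := jetConvergence_const_endMetric hτ hg.1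
  have hR := integrableOn_scalarDensity Φ hg.2
  have hd := h.integrableOn_divergence hτn hR
  have hm : MeasurableSet (exterior n r₁) := (isOpen_exterior r₁).measurableSet
  have hU : exterior n Φ.r₀ = {x : 𝔼 | Φ.r₀ < ‖x‖ ∧ ‖x‖ ≤ r₁} ∪ exterior n r₁ := by
    ext x
    simp only [exterior, mem_ofPred_eq, mem_union]
    refine ⟨fun hx => ?_, fun hx => hx.elim (fun h => h.1) fun h => hr.trans h⟩
    rcases le_or_gt ‖x‖ r₁ with h | h
    exacts [Or.inl ⟨hx, h⟩, Or.inr h]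
  have h1 : ∫ x in exterior n Φ.r₀, divergence Φ.r₀ (massField Φ.r₀ (endMetric Φ g)) x =
      (∫ x in {x : 𝔼 | Φ.r₀ < ‖x‖ ∧ ‖x‖ ≤ r₁},
        divergence Φ.r₀ (massField Φ.r₀ (endMetric Φ g)) x) +
      ∫ x in exterior n r₁, divergence Φ.r₀ (massField Φ.r₀ (endMetric Φ g)) x := by
    conv_lhs => rw [hU]
    refine setIntegral_union (disjoint_left.2 fun x hx hx' => not_lt_of_ge hx.2 hx') hm
      (hd.mono_set fun x hx => hx.1) (hd.mono_set fun x hx => hr.trans hx)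
  have hmass : admMass Φ g = _ := (tendsto_admFlux_of_lt hn hτ hτn hg hr).limUnder_eq
  rw [hmass, totalScalarCurvature_eq Φ hg.2, integral_sub hR hd, h1]
  ring

variable [T2Space M]

lemma tendsto_admMass_sub_totalScalarCurvature (hn : 0 < n) (hτ : 0 < τ)
    (hτn : (n : ℝ) < 2 + 2 * τ) (hgs : ∀ ℓ, IsAsymptoticallyFlat Φ τ (gs ℓ))
    (hg : IsAsymptoticallyFlat Φ τ g) (hconv : MetConverges Φ τ gs g) :
    Tendsto (fun ℓ => admMass Φ (gs ℓ)
        - 1 / (2 * ((n : ℝ) - 1) * unitSphereArea n) * totalScalarCurvature (gs ℓ)) atTop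
      (𝓝 (admMass Φ g
        - 1 / (2 * ((n : ℝ) - 1) * unitSphereArea n) * totalScalarCurvature g)) := by
  have h := jetConvergence_endMetric hτ hg.1 hconv
  have hr : Φ.r₀ < Φ.r₀ + 1 := lt_add_one _
  rw [admMass_sub_totalScalarCurvature hn hτ hτn hg hr]
  simp only [fun ℓ => admMass_sub_totalScalarCurvature hn hτ hτn (hgs ℓ) hr]
  exact ((((h.tendsto_flux_apply hr).sub (tendsto_setIntegral_scalarCurvature Φ.isCompact_core
    hconv.2 (fun ℓ => (hgs ℓ).2) hg.2)).sub (h.tendsto_integral_sub_divergence hτn)).sub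
      (h.tendsto_integral_divergence _)).const_mul _

/-- The total scalar curvature is lower semicontinuous on metrics of nonnegative scalar
curvature. -/
lemma eventually_lt_totalScalarCurvature (hτ : 0 < τ)
    (hgs : ∀ ℓ, IsAsymptoticallyFlat Φ τ (gs ℓ))
    (hg : IsAsymptoticallyFlat Φ τ g) (hconv : MetConverges Φ τ gs g)
    (hpos : ∀ ℓ x, 0 ≤ scalarCurvature (gs ℓ) x) {b : ℝ} (hb : b < totalScalarCurvature g) :
    ∀ᶠ ℓ in atTop, b < totalScalarCurvature (gs ℓ) := by
  have h := jetConvergence_endMetric hτ hg.1 hconv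
  have P := Φ.isParam (isOpen_exterior _) Φ.exterior_subset
  have hm : MeasurableSet (exterior n Φ.r₀) := (isOpen_exterior _).measurableSet
  have hcore := tendsto_setIntegral_scalarCurvature (K := Φ.core) Φ.isCompact_core hconv.2
    (fun ℓ => (hgs ℓ).2) hg.2
  rw [totalScalarCurvature_eq Φ hg.2] at hb
  simp only [fun ℓ => totalScalarCurvature_eq Φ (hgs ℓ).2]
  set T := ∫ x in Φ.core, scalarCurvature g x ∂(volumeMeasure g)
  set E := ∫ x in exterior n Φ.r₀, scalarDensity (exterior n Φ.r₀) (endMetric Φ g) x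
  -- The slack `T + E - b` is shared equally between the core, where the integrals converge, and the
  -- end, where Fatou's lemma gives a lower bound.
  have h1 := hcore.eventually_const_lt (show T - (T + E - b) / 2 < T by linarith)
  have h2 := eventually_lt_integral_of_nonneg (fun ℓ => integrableOn_scalarDensity Φ (hgs ℓ).2)
    (integrableOn_scalarDensity Φ hg.2) (fun ℓ => ?_) ?_
    (show E - (T + E - b) / 2 < E by linarith)
  · filter_upwards [h1, h2] with ℓ k1 k2
    linarith
  · filter_upwards [ae_restrict_mem hm] with x hx
    have := P.sqrt_det_mul_scalarCurvature (gs ℓ) hx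
    exact this ▸ mul_nonneg (Real.sqrt_nonneg _) (hpos ℓ _)
  · filter_upwards [ae_restrict_mem hm] with x hx
    exact h.tendsto_scalarDensity hx

lemma admMass_le_liminf (hn : 1 < n) (hτ : 0 < τ) (hτn : (n : ℝ) < 2 + 2 * τ)
    (hgs : ∀ ℓ, IsAsymptoticallyFlat Φ τ (gs ℓ))
    (hg : IsAsymptoticallyFlat Φ τ g) (hconv : MetConverges Φ τ gs g)
    (hpos : ∀ ℓ x, 0 ≤ scalarCurvature (gs ℓ) x) :
    (admMass Φ g : EReal) ≤ liminf (fun ℓ => (admMass Φ (gs ℓ) : EReal)) atTop := by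
  have h1 := tendsto_admMass_sub_totalScalarCurvature (by omega) hτ hτn hgs hg hconv
  set c := 1 / (2 * ((n : ℝ) - 1) * unitSphereArea n) with hc
  -- Only `c ≥ 0` is needed, so the positivity of the area of the sphere plays no role.
  have hc0 : 0 ≤ c := by
    have : (1 : ℝ) < n := by exact_mod_cast hn
    have h3 : 0 ≤ unitSphereArea n := measureReal_nonneg
    exact one_div_nonneg.2 (mul_nonneg (by linarith) h3)
  rw [le_liminf_iff]
  intro b hb
  induction b with
  | bot => exact Eventually.of_forall fun ℓ => EReal.bot_lt_coe _
  | top => exact absurd hb not_top_lt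
  | coe b =>
    have hb' : b < admMass Φ g := EReal.coe_lt_coe_iff.1 hb
    set ε := (admMass Φ g - b) / 2 with hε
    have hε0 : 0 < ε := by rw [hε]; linarith
    have h2 := h1.eventually_const_lt
      (show admMass Φ g - c * totalScalarCurvature g - ε < _ by linarith)
    -- The tolerance `ε / (c + 1)` costs at most `ε` after multiplication by `c`, also when `c = 0`.
    -- The two losses of `ε` add up to `admMass Φ g - b`.
    have h3 := eventually_lt_totalScalarCurvature hτ hgs hg hconv hpos
      (show totalScalarCurvature g - ε / (c + 1) < totalScalarCurvature g from
        sub_lt_self _ (by positivity))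
    filter_upwards [h2, h3] with ℓ k2 k3
    rw [EReal.coe_lt_coe_iff]
    have k4 := mul_le_mul_of_nonneg_left k3.le hc0
    have k5 : c * (ε / (c + 1)) ≤ ε := by
      rw [← mul_div_assoc, div_le_iff₀ (by positivity)]
      nlinarith
    rw [mul_sub] at k4
    linarith

end CurvatureIntegral

end Mass

end ADM

end

theorem theorem3 {n : ℕ} (hn : 3 ≤ n) {H : Type*} [TopologicalSpace H]
    (I : ModelWithCorners ℝ (EuclideanSpace ℝ (Fin n)) H)
    {M : Type*} [TopologicalSpace M] [T2Space M] [SecondCountableTopology M]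
    [ChartedSpace H M] [IsManifold I ∞ M] [MeasurableSpace M] [BorelSpace M]
    (Φ : ADM.EndChart I M) {τ : ℝ} (hτ : ((n : ℝ) - 2) / 2 < τ)
    (gs : ℕ → ADM.C2Metric I M) (g : ADM.C2Metric I M)
    (hgs : ∀ ℓ, ADM.IsAsymptoticallyFlat Φ τ (gs ℓ))
    (hg : ADM.IsAsymptoticallyFlat Φ τ g)
    (hconv : ADM.MetConverges Φ τ gs g) :
    -- the limits that define the ADM masses exist
    (∀ ℓ, Tendsto (ADM.admFlux Φ (gs ℓ)) atTop (𝓝 (ADM.admMass Φ (gs ℓ)))) ∧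
    Tendsto (ADM.admFlux Φ g) atTop (𝓝 (ADM.admMass Φ g)) ∧
    Tendsto
      (fun ℓ => ADM.admMass Φ (gs ℓ)
        - 1 / (2 * ((n : ℝ) - 1) * ADM.unitSphereArea n) * ADM.totalScalarCurvature (gs ℓ))
      atTop
      (𝓝 (ADM.admMass Φ g
        - 1 / (2 * ((n : ℝ) - 1) * ADM.unitSphereArea n) * ADM.totalScalarCurvature g)) ∧
    ((∀ ℓ x, 0 ≤ ADM.scalarCurvature (gs ℓ) x) →
      (ADM.admMass Φ g : EReal) ≤ liminf (fun ℓ => (ADM.admMass Φ (gs ℓ) : EReal)) atTop) := by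
  have hn' : (3 : ℝ) ≤ n := by exact_mod_cast hn
  -- Dimension at least three makes `(n - 2) / 2`, and hence `τ`, positive.
  have hτ0 : 0 < τ := by linarith
  have hτn : (n : ℝ) < 2 + 2 * τ := by linarith
  have hex : ∀ g : ADM.C2Metric I M, ADM.IsAsymptoticallyFlat Φ τ g →
      Tendsto (ADM.admFlux Φ g) atTop (𝓝 (ADM.admMass Φ g)) := fun g hg =>
    tendsto_nhds_limUnder
      ⟨_, ADM.tendsto_admFlux_of_lt (by omega) hτ0 hτn hg (lt_add_one Φ.r₀)⟩
  exact ⟨fun ℓ => hex _ (hgs ℓ), hex g hg,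
    ADM.tendsto_admMass_sub_totalScalarCurvature (by omega) hτ0 hτn hgs hg hconv,
    ADM.admMass_le_liminf (by omega) hτ0 hτn hgs hg hconv⟩
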